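/- Let $g$ be a smooth metric of signature $(-,+,+,+)$ on an oriented four-dimensional spacetime; all notions are local, so tensors are given by their components in a positively oriented coordinate domain $\Omega$. Let $\eta$ be the metric volume element, $W$ the Weyl tensor, $(*F)_{\alpha\beta}=\frac12\eta_{\alpha\beta\mu\nu}F^{\mu\nu}$, $\mathcal W=\frac12(W-\mathrm i *W)$ and $\mathcal G=\frac12(G-\mathrm i\,\eta)$ with $G_{\alpha\beta\mu\nu}=g_{\alpha\mu}g_{\beta\nu}-g_{\alpha\nu}g_{\beta\mu}$. For double bivectors $T,S$ and complex bivectors $\mathcal X,\mathcal Y$ put $T(\mathcal X)_{\alpha\beta}=\frac12T_{\alpha\beta\mu\nu}\mathcal X^{\mu\nu}$, $T(\mathcal X,\mathcal Y)=\frac14T_{\alpha\beta\mu\nu}\mathcal X^{\alpha\beta}\mathcal Y^{\mu\nu}$, $(TS)_{\alpha\beta\mu\nu}=\frac12T_{\alpha\beta\lambda\rho}S^{\lambda\rho}{}_{\mu\nu}$ and $(\mathcal X,\mathcal Y)=\mathcal G(\mathcal X,\mathcal Y)$. Assume that $W$ is of Petrov–Bel type III at every point of $\Omega$, that is, $\mathcal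 W^2\neq0$ and $\mathcal W^3=0$. A Weyl principal frame is a smooth oriented orthonormal frame $\{e_0,e_1,e_2,e_3\}$ such that $\mathcal W=\mathcal U_1\otimes\ell_++\ell_+\otimes\mathcal U_1$, where $\mathcal U_A=\frac1{\sqrt2}(e_0\wedge e_A-\mathrm i*(e_0\wedge e_A))$ and $\ell_\pm=\frac1{\sqrt2}(\mathcal U_2\pm\mathrm i\,\mathcal U_3)$. The connection tensor of a frame $\{e_a\}$ with dual basis $\{\theta^a\}$ is $H=\gamma^c_{ab}\,\theta^b\otimes\theta^a\otimes e_c$, where $\nabla e_a=\gamma^c_{ab}\,\theta^b\otimes e_c$. Every point of $\Omega$ has a neighbourhood on which a Weyl principal frame exists. Let $\{e_a\}$ be any Weyl principal frame on an open set $V\subseteq\Omega$, let $\mathcal X$ be any smooth field of complex bivectors on $V$ with $\mathcal W^2(\mathcal X)\neq0$ everywhere, and let $\sqrt{-\mathcal W^2(\mathcal X,\mathcal X)}$ denote any continuous branch of the square root on $V$. Put $$\mathcal L_+=-\frac{\mathcal W^2(\mathcal X)}{\sqrt{-\mathcal W^2(\mathcal X,\mathcal X)}},\qquad \mathcal U=\frac{1}{2(\mathcal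 L_+,\mathcal X)^2}\big[2(\mathcal L_+,\mathcal X)\,\mathcal W(\mathcal X)-\mathcal W(\mathcal X,\mathcal X)\,\mathcal L_+\big],$$ $$\mathcal L_-=\frac{1}{2(\mathcal L_+,\mathcal X)^2}\big[\mathcal S(\mathcal X,\mathcal X)\,\mathcal L_+-2(\mathcal L_+,\mathcal X)\,\mathcal S(\mathcal X)\big],\qquad \mathcal S=\mathcal G+\mathcal U\otimes\mathcal U .$$ Then the denominators do not vanish; at every point $(\mathcal U,\mathcal L_+,\mathcal L_-)=\pm(\mathcal U_1,\ell_+,\ell_-)$ with one common sign; and the connection tensor $H$ of the frame is $$H=\frac1{\sqrt2}(\mathcal H+\bar{\mathcal H}),\qquad \mathcal H=-\frac1{\sqrt2}\big(\nabla\mathcal U\cdot\mathcal U+\nabla\mathcal L_+\cdot\mathcal L_-+\nabla\mathcal L_-\cdot\mathcal L_+\big),$$ where $(\nabla A\cdot B)_{\alpha\mu\nu}=\nabla_\alpha A_{\mu\lambda}\,B^{\lambda}{}_{\nu}$. -/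

import Mathlib

open scoped ContDiff

noncomputable section

namespace Spacetime

/-! # Pointwise algebra of a Lorentzian metric

All tensors are given by their covariant components in a coordinate basis, so that a tensor and its
metric equivalents share one symbol. `G` denotes the matrix of the metric at a point. Bivectors have
complex components. -/

/-- Bivectors, and more generally covariant 2-tensors, at a point. -/
abbrev Tensor2 := Matrix (Fin 4) (Fin 4) ℂ

/-- Double bivectors, and more generally covariant 4-tensors, at a point. -/
abbrev Tensor4 := Fin 4 → Fin 4 → Fin 4 → Fin 4 → ℂ

/-- The signature symbol `diag(-1,1,1,1)`. -/
def minkowski : Matrix (Fin 4) (Fin 4) ℝ := Matrix.diagonal ![-1, 1, 1, 1]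

/-- The Levi-Civita symbol with `ε₀₁₂₃ = 1`: the sign of a permutation, and `0` if an index is
repeated. -/
def leviCivita (α β γ δ : Fin 4) : ℝ :=
  Matrix.det (Matrix.of fun i j : Fin 4 => if ![α, β, γ, δ] i = j then (1 : ℝ) else 0)

/-- The metric volume element `η` of positively oriented coordinates. -/
def vol (G : Matrix (Fin 4) (Fin 4) ℝ) (α β γ δ : Fin 4) : ℝ :=
  √|G.det| * leviCivita α β γ δ

/-- Raising both indices of a 2-tensor: `X^{αβ}`. -/
def raise (G : Matrix (Fin 4) (Fin 4) ℝ) (X : Tensor2) : Tensor2 := Matrix.of fun α β =>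
  ∑ ρ, ∑ σ, ((G⁻¹ α ρ : ℝ) : ℂ) * ((G⁻¹ β σ : ℝ) : ℂ) * X ρ σ

/-- The Hodge dual of a bivector, `(*X)_{αβ} = ½ η_{αβμν} X^{μν}`. -/
def hodge (G : Matrix (Fin 4) (Fin 4) ℝ) (X : Tensor2) : Tensor2 := Matrix.of fun α β =>
  (1 / 2 : ℂ) * ∑ μ, ∑ ν, (vol G α β μ ν : ℂ) * raise G X μ ν

/-- The image of a bivector under a double bivector, `T(X)_{αβ} = ½ T_{αβμν} X^{μν}`. -/
def image (G : Matrix (Fin 4) (Fin 4) ℝ) (T : Tensor4) (X : Tensor2) : Tensor2 :=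
  Matrix.of fun α β => (1 / 2 : ℂ) * ∑ μ, ∑ ν, T α β μ ν * raise G X μ ν

/-- A double bivector as a bilinear form, `T(X,Y) = ¼ T_{αβμν} X^{αβ} Y^{μν}`. -/
def form (G : Matrix (Fin 4) (Fin 4) ℝ) (T : Tensor4) (X Y : Tensor2) : ℂ :=
  (1 / 4 : ℂ) * ∑ α, ∑ β, ∑ μ, ∑ ν, T α β μ ν * raise G X α β * raise G Y μ ν

/-- Composition of double bivectors, `(S T)_{αβμν} = ½ S_{αβλρ} T^{λρ}_{μν}`. -/
def comp (G : Matrix (Fin 4) (Fin 4) ℝ) (S T : Tensor4) : Tensor4 := fun α β μ ν =>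
  (1 / 2 : ℂ) * ∑ κ, ∑ ρ, S α β κ ρ * raise G (Matrix.of fun κ' ρ' => T κ' ρ' μ ν) κ ρ

/-- The induced metric on self-dual bivectors, `𝓖 = ½ (G - i η)` with
`G_{αβμν} = g_{αμ} g_{βν} - g_{αν} g_{βμ}`. -/
def calG (G : Matrix (Fin 4) (Fin 4) ℝ) : Tensor4 := fun α β μ ν =>
  (1 / 2 : ℂ) * (((G α μ * G β ν - G α ν * G β μ : ℝ) : ℂ) - Complex.I * (vol G α β μ ν : ℂ))

/-- Scalar product `(X, Y) = 𝓖(X, Y)` of bivectors. -/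
def ip (G : Matrix (Fin 4) (Fin 4) ℝ) (X Y : Tensor2) : ℂ := form G (calG G) X Y

/-- The tensor product `A ⊗ B` of two bivectors. -/
def tensor (A B : Tensor2) : Tensor4 := fun α β μ ν => A α β * B μ ν

/-- Contraction of adjacent indices, `(A · B)_{μν} = A_{μλ} B^λ_ν`. -/
def dot (G : Matrix (Fin 4) (Fin 4) ℝ) (A B : Tensor2) : Tensor2 := Matrix.of fun μ ν =>
  ∑ κ, ∑ ρ, A μ κ * ((G⁻¹ κ ρ : ℝ) : ℂ) * B ρ ν

/-- `e₀ ∧ e_A = e₀ ⊗ e_A - e_A ⊗ e₀` with lowered indices, for a tetrad `e` of vectors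
(`e a μ` is the contravariant component `(e_a)^μ`). -/
def frameWedge (G : Matrix (Fin 4) (Fin 4) ℝ) (e : Fin 4 → Fin 4 → ℝ) (A : Fin 4) : Tensor2 :=
  Matrix.of fun α β =>
    ((G.mulVec (e 0) α * G.mulVec (e A) β - G.mulVec (e A) α * G.mulVec (e 0) β : ℝ) : ℂ)

/-- The self-dual bivectors `𝓤_A = (U_A - i *U_A)/√2`, `U_A = e₀ ∧ e_A`, of a tetrad. -/
def frameU (G : Matrix (Fin 4) (Fin 4) ℝ) (e : Fin 4 → Fin 4 → ℝ) (A : Fin 4) : Tensor2 :=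
  (1 / (√2 : ℝ) : ℂ) • (frameWedge G e A - Complex.I • hodge G (frameWedge G e A))

/-- The null bivector `𝓛₊ = (𝓤₂ + i 𝓤₃)/√2` of a tetrad. -/
def frameLp (G : Matrix (Fin 4) (Fin 4) ℝ) (e : Fin 4 → Fin 4 → ℝ) : Tensor2 :=
  (1 / (√2 : ℝ) : ℂ) • (frameU G e 2 + Complex.I • frameU G e 3)

/-- The null bivector `𝓛₋ = (𝓤₂ - i 𝓤₃)/√2` of a tetrad. -/
def frameLm (G : Matrix (Fin 4) (Fin 4) ℝ) (e : Fin 4 → Fin 4 → ℝ) : Tensor2 :=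
  (1 / (√2 : ℝ) : ℂ) • (frameU G e 2 - Complex.I • frameU G e 3)

/-! # Curvature in a coordinate domain -/

/-- A smooth metric of signature `(-,+,+,+)` on a coordinate domain `Ω ⊆ ℝ⁴`. -/
structure IsLorentzMetricOn (Ω : Set (Fin 4 → ℝ)) (g : (Fin 4 → ℝ) → Matrix (Fin 4) (Fin 4) ℝ) :
    Prop where
  smooth : ∀ μ ν, ContDiffOn ℝ ∞ (fun x => g x μ ν) Ω
  symm : ∀ x ∈ Ω, (g x).IsSymm
  signature : ∀ x ∈ Ω, ∃ E : Matrix (Fin 4) (Fin 4) ℝ, E.transpose * g x * E = minkowski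

/-- The partial derivative `∂_μ f` of a real or complex function. -/
def pd {F : Type} [NormedAddCommGroup F] [NormedSpace ℝ F] (μ : Fin 4) (f : (Fin 4 → ℝ) → F)
    (x : Fin 4 → ℝ) : F :=
  fderiv ℝ f x (Pi.single μ 1)

variable (g : (Fin 4 → ℝ) → Matrix (Fin 4) (Fin 4) ℝ)

/-- Christoffel symbols `Γ^ρ_{μν}` of the Levi-Civita connection. -/
def christoffel (ρ μ ν : Fin 4) (x : Fin 4 → ℝ) : ℝ :=
  (1 / 2) * ∑ σ, (g x)⁻¹ ρ σ *
    (pd μ (fun y => g y σ ν) x + pd ν (fun y => g y σ μ) x - pd σ (fun y => g y μ ν) x)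

/-- The Riemann tensor `R^ρ_{σμν}`. -/
def riemannUp (ρ σ μ ν : Fin 4) (x : Fin 4 → ℝ) : ℝ :=
  pd μ (christoffel g ρ ν σ) x - pd ν (christoffel g ρ μ σ) x +
    ∑ κ, (christoffel g ρ μ κ x * christoffel g κ ν σ x -
      christoffel g ρ ν κ x * christoffel g κ μ σ x)

/-- The Riemann tensor `R_{αβμν}`. -/
def riemann (α β μ ν : Fin 4) (x : Fin 4 → ℝ) : ℝ := ∑ ρ, g x α ρ * riemannUp g ρ β μ ν x

/-- The Ricci tensor `R_{βν} = R^α_{βαν}`. -/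
def ricci (β ν : Fin 4) (x : Fin 4 → ℝ) : ℝ := ∑ α, riemannUp g α β α ν x

/-- The scalar curvature. -/
def scalarCurv (x : Fin 4 → ℝ) : ℝ := ∑ β, ∑ ν, (g x)⁻¹ β ν * ricci g β ν x

/-- The Weyl tensor `W_{αβμν}`. -/
def weyl (α β μ ν : Fin 4) (x : Fin 4 → ℝ) : ℝ :=
  riemann g α β μ ν x
    - (1 / 2) * (g x α μ * ricci g β ν x - g x α ν * ricci g β μ x
        - g x β μ * ricci g α ν x + g x β ν * ricci g α μ x)
    + (1 / 6) * scalarCurv g x * (g x α μ * g x β ν - g x α ν * g x β μ)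

/-- The self-dual Weyl tensor `𝓦 = ½ (W - i *W)`, `(*W)_{αβμν} = ½ η_{αβρσ} W^{ρσ}_{μν}`. -/
def calW (x : Fin 4 → ℝ) : Tensor4 := fun α β μ ν =>
  (1 / 2 : ℂ) * ((weyl g α β μ ν x : ℂ) -
    Complex.I * hodge (g x) (Matrix.of fun ρ σ => (weyl g ρ σ μ ν x : ℂ)) α β)

/-- `𝓦²`. -/
def calW2 (x : Fin 4 → ℝ) : Tensor4 := comp (g x) (calW g x) (calW g x)

/-- The Weyl tensor is of Petrov-Bel type III at `x`: as an endomorphism of the space of self-dual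
bivectors, `𝓦` is nilpotent with `𝓦³ = 0` and `𝓦² ≠ 0`. -/
def IsTypeIII (x : Fin 4 → ℝ) : Prop :=
  calW2 g x ≠ 0 ∧ comp (g x) (calW g x) (calW2 g x) = 0

/-- The covariant derivative of a bivector field: `nablaB g B α x μ ν = ∇_α B_{μν}`. -/
def nablaB (B : (Fin 4 → ℝ) → Tensor2) (α : Fin 4) (x : Fin 4 → ℝ) : Tensor2 :=
  Matrix.of fun μ ν => pd α (fun y => B y μ ν) x -
    ∑ ρ, ((christoffel g ρ α μ x : ℂ) * B x ρ ν + (christoffel g ρ α ν x : ℂ) * B x μ ρ)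

/-- The covariant derivative of a vector field: `nablaV g v α μ x = ∇_α v^μ`. -/
def nablaV (v : (Fin 4 → ℝ) → Fin 4 → ℝ) (α μ : Fin 4) (x : Fin 4 → ℝ) : ℝ :=
  pd α (fun y => v y μ) x + ∑ ρ, christoffel g μ α ρ x * v x ρ

/-! # Frames and the connection tensor -/

/-- `e` is a smooth oriented orthonormal frame on `V` (`e a x μ` is the component `(e_a)^μ` at
`x`). -/
structure IsOrientedFrameOn (V : Set (Fin 4 → ℝ)) (e : Fin 4 → (Fin 4 → ℝ) → Fin 4 → ℝ) :
    Prop where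
  smooth : ∀ a, ContDiffOn ℝ ∞ (e a) V
  orthonormal : ∀ x ∈ V, ∀ a b, ∑ μ, ∑ ν, g x μ ν * e a x μ * e b x ν = minkowski a b
  oriented : ∀ x ∈ V,
    ∑ α, ∑ β, ∑ γ, ∑ δ, vol (g x) α β γ δ * e 0 x α * e 1 x β * e 2 x γ * e 3 x δ = 1

/-- `e` is a Weyl principal frame on `V` for a type III Weyl tensor: its bivectors
`𝓤 = 𝓤₁` and `𝓛₊` give the canonical form `𝓦 = 𝓤 ⊗ 𝓛₊ + 𝓛₊ ⊗ 𝓤`. -/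
structure IsWeylPrincipalFrameOn (V : Set (Fin 4 → ℝ)) (e : Fin 4 → (Fin 4 → ℝ) → Fin 4 → ℝ) :
    Prop extends IsOrientedFrameOn g V e where
  canonical : ∀ x ∈ V,
    calW g x = tensor (frameU (g x) (fun a => e a x) 1) (frameLp (g x) fun a => e a x) +
      tensor (frameLp (g x) fun a => e a x) (frameU (g x) (fun a => e a x) 1)

/-- The algebraic dual basis: `coframe e x c μ = (θ^c)_μ`. -/
def coframe (e : Fin 4 → (Fin 4 → ℝ) → Fin 4 → ℝ) (x : Fin 4 → ℝ) (c μ : Fin 4) : ℝ :=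
  (Matrix.of fun a ν => e a x ν)⁻¹ μ c

/-- Connection coefficients `γ^c_{ab}` of a frame, `∇ e_a = γ^c_{ab} θ^b ⊗ e_c`. -/
def connCoeff (e : Fin 4 → (Fin 4 → ℝ) → Fin 4 → ℝ) (c a b : Fin 4) (x : Fin 4 → ℝ) : ℝ :=
  ∑ κ, ∑ μ, coframe e x c μ * e b x κ * nablaV g (e a) κ μ x

/-- The connection tensor `H = γ^c_{ab} θ^b ⊗ θ^a ⊗ e_c` of a frame, with all indices lowered:
`connTensor g e x α μ ν = H_{αμν}`. -/
def connTensor (e : Fin 4 → (Fin 4 → ℝ) → Fin 4 → ℝ) (x : Fin 4 → ℝ) (α μ ν : Fin 4) : ℝ :=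
  ∑ a, ∑ b, ∑ c, connCoeff g e c a b x * coframe e x b α * coframe e x a μ *
    (g x).mulVec (e c x) ν

/-- `𝓗 = -(∇𝓤·𝓤 + ∇𝓛₊·𝓛₋ + ∇𝓛₋·𝓛₊)/√2` for fields of bivectors `𝓤`, `𝓛₊`, `𝓛₋`;
`calH g U Lp Lm x α μ ν = 𝓗_{αμν}`. -/
def calH (U Lp Lm : (Fin 4 → ℝ) → Tensor2) (x : Fin 4 → ℝ) (α : Fin 4) : Tensor2 :=
  -(1 / (√2 : ℝ) : ℂ) • (dot (g x) (nablaB g U α x) (U x) +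
    dot (g x) (nablaB g Lp α x) (Lm x) + dot (g x) (nablaB g Lm α x) (Lp x))

/-! # The bivectors computed from the Weyl tensor

`X` is a field of bivectors and `s` a branch of the square root `√(-𝓦²(X,X))`. -/

/-- `𝓛₊ = -𝓦²(X)/√(-𝓦²(X,X))`. -/
def weylLp (X : (Fin 4 → ℝ) → Tensor2) (s : (Fin 4 → ℝ) → ℂ) (x : Fin 4 → ℝ) : Tensor2 :=
  -((s x)⁻¹ • image (g x) (calW2 g x) (X x))

/-- `𝓤 = [2 (𝓛₊,X) 𝓦(X) - 𝓦(X,X) 𝓛₊] / (2 (𝓛₊,X)²)`. -/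
def weylU (X : (Fin 4 → ℝ) → Tensor2) (s : (Fin 4 → ℝ) → ℂ) (x : Fin 4 → ℝ) : Tensor2 :=
  (1 / (2 * ip (g x) (weylLp g X s x) (X x) ^ 2)) •
    ((2 * ip (g x) (weylLp g X s x) (X x)) • image (g x) (calW g x) (X x) -
      form (g x) (calW g x) (X x) (X x) • weylLp g X s x)

/-- `𝓢 = 𝓖 + 𝓤 ⊗ 𝓤`. -/
def weylS (X : (Fin 4 → ℝ) → Tensor2) (s : (Fin 4 → ℝ) → ℂ) (x : Fin 4 → ℝ) : Tensor4 :=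
  calG (g x) + tensor (weylU g X s x) (weylU g X s x)

/-- `𝓛₋ = [𝓢(X,X) 𝓛₊ - 2 (𝓛₊,X) 𝓢(X)] / (2 (𝓛₊,X)²)`. -/
def weylLm (X : (Fin 4 → ℝ) → Tensor2) (s : (Fin 4 → ℝ) → ℂ) (x : Fin 4 → ℝ) : Tensor2 :=
  (1 / (2 * ip (g x) (weylLp g X s x) (X x) ^ 2)) •
    (form (g x) (weylS g X s x) (X x) (X x) • weylLp g X s x -
      (2 * ip (g x) (weylLp g X s x) (X x)) • image (g x) (weylS g X s x) (X x))

end Spacetime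

end

noncomputable section

namespace Spacetime

open Filter Topology
open scoped ComplexConjugate

section

/-! # Tensors in the components of a coframe -/

/-! All pointwise operations commute with passage to the components of an oriented orthonormal
coframe `θ` (`pull`), so tensor identities need checking only for the Minkowski metric, where `sd 0,
sd 1, sd 2` is an orthogonal basis of the self-dual bivectors.

Algebra. If 𝓦 = 𝓤₁⊗ℓ₊ + ℓ₊⊗𝓤₁, then (ℓ₊,ℓ₊) = (𝓤₁,ℓ₊) = 0 and (𝓤₁,𝓤₁) = -1 give 𝓦² = -ℓ₊⊗ℓ₊. Hence
𝓦²(X) = -(ℓ₊,X)ℓ₊ and -𝓦²(X,X) = (ℓ₊,X)². The square root is therefore ε(ℓ₊,X) with ε = ±1, nonzero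
because 𝓦²(X) ≠ 0, and substitution into the three formulas gives ε times the triad of the frame
(`weylTriad_eq`).

Connection. Both the root and (ℓ₊,X) are continuous and nonzero, so ε is locally constant; it enters
𝓗 only squared. Write ∇θ = ωθ, with ω in the Lorentz algebra (`conn_antisymm`). A bivector with
constant components X has a derivative with components ωᵀX + Xω (`nablaB_pull`). Summing these
derivatives against the triad returns a multiple of the self-dual part of ω, and adding the
conjugate recovers all of ω (`sum_covC_sd`), which is the connection tensor up to sign and index
position (`connTensor_eq`).

Existence at a point. The symmetries and trace-freeness of the Weyl tensor turn 𝓦 into a symmetric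
complex 3×3 matrix w, and type III becomes w² ≠ 0, w³ = 0. Then w² has rank one and is spanned by a
null vector, the square of a spinor. A spin frame completing this spinor, corrected by a null
rotation, brings w to canonical form (`exists_spin_canonical`), and the action of SL(2,ℂ) on
coframes realizes the spin frame by an orthonormal coframe.

Smoothness. Coframes chosen point by point need not vary smoothly, but the formulas for 𝓤, 𝓛₊, 𝓛₋
with constant X do. A cubic contraction of the computed triad equals ε, so the sign can be divided
out (`triad_sign`). The coframe is recovered algebraically from its self-dual bivectors up to a
factor -1, which is fixed by the sign of θ⁰ on a fixed vector (`exists_smooth_coframe`). -/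

/-- A real matrix with complex entries. -/
def toC {m n : Type*} (M : Matrix m n ℝ) : Matrix m n ℂ := M.map Complex.ofReal

@[simp] lemma toC_apply {m n : Type*} (M : Matrix m n ℝ) (i : m) (j : n) : toC M i j = (M i j : ℂ) :=
  rfl

lemma toC_mul (M N : Matrix (Fin 4) (Fin 4) ℝ) : toC (M * N) = toC M * toC N := by
  ext i j; simp [Matrix.mul_apply]

lemma toC_transpose (M : Matrix (Fin 4) (Fin 4) ℝ) : toC M.transpose = (toC M).transpose := rfl

@[simp] lemma toC_one : toC (1 : Matrix (Fin 4) (Fin 4) ℝ) = 1 := by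
  ext i j; by_cases h : i = j <;> simp [Matrix.one_apply, h]

/-- The rows of `θ` are an oriented orthonormal coframe of the metric `G`. -/
structure IsCoframe (G θ : Matrix (Fin 4) (Fin 4) ℝ) : Prop where
  metric : θ.transpose * minkowski * θ = G
  pos : 0 < θ.det

lemma minkowski_mul_self : minkowski * minkowski = 1 := by
  rw [minkowski, Matrix.diagonal_mul_diagonal, ← Matrix.diagonal_one]
  congr 1; ext i; fin_cases i <;> simp

lemma minkowski_transpose : minkowski.transpose = minkowski := by
  simp [minkowski]

lemma minkowski_inv : minkowski⁻¹ = minkowski := Matrix.inv_eq_left_inv minkowski_mul_self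

lemma minkowski_det : minkowski.det = -1 := by
  simp [minkowski, Fin.prod_univ_four]

namespace IsCoframe
variable {G θ : Matrix (Fin 4) (Fin 4) ℝ}

lemma isUnit_det (h : IsCoframe G θ) : IsUnit θ.det := h.pos.ne'.isUnit

lemma mul_inv (h : IsCoframe G θ) : θ * θ⁻¹ = 1 := Matrix.mul_nonsing_inv _ h.isUnit_det

lemma inv_mul (h : IsCoframe G θ) : θ⁻¹ * θ = 1 := Matrix.nonsing_inv_mul _ h.isUnit_det

lemma toC_mul_inv (h : IsCoframe G θ) : toC θ * toC θ⁻¹ = 1 := by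
  rw [← toC_mul, h.mul_inv, toC_one]

lemma metric_inv (h : IsCoframe G θ) : G⁻¹ = θ⁻¹ * minkowski * θ⁻¹.transpose := by
  rw [← h.metric, Matrix.mul_inv_rev, Matrix.mul_inv_rev, minkowski_inv,
    Matrix.transpose_nonsing_inv, Matrix.mul_assoc]

lemma det_metric (h : IsCoframe G θ) : G.det = -(θ.det) ^ 2 := by
  rw [← h.metric, Matrix.det_mul, Matrix.det_mul, Matrix.det_transpose, minkowski_det]; ring

lemma sqrt_det (h : IsCoframe G θ) : √|G.det| = θ.det := by
  rw [h.det_metric, abs_neg, abs_of_nonneg (sq_nonneg _), Real.sqrt_sq h.pos.le]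

end IsCoframe

lemma raise_eq (G : Matrix (Fin 4) (Fin 4) ℝ) (X : Tensor2) :
    raise G X = toC G⁻¹ * X * (toC G⁻¹).transpose := by
  ext α β
  simp only [raise, Matrix.of_apply, Matrix.mul_apply, Matrix.transpose_apply, toC_apply,
    Finset.sum_mul]
  rw [Finset.sum_comm]
  refine Finset.sum_congr rfl fun _ _ => Finset.sum_congr rfl fun _ _ => by ring

/-- The covariant 2-tensor whose components in the coframe `θ` are `X`. -/
def pull (θ : Matrix (Fin 4) (Fin 4) ℝ) : Tensor2 →ₗ[ℂ] Tensor2 where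
  toFun X := (toC θ).transpose * X * toC θ
  map_add' X Y := by rw [Matrix.mul_add, Matrix.add_mul]
  map_smul' c X := by simp

lemma pull_apply (θ : Matrix (Fin 4) (Fin 4) ℝ) (X : Tensor2) :
    pull θ X = (toC θ).transpose * X * toC θ := rfl

lemma pull_pull (A B : Matrix (Fin 4) (Fin 4) ℝ) (X : Tensor2) :
    pull A (pull B X) = pull (B * A) X := by
  simp only [pull_apply, toC_mul, Matrix.transpose_mul, Matrix.mul_assoc]

lemma pull_one (X : Tensor2) : pull 1 X = X := by simp [pull_apply]

lemma pull_entry (θ : Matrix (Fin 4) (Fin 4) ℝ) (X : Tensor2) (α β : Fin 4) :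
    pull θ X α β = ∑ a, ∑ b, (θ a α : ℂ) * X a b * (θ b β : ℂ) := by
  simp only [pull_apply, Matrix.mul_apply, Matrix.transpose_apply, toC_apply, Finset.sum_mul]
  rw [Finset.sum_comm]

lemma toC_metric_inv {G θ : Matrix (Fin 4) (Fin 4) ℝ} (h : IsCoframe G θ) :
    toC G⁻¹ = toC θ⁻¹ * toC minkowski * (toC θ⁻¹).transpose := by
  rw [h.metric_inv, toC_mul, toC_mul, toC_transpose]

lemma toC_minkowski_transpose : (toC minkowski).transpose = toC minkowski := by
  rw [← toC_transpose, minkowski_transpose]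

lemma raise_minkowski (X : Tensor2) : raise minkowski X = toC minkowski * X * toC minkowski := by
  rw [raise_eq, minkowski_inv, toC_minkowski_transpose]

/-- Raised indices carry θ⁻¹ where lowered ones carry θ, so in every contraction the two cancel. All
later reductions to Minkowski components rest on this. -/
lemma raise_pull {G θ : Matrix (Fin 4) (Fin 4) ℝ} (h : IsCoframe G θ) (X : Tensor2) :
    raise G (pull θ X) = toC θ⁻¹ * raise minkowski X * (toC θ⁻¹).transpose := by
  have h1 := h.toC_mul_inv
  have h2 : (toC θ⁻¹).transpose * (toC θ).transpose = 1 := by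
    rw [← Matrix.transpose_mul, h1, Matrix.transpose_one]
  rw [raise_eq, raise_minkowski, toC_metric_inv h, pull_apply]
  simp only [Matrix.transpose_mul, Matrix.transpose_transpose, toC_minkowski_transpose]
  calc _ = toC θ⁻¹ * toC minkowski * ((toC θ⁻¹).transpose * (toC θ).transpose) * X *
        (toC θ * toC θ⁻¹) * (toC minkowski * (toC θ⁻¹).transpose) := by
        simp only [Matrix.mul_assoc]
    _ = _ := by rw [h1, h2]; simp only [Matrix.mul_assoc, Matrix.mul_one]

lemma sum_pull_mul (A X Y : Tensor2) :
    ∑ μ, ∑ ν, (A.transpose * X * A) μ ν * Y μ ν =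
      ∑ c, ∑ d, X c d * (A * Y * A.transpose) c d := by
  have key : ∀ P Q : Tensor2, ∑ μ, ∑ ν, P μ ν * Q μ ν = (P * Q.transpose).trace := fun P Q => by
    simp [Matrix.trace, Matrix.mul_apply]
  rw [key, key]
  simp only [Matrix.transpose_mul, Matrix.transpose_transpose]
  rw [Matrix.mul_assoc, Matrix.mul_assoc, Matrix.trace_mul_comm]
  simp only [Matrix.mul_assoc]

/-- The scalar product `½ A_{μν} B^{μν}` of bivectors. -/
def pair (G : Matrix (Fin 4) (Fin 4) ℝ) (A B : Tensor2) : ℂ :=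
  (1 / 2 : ℂ) * ∑ μ, ∑ ν, A μ ν * raise G B μ ν

lemma pair_pull {G θ : Matrix (Fin 4) (Fin 4) ℝ} (h : IsCoframe G θ) (X Y : Tensor2) :
    pair G (pull θ X) (pull θ Y) = pair minkowski X Y := by
  have h1 := h.toC_mul_inv
  have h2 : (toC θ⁻¹).transpose * (toC θ).transpose = 1 := by
    rw [← Matrix.transpose_mul, h1, Matrix.transpose_one]
  have h3 : toC θ * (toC θ⁻¹ * raise minkowski Y * (toC θ⁻¹).transpose) * (toC θ).transpose =
      raise minkowski Y := by
    calc _ = (toC θ * toC θ⁻¹) * raise minkowski Y *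
          ((toC θ⁻¹).transpose * (toC θ).transpose) := by simp only [Matrix.mul_assoc]
      _ = _ := by rw [h1, h2, Matrix.mul_one, Matrix.one_mul]
  rw [pair, pair, raise_pull h, pull_apply, sum_pull_mul, h3]

lemma dot_eq (G : Matrix (Fin 4) (Fin 4) ℝ) (A B : Tensor2) : dot G A B = A * toC G⁻¹ * B := by
  ext μ ν
  simp only [dot, Matrix.of_apply, Matrix.mul_apply, toC_apply, Finset.sum_mul]
  rw [Finset.sum_comm]

lemma dot_pull {G θ : Matrix (Fin 4) (Fin 4) ℝ} (h : IsCoframe G θ) (X Y : Tensor2) :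
    dot G (pull θ X) (pull θ Y) = pull θ (X * toC minkowski * Y) := by
  have h1 := h.toC_mul_inv
  have h2 : (toC θ⁻¹).transpose * (toC θ).transpose = 1 := by
    rw [← Matrix.transpose_mul, h1, Matrix.transpose_one]
  rw [dot_eq, toC_metric_inv h]
  simp only [pull_apply]
  calc _ = (toC θ).transpose * X * (toC θ * toC θ⁻¹) * toC minkowski *
        ((toC θ⁻¹).transpose * (toC θ).transpose) * Y * toC θ := by
        simp only [Matrix.mul_assoc]
    _ = _ := by rw [h1, h2]; simp only [Matrix.mul_assoc, Matrix.mul_one]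

/-! ## Tensor products -/

lemma tensor_smul_left (c : ℂ) (A B : Tensor2) : tensor (c • A) B = c • tensor A B := by
  funext α β μ ν; simp [tensor, mul_assoc]

lemma tensor_smul_right (c : ℂ) (A B : Tensor2) : tensor A (c • B) = c • tensor A B := by
  funext α β μ ν; simp [tensor]; ring

lemma image_add (G : Matrix (Fin 4) (Fin 4) ℝ) (S T : Tensor4) (X : Tensor2) :
    image G (S + T) X = image G S X + image G T X := by
  ext α β; simp [image, add_mul, Finset.sum_add_distrib, mul_add]

lemma image_smul (G : Matrix (Fin 4) (Fin 4) ℝ) (c : ℂ) (T : Tensor4) (X : Tensor2) :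
    image G (c • T) X = c • image G T X := by
  ext α β; simp only [image, Matrix.of_apply, Matrix.smul_apply, Pi.smul_apply, smul_eq_mul,
    Finset.mul_sum]
  refine Finset.sum_congr rfl fun _ _ => Finset.sum_congr rfl fun _ _ => by ring

lemma image_tensor (G : Matrix (Fin 4) (Fin 4) ℝ) (A B X : Tensor2) :
    image G (tensor A B) X = pair G B X • A := by
  ext α β
  simp only [image, tensor, pair, Matrix.of_apply, Matrix.smul_apply, smul_eq_mul, Finset.mul_sum,
    Finset.sum_mul]
  refine Finset.sum_congr rfl fun _ _ => Finset.sum_congr rfl fun _ _ => by ring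

lemma form_eq_pair_image (G : Matrix (Fin 4) (Fin 4) ℝ) (T : Tensor4) (X Y : Tensor2) :
    form G T X Y = pair G (image G T Y) X := by
  simp only [form, pair, image, Matrix.of_apply, Finset.mul_sum, Finset.sum_mul]
  refine Finset.sum_congr rfl fun _ _ => Finset.sum_congr rfl fun _ _ => Finset.sum_congr rfl
    fun _ _ => Finset.sum_congr rfl fun _ _ => by ring

lemma pair_add_left (G : Matrix (Fin 4) (Fin 4) ℝ) (A A' B : Tensor2) :
    pair G (A + A') B = pair G A B + pair G A' B := by
  simp [pair, add_mul, Finset.sum_add_distrib, mul_add]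

lemma pair_smul_left (G : Matrix (Fin 4) (Fin 4) ℝ) (c : ℂ) (A B : Tensor2) :
    pair G (c • A) B = c * pair G A B := by
  simp only [pair, Matrix.smul_apply, smul_eq_mul, Finset.mul_sum]
  refine Finset.sum_congr rfl fun _ _ => Finset.sum_congr rfl fun _ _ => by ring

lemma comp_add_left (G : Matrix (Fin 4) (Fin 4) ℝ) (S S' T : Tensor4) :
    comp G (S + S') T = comp G S T + comp G S' T := by
  funext α β μ ν; simp [comp, add_mul, Finset.sum_add_distrib, mul_add]

lemma raise_smul (G : Matrix (Fin 4) (Fin 4) ℝ) (c : ℂ) (X : Tensor2) :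
    raise G (c • X) = c • raise G X := by
  rw [raise_eq, raise_eq]; simp

lemma raise_add (G : Matrix (Fin 4) (Fin 4) ℝ) (X Y : Tensor2) :
    raise G (X + Y) = raise G X + raise G Y := by
  simp only [raise_eq, Matrix.mul_add, Matrix.add_mul]

lemma comp_add_right (G : Matrix (Fin 4) (Fin 4) ℝ) (S T T' : Tensor4) :
    comp G S (T + T') = comp G S T + comp G S T' := by
  funext α β μ ν
  have : (Matrix.of fun κ' ρ' => (T + T') κ' ρ' μ ν) = (Matrix.of fun κ' ρ' => T κ' ρ' μ ν) +
    Matrix.of fun κ' ρ' => T' κ' ρ' μ ν := rfl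
  rw [Pi.add_apply, Pi.add_apply, Pi.add_apply, Pi.add_apply]
  unfold comp
  rw [this, raise_add]
  simp only [Matrix.add_apply, mul_add, Finset.sum_add_distrib]

lemma comp_smul_left (G : Matrix (Fin 4) (Fin 4) ℝ) (c : ℂ) (S T : Tensor4) :
    comp G (c • S) T = c • comp G S T := by
  funext α β μ ν
  simp only [comp, Pi.smul_apply, smul_eq_mul, Finset.mul_sum]
  refine Finset.sum_congr rfl fun _ _ => Finset.sum_congr rfl fun _ _ => by ring

lemma comp_smul_right (G : Matrix (Fin 4) (Fin 4) ℝ) (c : ℂ) (S T : Tensor4) :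
    comp G S (c • T) = c • comp G S T := by
  funext α β μ ν
  have : (Matrix.of fun κ' ρ' => (c • T) κ' ρ' μ ν) = c • (Matrix.of fun κ' ρ' => T κ' ρ' μ ν) :=
    rfl
  rw [Pi.smul_apply, Pi.smul_apply, Pi.smul_apply, Pi.smul_apply]
  unfold comp
  rw [this, raise_smul]
  simp only [Matrix.smul_apply, smul_eq_mul, Finset.mul_sum]
  refine Finset.sum_congr rfl fun _ _ => Finset.sum_congr rfl fun _ _ => by ring

/-- Composition of double bivectors as a bilinear map. -/
def compL (G : Matrix (Fin 4) (Fin 4) ℝ) : Tensor4 →ₗ[ℂ] Tensor4 →ₗ[ℂ] Tensor4 :=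
  LinearMap.mk₂ ℂ (comp G) (comp_add_left G) (comp_smul_left G) (comp_add_right G)
    (comp_smul_right G)

@[simp] lemma compL_apply (G : Matrix (Fin 4) (Fin 4) ℝ) (S T : Tensor4) :
    compL G S T = comp G S T := rfl

lemma comp_tensor (G : Matrix (Fin 4) (Fin 4) ℝ) (A B C D : Tensor2) :
    comp G (tensor A B) (tensor C D) = pair G B C • tensor A D := by
  funext α β μ ν
  have : (Matrix.of fun κ' ρ' => tensor C D κ' ρ' μ ν) = D μ ν • C := by
    ext; simp [tensor, mul_comm]
  rw [Pi.smul_apply, Pi.smul_apply, Pi.smul_apply, Pi.smul_apply]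
  unfold comp
  rw [this, raise_smul]
  simp only [Matrix.smul_apply, smul_eq_mul, Finset.mul_sum, tensor, pair, Finset.sum_mul]
  refine Finset.sum_congr rfl fun _ _ => Finset.sum_congr rfl fun _ _ => by ring

/-- The covariant 4-tensor whose components in the coframe `θ` are `T`. -/
def pull4 (θ : Matrix (Fin 4) (Fin 4) ℝ) : Tensor4 →ₗ[ℂ] Tensor4 where
  toFun T := fun α β μ ν => ∑ a, ∑ b, ∑ c, ∑ d,
    (θ a α : ℂ) * (θ b β : ℂ) * (θ c μ : ℂ) * (θ d ν : ℂ) * T a b c d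
  map_add' S T := by
    funext α β μ ν; simp only [Pi.add_apply, mul_add, Finset.sum_add_distrib]
  map_smul' z T := by
    funext α β μ ν
    simp only [Pi.smul_apply, smul_eq_mul, RingHom.id_apply, Finset.mul_sum]
    refine Finset.sum_congr rfl fun _ _ => Finset.sum_congr rfl fun _ _ => Finset.sum_congr rfl
      fun _ _ => Finset.sum_congr rfl fun _ _ => by ring

lemma pull4_apply (θ : Matrix (Fin 4) (Fin 4) ℝ) (T : Tensor4) (α β μ ν : Fin 4) :
    pull4 θ T α β μ ν = ∑ a, ∑ b, ∑ c, ∑ d,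
    (θ a α : ℂ) * (θ b β : ℂ) * (θ c μ : ℂ) * (θ d ν : ℂ) * T a b c d := rfl

lemma pull4_tensor (θ : Matrix (Fin 4) (Fin 4) ℝ) (A B : Tensor2) :
    pull4 θ (tensor A B) = tensor (pull θ A) (pull θ B) := by
  funext α β μ ν
  simp only [pull4_apply, tensor, pull_entry]
  simp only [Finset.sum_mul]
  simp only [Finset.mul_sum]
  refine Finset.sum_congr rfl fun _ _ => Finset.sum_congr rfl fun _ _ => Finset.sum_congr rfl
    fun _ _ => Finset.sum_congr rfl fun _ _ => by ring

lemma tensor4_eq_sum (T : Tensor4) : T = ∑ a, ∑ b, ∑ c, ∑ d,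
    T a b c d • tensor (Matrix.single a b 1) (Matrix.single c d 1) := by
  funext α β μ ν
  simp only [Finset.sum_apply, Pi.smul_apply, tensor, Matrix.single_apply, smul_eq_mul]
  rw [Finset.sum_eq_single α, Finset.sum_eq_single β, Finset.sum_eq_single μ,
    Finset.sum_eq_single ν] <;> simp +contextual

/-- Linear maps on 4-tensors agree if they agree on tensor products of 2-tensors. -/
lemma linear_ext_tensor {M : Type*} [AddCommGroup M] [Module ℂ M] {f h : Tensor4 →ₗ[ℂ] M}
    (H : ∀ A B, f (tensor A B) = h (tensor A B)) : f = h := by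
  refine LinearMap.ext fun T => ?_
  rw [tensor4_eq_sum T]
  simp only [map_sum, map_smul, H]

lemma pull4_pull4 (A B : Matrix (Fin 4) (Fin 4) ℝ) (T : Tensor4) :
    pull4 A (pull4 B T) = pull4 (B * A) T := by
  have : (pull4 A) ∘ₗ (pull4 B) = pull4 (B * A) :=
    linear_ext_tensor fun X Y => by
      simp only [LinearMap.comp_apply, pull4_tensor, pull_pull]
  exact LinearMap.congr_fun this T

lemma pull4_one (T : Tensor4) : pull4 1 T = T := by
  have : pull4 1 = LinearMap.id :=
    linear_ext_tensor fun X Y => by simp only [pull4_tensor, pull_one, LinearMap.id_apply]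
  exact LinearMap.congr_fun this T

/-! ## The volume element -/

lemma sum_vecCons {n : ℕ} {α M : Type*} [Fintype α] [AddCommMonoid M] (F : (Fin (n + 1) → α) → M) :
    ∑ f, F f = ∑ a, ∑ f, F (Matrix.vecCons a f) := by
  rw [← Fintype.sum_prod_type']
  exact (Fintype.sum_equiv (Fin.consEquiv fun _ => α) _ _ fun _ => rfl).symm

/-- Both sides are the determinant of the matrix formed by columns α, β, γ, δ of θ: the left by
multiplicativity, the right by multilinear expansion. -/
lemma leviCivita_mul_det (θ : Matrix (Fin 4) (Fin 4) ℝ) (α β γ δ : Fin 4) :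
    θ.det * leviCivita α β γ δ = ∑ a, ∑ b, ∑ c, ∑ d,
      θ a α * θ b β * θ c γ * θ d δ * leviCivita a b c d := by
  have h1 : θ.det * leviCivita α β γ δ =
      Matrix.detRowAlternating (fun i => ∑ b, θ b (![α, β, γ, δ] i) • (Pi.single b (1 : ℝ) :
        Fin 4 → ℝ)) := by
    rw [leviCivita, ← Matrix.det_transpose θ, mul_comm, ← Matrix.det_mul]
    change Matrix.det _ = Matrix.det _
    congr 1
    ext i j
    simp [Matrix.mul_apply, Pi.single_apply, Finset.sum_apply]
  rw [h1]
  have h2 := MultilinearMap.map_sum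
    (Matrix.detRowAlternating (n := Fin 4) (R := ℝ)).toMultilinearMap
    (g := fun i b => θ b (![α, β, γ, δ] i) • (Pi.single b (1 : ℝ) : Fin 4 → ℝ))
  refine h2.trans ?_
  rw [sum_vecCons]
  refine Finset.sum_congr rfl fun a _ => ?_
  rw [sum_vecCons]
  refine Finset.sum_congr rfl fun b _ => ?_
  rw [sum_vecCons]
  refine Finset.sum_congr rfl fun c _ => ?_
  rw [sum_vecCons]
  refine Finset.sum_congr rfl fun d _ => ?_
  rw [Fintype.sum_unique, MultilinearMap.map_smul_univ, Fin.prod_univ_four, smul_eq_mul]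
  congr 1
  change Matrix.det _ = Matrix.det _
  congr 1
  ext i j
  fin_cases i <;> simp [Pi.single_apply, eq_comm]

lemma vol_minkowski (α β γ δ : Fin 4) : vol minkowski α β γ δ = leviCivita α β γ δ := by
  simp [vol, minkowski_det]

/-- The orientation enters here: positivity of det θ makes √|det G| equal to det θ without a sign.
-/
lemma IsCoframe.vol_eq {G θ : Matrix (Fin 4) (Fin 4) ℝ} (h : IsCoframe G θ) (α β γ δ : Fin 4) :
    vol G α β γ δ = ∑ a, ∑ b, ∑ c, ∑ d,
      θ a α * θ b β * θ c γ * θ d δ * vol minkowski a b c d := by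
  simp only [vol_minkowski]
  rw [vol, h.sqrt_det, leviCivita_mul_det]

lemma hodge_pull {G θ : Matrix (Fin 4) (Fin 4) ℝ} (h : IsCoframe G θ) (X : Tensor2) :
    hodge G (pull θ X) = pull θ (hodge minkowski X) := by
  have h1 := h.toC_mul_inv
  have h2 : (toC θ⁻¹).transpose * (toC θ).transpose = 1 := by
    rw [← Matrix.transpose_mul, h1, Matrix.transpose_one]
  have h3 : toC θ * (toC θ⁻¹ * raise minkowski X * (toC θ⁻¹).transpose) * (toC θ).transpose =
      raise minkowski X := by
    calc _ = (toC θ * toC θ⁻¹) * raise minkowski X *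
          ((toC θ⁻¹).transpose * (toC θ).transpose) := by simp only [Matrix.mul_assoc]
      _ = _ := by rw [h1, h2, Matrix.mul_one, Matrix.one_mul]
  ext α β
  have h4 : ∀ μ ν, (vol G α β μ ν : ℂ) = ∑ a, ∑ b, (θ a α : ℂ) * (θ b β : ℂ) *
      ((toC θ).transpose * (Matrix.of fun c d => (vol minkowski a b c d : ℂ)) * toC θ) μ ν := by
    intro μ ν
    rw [h.vol_eq]
    push_cast
    refine Finset.sum_congr rfl fun a _ => Finset.sum_congr rfl fun b _ => ?_
    rw [← pull_apply, pull_entry, Finset.mul_sum]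
    refine Finset.sum_congr rfl fun c _ => ?_
    rw [Finset.mul_sum]
    refine Finset.sum_congr rfl fun d _ => ?_
    rw [Matrix.of_apply]; ring
  have h5 : ∀ a b, ∑ μ, ∑ ν,
      ((toC θ).transpose * (Matrix.of fun c d => (vol minkowski a b c d : ℂ)) * toC θ) μ ν *
        raise G (pull θ X) μ ν = ∑ μ, ∑ ν, (vol minkowski a b μ ν : ℂ) * raise minkowski X μ ν := by
    intro a b
    rw [sum_pull_mul, raise_pull h, h3]; rfl
  rw [pull_entry]
  simp only [hodge, Matrix.of_apply]
  simp only [← h5, h4, Finset.mul_sum, Finset.sum_mul]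
  rw [Finset.sum_congr rfl fun μ _ => Finset.sum_comm]
  rw [Finset.sum_comm]
  refine Finset.sum_congr rfl fun a _ => ?_
  rw [Finset.sum_congr rfl fun μ _ => Finset.sum_comm]
  rw [Finset.sum_comm]
  refine Finset.sum_congr rfl fun b _ => Finset.sum_congr rfl fun μ _ =>
    Finset.sum_congr rfl fun ν _ => ?_
  ring

lemma metric_mul_pull {G θ : Matrix (Fin 4) (Fin 4) ℝ} (h : IsCoframe G θ) (α μ : Fin 4) :
    (G α μ : ℂ) = ∑ a, ∑ c, (θ a α : ℂ) * (minkowski a c : ℂ) * (θ c μ : ℂ) := by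
  rw [← h.metric]
  simp only [Matrix.mul_apply, Matrix.transpose_apply, Finset.sum_mul]
  push_cast
  rw [Finset.sum_comm]

lemma calG_pull {G θ : Matrix (Fin 4) (Fin 4) ℝ} (h : IsCoframe G θ) :
    calG G = pull4 θ (calG minkowski) := by
  have e : ∀ α μ β ν, (G α μ * G β ν : ℂ) = ∑ a, ∑ b, ∑ c, ∑ d,
      (θ a α : ℂ) * (θ b β : ℂ) * (θ c μ : ℂ) * (θ d ν : ℂ) *
        ((minkowski a c : ℂ) * (minkowski b d : ℂ)) := by
    intro α μ β ν
    rw [metric_mul_pull h, metric_mul_pull h]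
    simp only [Finset.sum_mul]
    simp only [Finset.mul_sum]
    refine Finset.sum_congr rfl fun a _ => ?_
    rw [Finset.sum_comm]
    refine Finset.sum_congr rfl fun b _ => Finset.sum_congr rfl fun c _ =>
      Finset.sum_congr rfl fun d _ => by ring
  have e' : ∀ α ν β μ, (G α ν * G β μ : ℂ) = ∑ a, ∑ b, ∑ c, ∑ d,
      (θ a α : ℂ) * (θ b β : ℂ) * (θ c μ : ℂ) * (θ d ν : ℂ) *
        ((minkowski a d : ℂ) * (minkowski b c : ℂ)) := by
    intro α ν β μ
    rw [e]
    refine Finset.sum_congr rfl fun a _ => Finset.sum_congr rfl fun b _ => ?_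
    rw [Finset.sum_comm]
    refine Finset.sum_congr rfl fun c _ => Finset.sum_congr rfl fun d _ => by ring
  funext α β μ ν
  rw [pull4_apply, calG]
  push_cast
  rw [e, e', h.vol_eq]
  push_cast
  simp only [Finset.mul_sum, ← Finset.sum_sub_distrib]
  refine Finset.sum_congr rfl fun a _ => Finset.sum_congr rfl fun b _ =>
      Finset.sum_congr rfl fun c _ => Finset.sum_congr rfl fun d _ => ?_
  rw [calG]; push_cast; ring

end

section

/-! ## Self-dual bivectors in an orthonormal frame -/

/-- The symbol is the determinant of a row selection, hence a quotient of Vandermonde determinants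
at the nodes 0, 1, 2, 3, and 12 is the value of the denominator. The polynomial form lets `ring`
prove its symmetries. -/
lemma leviCivita_eq (α β γ δ : Fin 4) : leviCivita α β γ δ =
    let v : Fin 4 → ℝ := ![0, 1, 2, 3]
    (v β - v α) * (v γ - v α) * (v δ - v α) * (v γ - v β) * (v δ - v β) * (v δ - v γ) / 12 := by
  set v : Fin 4 → ℝ := ![0, 1, 2, 3] with hv
  have prod4 : ∀ w : Fin 4 → ℝ, ∏ i, ∏ j ∈ Finset.Ioi i, (w j - w i) =
      (w 1 - w 0) * (w 2 - w 0) * (w 3 - w 0) * (w 2 - w 1) * (w 3 - w 1) * (w 3 - w 2) := by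
    intro w
    rw [Fin.prod_univ_four, show Finset.Ioi (0 : Fin 4) = {1, 2, 3} by decide,
      show Finset.Ioi (1 : Fin 4) = {2, 3} by decide, show Finset.Ioi (2 : Fin 4) = {3} by decide,
      show Finset.Ioi (3 : Fin 4) = ∅ by decide]
    rw [Finset.prod_insert (by decide), Finset.prod_insert (by decide), Finset.prod_singleton,
      Finset.prod_pair (by decide), Finset.prod_singleton, Finset.prod_empty]
    ring
  have h1 : leviCivita α β γ δ * (Matrix.vandermonde v).det =
      (Matrix.vandermonde fun i => v (![α, β, γ, δ] i)).det := by
    rw [leviCivita, ← Matrix.det_mul]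
    congr 1
    ext i j
    simp [Matrix.mul_apply, Matrix.vandermonde_apply]
  have h2 : (Matrix.vandermonde v).det = 12 := by
    rw [Matrix.det_vandermonde]
    rw [prod4]
    simp [hv]
    norm_num
  rw [h2, Matrix.det_vandermonde] at h1
  rw [eq_div_iff (by norm_num), h1]
  rw [prod4]
  simp

lemma leviCivita_0123 : leviCivita 0 1 2 3 = 1 := by
  rw [leviCivita_eq]; simp; norm_num

lemma minkowski_apply (i j : Fin 4) :
    minkowski i j = (!![-1, 0, 0, 0; 0, 1, 0, 0; 0, 0, 1, 0; 0, 0, 0, 1] :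
      Matrix (Fin 4) (Fin 4) ℝ) i j := by
  fin_cases i <;> fin_cases j <;> simp [minkowski]

lemma toC_minkowski : toC minkowski =
    !![-1, 0, 0, 0; 0, 1, 0, 0; 0, 0, 1, 0; 0, 0, 0, 1] := by
  ext i j
  rw [toC_apply, minkowski_apply]
  fin_cases i <;> fin_cases j <;> simp

lemma raise_minkowski_apply (X : Tensor2) : raise minkowski X =
    !![X 0 0, -X 0 1, -X 0 2, -X 0 3; -X 1 0, X 1 1, X 1 2, X 1 3;
      -X 2 0, X 2 1, X 2 2, X 2 3; -X 3 0, X 3 1, X 3 2, X 3 3] := by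
  rw [raise_minkowski, toC_minkowski]
  ext i j
  fin_cases i <;> fin_cases j <;> simp [Matrix.vecMul, dotProduct, Matrix.mul_apply, Fin.sum_univ_four]

lemma hodge_minkowski (X : Tensor2) : hodge minkowski X = (1 / 2 : ℂ) •
    !![0, X 2 3 - X 3 2, X 3 1 - X 1 3, X 1 2 - X 2 1;
      X 3 2 - X 2 3, 0, X 3 0 - X 0 3, X 0 2 - X 2 0;
      X 1 3 - X 3 1, X 0 3 - X 3 0, 0, X 1 0 - X 0 1;
      X 2 1 - X 1 2, X 2 0 - X 0 2, X 0 1 - X 1 0, 0] := by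
  ext i j
  simp only [hodge, raise_minkowski_apply, vol_minkowski, leviCivita_eq, Matrix.of_apply,
    Matrix.smul_apply, smul_eq_mul, Fin.sum_univ_four]
  fin_cases i <;> fin_cases j <;> simp <;> norm_num <;> ring

/-- The components `√2 𝓤_A` of the self-dual bivectors of an orthonormal frame. -/
def sd (A : Fin 3) : Tensor2 :=
  ![!![0, -1, 0, 0; 1, 0, 0, 0; 0, 0, 0, -Complex.I; 0, 0, Complex.I, 0],
    !![0, 0, -1, 0; 0, 0, 0, Complex.I; 1, 0, 0, 0; 0, -Complex.I, 0, 0],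
    !![0, 0, 0, -1; 0, 0, -Complex.I, 0; 0, Complex.I, 0, 0; 1, 0, 0, 0]] A

/-- The components of `e₀ ∧ e_A` in an orthonormal frame. -/
def electric (A : Fin 3) : Tensor2 :=
  ![!![0, -1, 0, 0; 1, 0, 0, 0; 0, 0, 0, 0; 0, 0, 0, 0],
    !![0, 0, -1, 0; 0, 0, 0, 0; 1, 0, 0, 0; 0, 0, 0, 0],
    !![0, 0, 0, -1; 0, 0, 0, 0; 0, 0, 0, 0; 1, 0, 0, 0]] A

lemma electric_sub_hodge (A : Fin 3) :
    electric A - Complex.I • hodge minkowski (electric A) = sd A := by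
  rw [hodge_minkowski]
  ext i j
  fin_cases A <;> fin_cases i <;> fin_cases j <;> simp [electric, sd] <;> norm_num

lemma pair_sd (A B : Fin 3) : pair minkowski (sd A) (sd B) = if A = B then -2 else 0 := by
  rw [pair, raise_minkowski_apply]
  fin_cases A <;> fin_cases B <;> simp [sd, Fin.sum_univ_four] <;> norm_num

/-- Applied to each index pair, this cuts an identity of double bivectors from 256 entries to 36.
The pairs 23, 31, 12 are ordered cyclically, as the duals of 01, 02, 03. -/
lemma ext_of_antisymm {X Y : Fin 4 → Fin 4 → ℂ} (hX : ∀ a b, X b a = -X a b)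
    (hY : ∀ a b, Y b a = -Y a b) (h01 : X 0 1 = Y 0 1) (h02 : X 0 2 = Y 0 2)
    (h03 : X 0 3 = Y 0 3) (h23 : X 2 3 = Y 2 3) (h31 : X 3 1 = Y 3 1) (h12 : X 1 2 = Y 1 2)
    (a b : Fin 4) : X a b = Y a b := by
  have dX : ∀ a, X a a = 0 := fun a => by linear_combination (1 / 2 : ℂ) * hX a a
  have dY : ∀ a, Y a a = 0 := fun a => by linear_combination (1 / 2 : ℂ) * hY a a
  fin_cases a <;> fin_cases b <;> simp only [Fin.zero_eta, Fin.mk_one, Fin.reduceFinMk] <;>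
    first
    | rw [dX, dY]
    | assumption
    | (rw [hX, hY, neg_inj]; assumption)

lemma leviCivita_swap_left (α β γ δ : Fin 4) : leviCivita β α γ δ = -leviCivita α β γ δ := by
  simp only [leviCivita_eq]; ring

lemma leviCivita_swap_right (α β γ δ : Fin 4) : leviCivita α β δ γ = -leviCivita α β γ δ := by
  simp only [leviCivita_eq]; ring

lemma sd_antisymm (A : Fin 3) (a b : Fin 4) : sd A b a = -sd A a b := by
  fin_cases A <;> fin_cases a <;> fin_cases b <;> simp [sd]

/-- 𝓖 is the projector onto self-dual bivectors. Their basis `sd` is orthogonal with squares -2,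
whence the coefficient -1/2. -/
lemma calG_minkowski : calG minkowski = -((1 / 2 : ℂ) • ∑ A, tensor (sd A) (sd A)) := by
  have e : ∀ α β μ ν, (-((1 / 2 : ℂ) • ∑ A, tensor (sd A) (sd A)) : Tensor4) α β μ ν =
      -((1 / 2 : ℂ) * (sd 0 α β * sd 0 μ ν + sd 1 α β * sd 1 μ ν + sd 2 α β * sd 2 μ ν)) := by
    intro α β μ ν
    simp only [Pi.neg_apply, Pi.smul_apply, Fin.sum_univ_three, Pi.add_apply, tensor, smul_eq_mul]
  funext α β μ ν
  rw [e]
  revert α β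
  refine ext_of_antisymm ?_ ?_ ?_ ?_ ?_ ?_ ?_ ?_
  · intro a b; simp only [calG, vol_minkowski, leviCivita_swap_left a b]; push_cast; ring
  · intro a b; simp only [fun A => sd_antisymm A a b]; ring
  all_goals
    revert μ ν
    refine ext_of_antisymm ?_ ?_ ?_ ?_ ?_ ?_ ?_ ?_
    · intro a b; simp only [calG, vol_minkowski, leviCivita_swap_right _ _ a b]; push_cast; ring
    · intro a b; simp only [fun A => sd_antisymm A a b]; ring
  all_goals
    simp only [calG, vol_minkowski, leviCivita_eq, minkowski_apply]
    simp [sd]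
    try norm_num

end

/-! ### The null triad of a tetrad and its recovery from the Weyl tensor. -/

section

/-- `1/√2` as a complex number. -/
def rt : ℂ := 1 / (√2 : ℝ)

lemma rt_sq : rt ^ 2 = 1 / 2 := by
  rw [rt, div_pow, ← Complex.ofReal_pow, Real.sq_sqrt (by norm_num)]; norm_num

lemma rt_ne_zero : rt ≠ 0 := fun h => by
  have := rt_sq; rw [h] at this; norm_num at this

lemma conj_rt : (starRingEnd ℂ) rt = rt := by simp [rt]

/-- The components of `𝓛₊` in an orthonormal frame. -/
def sdP : Tensor2 := (1 / 2 : ℂ) • (sd 1 + Complex.I • sd 2)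

/-- The components of `𝓛₋` in an orthonormal frame. -/
def sdM : Tensor2 := (1 / 2 : ℂ) • (sd 1 - Complex.I • sd 2)

/-- The components `(e_a)^μ` of the vectors dual to the coframe `θ`. -/
def dualFrame (θ : Matrix (Fin 4) (Fin 4) ℝ) (a μ : Fin 4) : ℝ := θ⁻¹ μ a

lemma mulVec_dualFrame {G θ : Matrix (Fin 4) (Fin 4) ℝ} (h : IsCoframe G θ) (a α : Fin 4) :
    G.mulVec (dualFrame θ a) α = minkowski a a * θ a α := by
  have h1 : G * θ⁻¹ = θ.transpose * minkowski := by
    rw [← h.metric, Matrix.mul_assoc, h.mul_inv, Matrix.mul_one]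
  have h2 : G.mulVec (dualFrame θ a) α = (G * θ⁻¹) α a := by
    simp [Matrix.mulVec, dotProduct, Matrix.mul_apply, dualFrame]
  rw [h2, h1, minkowski, Matrix.mul_diagonal, Matrix.diagonal_apply_eq, Matrix.transpose_apply,
    mul_comm]

lemma frameWedge_dualFrame {G θ : Matrix (Fin 4) (Fin 4) ℝ} (h : IsCoframe G θ) (A : Fin 3) :
    frameWedge G (dualFrame θ) A.succ = pull θ (electric A) := by
  ext α β
  rw [pull_entry, frameWedge, Matrix.of_apply]
  simp only [mulVec_dualFrame h]
  fin_cases A <;> simp [electric, Fin.sum_univ_four, minkowski_apply]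

lemma hodge_linear (G : Matrix (Fin 4) (Fin 4) ℝ) (c : ℂ) (X Y : Tensor2) :
    hodge G (X + c • Y) = hodge G X + c • hodge G Y := by
  ext α β
  simp only [hodge, raise_add, raise_smul, Matrix.add_apply, Matrix.smul_apply, Matrix.of_apply,
    smul_eq_mul, Finset.mul_sum, ← Finset.sum_add_distrib]
  refine Finset.sum_congr rfl fun _ _ => Finset.sum_congr rfl fun _ _ => by ring

lemma frameU_dualFrame {G θ : Matrix (Fin 4) (Fin 4) ℝ} (h : IsCoframe G θ) (A : Fin 3) :
    frameU G (dualFrame θ) A.succ = rt • pull θ (sd A) := by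
  rw [frameU, frameWedge_dualFrame h, hodge_pull h, ← map_smul, ← map_sub, electric_sub_hodge, rt]

lemma frameLp_dualFrame {G θ : Matrix (Fin 4) (Fin 4) ℝ} (h : IsCoframe G θ) :
    frameLp G (dualFrame θ) = pull θ sdP := by
  have h1 := frameU_dualFrame h 1
  have h2 := frameU_dualFrame h 2
  rw [show Fin.succ (1 : Fin 3) = 2 from rfl] at h1
  rw [show Fin.succ (2 : Fin 3) = 3 from rfl] at h2
  rw [frameLp, h1, h2, ← rt, sdP, ← rt_sq, smul_comm Complex.I rt, ← smul_add, smul_smul, ← pow_two,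
    map_smul, map_add, map_smul]

lemma frameLm_dualFrame {G θ : Matrix (Fin 4) (Fin 4) ℝ} (h : IsCoframe G θ) :
    frameLm G (dualFrame θ) = pull θ sdM := by
  have h1 := frameU_dualFrame h 1
  have h2 := frameU_dualFrame h 2
  rw [show Fin.succ (1 : Fin 3) = 2 from rfl] at h1
  rw [show Fin.succ (2 : Fin 3) = 3 from rfl] at h2
  rw [frameLm, h1, h2, ← rt, sdM, ← rt_sq, smul_comm Complex.I rt, ← smul_sub, smul_smul, ← pow_two,
    map_smul, map_sub, map_smul]

/-- A basis of the self-dual bivectors of the type `(𝓤, 𝓛₊, 𝓛₋)`. -/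
structure IsTriad (G : Matrix (Fin 4) (Fin 4) ℝ) (U Lp Lm : Tensor2) : Prop where
  uu : pair G U U = -1
  pp : pair G Lp Lp = 0
  mp : pair G Lm Lp = -1
  up : pair G U Lp = 0
  pu : pair G Lp U = 0
  pm : pair G Lp Lm = -1
  calG_eq : calG G = -(tensor U U + tensor Lp Lm + tensor Lm Lp)

lemma pair_minkowski (X Y : Tensor2) : pair minkowski X Y = (1 / 2 : ℂ) * (X 0 0 * Y 0 0 +
    (X 1 1 * Y 1 1 + X 1 2 * Y 1 2 + X 1 3 * Y 1 3 + X 2 1 * Y 2 1 + X 2 2 * Y 2 2 +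
      X 2 3 * Y 2 3 + X 3 1 * Y 3 1 + X 3 2 * Y 3 2 + X 3 3 * Y 3 3) -
    (X 0 1 * Y 0 1 + X 0 2 * Y 0 2 + X 0 3 * Y 0 3 + X 1 0 * Y 1 0 + X 2 0 * Y 2 0 +
      X 3 0 * Y 3 0)) := by
  rw [pair, raise_minkowski_apply]
  simp [Fin.sum_univ_four]
  ring

lemma pair_add_right (G : Matrix (Fin 4) (Fin 4) ℝ) (A B B' : Tensor2) :
    pair G A (B + B') = pair G A B + pair G A B' := by
  simp [pair, raise_add, mul_add, Finset.sum_add_distrib]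

lemma pair_smul_right (G : Matrix (Fin 4) (Fin 4) ℝ) (c : ℂ) (A B : Tensor2) :
    pair G A (c • B) = c * pair G A B := by
  simp only [pair, raise_smul, Matrix.smul_apply, smul_eq_mul, Finset.mul_sum]
  refine Finset.sum_congr rfl fun _ _ => Finset.sum_congr rfl fun _ _ => by ring

lemma isTriad_pull {G θ : Matrix (Fin 4) (Fin 4) ℝ} (h : IsCoframe G θ) :
    IsTriad G (rt • pull θ (sd 0)) (pull θ sdP) (pull θ sdM) := by
  have hI : Complex.I ^ 2 = -1 := Complex.I_sq
  have hr := rt_sq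
  have hP : sdP = (1 / 2 : ℂ) • (sd 1 + Complex.I • sd 2) := rfl
  have hM : sdM = (1 / 2 : ℂ) • (sd 1 + (-Complex.I) • sd 2) := by
    rw [sdM, sub_eq_add_neg, neg_smul]
  refine ⟨?_, ?_, ?_, ?_, ?_, ?_, ?_⟩
  on_goal 7 =>
    rw [calG_pull h, calG_minkowski, map_neg, map_smul, map_sum, Fin.sum_univ_three]
    simp only [pull4_tensor, sdP, sdM, map_smul, map_add, map_sub]
    funext α β μ ν
    simp only [Pi.neg_apply, Pi.smul_apply, Pi.add_apply, tensor, Matrix.smul_apply,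
      Matrix.add_apply, Matrix.sub_apply, smul_eq_mul]
    linear_combination (pull θ (sd 0) α β * pull θ (sd 0) μ ν) * rt_sq -
      (1 / 2 * pull θ (sd 2) α β * pull θ (sd 2) μ ν) * hI
  all_goals
    simp only [pair_smul_left, pair_smul_right, pair_pull h, hP, hM, pair_add_left,
      pair_add_right, pair_sd]
    simp
  · linear_combination (2 : ℂ) * hr
  · linear_combination (-1 : ℂ) * hI
  · linear_combination (1 / 2 : ℂ) * hI
  · linear_combination (1 / 2 : ℂ) * hI

/-- Of the four products only (ℓ₊⊗U)(U⊗ℓ₊) survives, with coefficient (U,U) = -1. -/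
lemma comp_canonical {G : Matrix (Fin 4) (Fin 4) ℝ} {U Lp Lm : Tensor2} (h : IsTriad G U Lp Lm) :
    comp G (tensor U Lp + tensor Lp U) (tensor U Lp + tensor Lp U) = -tensor Lp Lp := by
  simp [comp_add_left, comp_add_right, comp_tensor, h.uu, h.pp, h.up, h.pu]

lemma image_neg (G : Matrix (Fin 4) (Fin 4) ℝ) (T : Tensor4) (X : Tensor2) :
    image G (-T) X = -image G T X := by
  rw [← neg_one_smul ℂ, image_smul, neg_one_smul]

lemma pair_neg_left (G : Matrix (Fin 4) (Fin 4) ℝ) (A B : Tensor2) :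
    pair G (-A) B = -pair G A B := by
  rw [← neg_one_smul ℂ, pair_smul_left, neg_one_mul]

lemma image_calG {G : Matrix (Fin 4) (Fin 4) ℝ} {U Lp Lm : Tensor2} (h : IsTriad G U Lp Lm)
    (X : Tensor2) :
    image G (calG G) X = -(pair G U X • U + pair G Lm X • Lp + pair G Lp X • Lm) := by
  rw [h.calG_eq, image_neg, image_add, image_add]
  simp only [image_tensor]

/-- The bivectors computed from a Weyl tensor in canonical form are those of its triad, up to a
common sign. -/
theorem weylTriad_eq {g : (Fin 4 → ℝ) → Matrix (Fin 4) (Fin 4) ℝ} {X : (Fin 4 → ℝ) → Tensor2}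
    {s : (Fin 4 → ℝ) → ℂ} {x : Fin 4 → ℝ} {U Lp Lm : Tensor2} (h : IsTriad (g x) U Lp Lm)
    (hW : calW g x = tensor U Lp + tensor Lp U)
    (hX : image (g x) (calW2 g x) (X x) ≠ 0)
    (hs : s x ^ 2 = -form (g x) (calW2 g x) (X x) (X x)) :
    ∃ ε : ℂ, (ε = 1 ∨ ε = -1) ∧ s x ≠ 0 ∧ s x = ε * pair (g x) Lp (X x) ∧
      ip (g x) (weylLp g X s x) (X x) ≠ 0 ∧
      weylU g X s x = ε • U ∧ weylLp g X s x = ε • Lp ∧ weylLm g X s x = ε • Lm := by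
  have hW2 : calW2 g x = -tensor Lp Lp := by rw [calW2, hW, comp_canonical h]
  -- The formulas see X only through these three numbers, which by `image_calG` also determine 𝓖(X).
  set a := pair (g x) Lp (X x) with ha
  set b := pair (g x) Lm (X x) with hb
  set u := pair (g x) U (X x) with hu
  have hi : image (g x) (calW2 g x) (X x) = -(a • Lp) := by
    rw [hW2, image_neg, image_tensor]
  have ha0 : a ≠ 0 := fun h0 => hX (by rw [hi, h0, zero_smul, neg_zero])
  have hs2 : s x ^ 2 = a ^ 2 := by
    rw [hs, form_eq_pair_image, hi, pair_neg_left, pair_smul_left, ← ha]; ring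
  obtain ⟨ε, hε, hsε⟩ : ∃ ε : ℂ, (ε = 1 ∨ ε = -1) ∧ s x = ε * a := by
    rcases sq_eq_sq_iff_eq_or_eq_neg.1 hs2 with h1 | h1
    · exact ⟨1, Or.inl rfl, by rw [h1, one_mul]⟩
    · exact ⟨-1, Or.inr rfl, by rw [h1]; ring⟩
  have hε2 : ε ^ 2 = 1 := by rcases hε with rfl | rfl <;> norm_num
  have hε0 : ε ≠ 0 := by rintro rfl; norm_num at hε2
  have hLp : weylLp g X s x = ε • Lp := by
    rw [weylLp, hi, smul_neg, neg_neg, smul_smul, hsε]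
    congr 1
    field_simp
    exact hε2.symm
  have hip : ip (g x) (weylLp g X s x) (X x) = ε * a := by
    rw [hLp, ip, form_eq_pair_image, image_calG h, pair_neg_left, pair_add_left, pair_add_left]
    simp only [pair_smul_left, pair_smul_right, h.up, h.pp, h.mp]
    rw [← ha]; ring
  have hiW : image (g x) (calW g x) (X x) = a • U + u • Lp := by
    rw [hW, image_add, image_tensor, image_tensor]
  have hU : weylU g X s x = ε • U := by
    rw [weylU, form_eq_pair_image, hiW, hip, hLp, pair_add_left, pair_smul_left, pair_smul_left,
      ← ha, ← hu]
    ext i j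
    simp only [Matrix.smul_apply, Matrix.add_apply, Matrix.sub_apply, smul_eq_mul, mul_pow, hε2]
    field_simp
    ring
  -- 𝓤 enters 𝓢 quadratically, so ε drops out, and 𝓤⊗𝓤 cancels its counterpart in 𝓖.
  have hS : weylS g X s x = -(tensor Lp Lm + tensor Lm Lp) := by
    rw [weylS, hU, tensor_smul_left, tensor_smul_right, smul_smul, ← pow_two, hε2, one_smul,
      h.calG_eq]
    abel
  have hiS : image (g x) (weylS g X s x) (X x) = -(b • Lp + a • Lm) := by
    rw [hS, image_neg, image_add, image_tensor, image_tensor]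
  have hLm : weylLm g X s x = ε • Lm := by
    rw [weylLm, form_eq_pair_image, hiS, hip, hLp, pair_neg_left, pair_add_left, pair_smul_left,
      pair_smul_left, ← ha, ← hb]
    ext i j
    simp only [Matrix.smul_apply, Matrix.add_apply, Matrix.sub_apply, Matrix.neg_apply,
      smul_eq_mul, mul_pow, hε2]
    field_simp
    ring
  exact ⟨ε, hε, by rw [hsε]; exact mul_ne_zero hε0 ha0, hsε,
    by rw [hip]; exact mul_ne_zero hε0 ha0, hU, hLp, hLm⟩

/-! ## Orthonormal frames and coframes -/

lemma leviCivita_sum (θ : Matrix (Fin 4) (Fin 4) ℝ) : ∑ α, ∑ β, ∑ γ, ∑ δ,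
    leviCivita α β γ δ * θ α 0 * θ β 1 * θ γ 2 * θ δ 3 = θ.det := by
  rw [← mul_one θ.det, ← leviCivita_0123, leviCivita_mul_det]
  refine Finset.sum_congr rfl fun _ _ => Finset.sum_congr rfl fun _ _ => Finset.sum_congr rfl
    fun _ _ => Finset.sum_congr rfl fun _ _ => by ring

/-- The dual basis of an oriented orthonormal tetrad is an oriented orthonormal coframe. -/
lemma isCoframe_of_tetrad {G : Matrix (Fin 4) (Fin 4) ℝ} {e : Fin 4 → Fin 4 → ℝ}
    (ho : ∀ a b, ∑ μ, ∑ ν, G μ ν * e a μ * e b ν = minkowski a b)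
    (hor : ∑ α, ∑ β, ∑ γ, ∑ δ, vol G α β γ δ * e 0 α * e 1 β * e 2 γ * e 3 δ = 1) :
    IsCoframe G (Matrix.of e).transpose⁻¹ ∧ dualFrame (Matrix.of e).transpose⁻¹ = e := by
  set E : Matrix (Fin 4) (Fin 4) ℝ := (Matrix.of e).transpose with hE
  have hm : E.transpose * G * E = minkowski := by
    ext a b
    rw [← ho]
    simp only [Matrix.mul_apply, Finset.sum_mul, hE, Matrix.transpose_apply, Matrix.of_apply]
    rw [Finset.sum_comm]
    refine Finset.sum_congr rfl fun _ _ => Finset.sum_congr rfl fun _ _ => by ring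
  have hd : 0 < E.det := by
    have h1 : √|G.det| * E.det = 1 := by
      rw [← hor, ← leviCivita_sum E]
      simp only [vol, Finset.mul_sum, hE, Matrix.transpose_apply, Matrix.of_apply]
      refine Finset.sum_congr rfl fun _ _ => Finset.sum_congr rfl fun _ _ => Finset.sum_congr rfl
        fun _ _ => Finset.sum_congr rfl fun _ _ => by ring
    exact pos_of_mul_pos_right (by rw [h1]; norm_num) (Real.sqrt_nonneg _)
  have hu : IsUnit E.det := hd.ne'.isUnit
  refine ⟨⟨?_, ?_⟩, ?_⟩
  · rw [← hm, Matrix.transpose_nonsing_inv]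
    have h2 : E.transpose⁻¹ * E.transpose = 1 := Matrix.nonsing_inv_mul _ (by
      rwa [Matrix.det_transpose])
    calc _ = (E.transpose⁻¹ * E.transpose) * G * (E * E⁻¹) := by simp only [Matrix.mul_assoc]
      _ = G := by rw [h2, Matrix.mul_nonsing_inv _ hu, Matrix.one_mul, Matrix.mul_one]
  · rw [Matrix.det_nonsing_inv, Ring.inverse_eq_inv']; exact inv_pos.2 hd
  · funext a μ
    rw [dualFrame, Matrix.nonsing_inv_nonsing_inv _ hu]; rfl

/-- The vectors dual to an oriented orthonormal coframe form an oriented orthonormal tetrad. -/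
lemma IsCoframe.tetrad {G θ : Matrix (Fin 4) (Fin 4) ℝ} (h : IsCoframe G θ) :
    (∀ a b, ∑ μ, ∑ ν, G μ ν * dualFrame θ a μ * dualFrame θ b ν = minkowski a b) ∧
    ∑ α, ∑ β, ∑ γ, ∑ δ, vol G α β γ δ * dualFrame θ 0 α * dualFrame θ 1 β * dualFrame θ 2 γ *
      dualFrame θ 3 δ = 1 := by
  constructor
  · intro a b
    have h2 : θ⁻¹.transpose * G * θ⁻¹ = minkowski := by
      have h3 : θ⁻¹.transpose * θ.transpose = 1 := by
        rw [← Matrix.transpose_mul, h.mul_inv, Matrix.transpose_one]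
      rw [← h.metric]
      calc _ = (θ⁻¹.transpose * θ.transpose) * minkowski * (θ * θ⁻¹) := by
            simp only [Matrix.mul_assoc]
        _ = _ := by rw [h3, h.mul_inv, Matrix.one_mul, Matrix.mul_one]
    rw [← h2]
    simp only [Matrix.mul_apply, Finset.sum_mul, Matrix.transpose_apply, dualFrame]
    rw [Finset.sum_comm]
    refine Finset.sum_congr rfl fun _ _ => Finset.sum_congr rfl fun _ _ => by ring
  · have h1 : √|G.det| * θ⁻¹.det = 1 := by
      rw [h.sqrt_det, ← Matrix.det_mul, h.mul_inv, Matrix.det_one]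
    rw [← h1, ← leviCivita_sum θ⁻¹]
    simp only [vol, Finset.mul_sum, dualFrame]
    refine Finset.sum_congr rfl fun _ _ => Finset.sum_congr rfl fun _ _ => Finset.sum_congr rfl
      fun _ _ => Finset.sum_congr rfl fun _ _ => by ring

end

section

/-! # Calculus of components -/

section pd
variable {f h : (Fin 4 → ℝ) → ℝ} {x : Fin 4 → ℝ}

lemma pd_congr {F : Type} [NormedAddCommGroup F] [NormedSpace ℝ F] {f h : (Fin 4 → ℝ) → F}
    (H : f =ᶠ[𝓝 x] h) (α : Fin 4) : pd α f x = pd α h x := by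
  rw [pd, pd, H.fderiv_eq]

lemma pd_mul (hf : DifferentiableAt ℝ f x) (hh : DifferentiableAt ℝ h x) (α : Fin 4) :
    pd α (fun y => f y * h y) x = pd α f x * h x + f x * pd α h x := by
  rw [pd, fderiv_fun_mul hf hh]
  simp [pd]
  ring

lemma pd_add (hf : DifferentiableAt ℝ f x) (hh : DifferentiableAt ℝ h x) (α : Fin 4) :
    pd α (fun y => f y + h y) x = pd α f x + pd α h x := by
  rw [pd, fderiv_fun_add hf hh]; rfl

lemma pd_sub (hf : DifferentiableAt ℝ f x) (hh : DifferentiableAt ℝ h x) (α : Fin 4) :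
    pd α (fun y => f y - h y) x = pd α f x - pd α h x := by
  rw [pd, fderiv_fun_sub hf hh]; rfl

lemma pd_const_mul (c : ℝ) (hf : DifferentiableAt ℝ f x) (α : Fin 4) :
    pd α (fun y => c * f y) x = c * pd α f x := by
  rw [pd, fderiv_const_mul hf]; rfl

lemma pd_sum {F : Type} [NormedAddCommGroup F] [NormedSpace ℝ F] {ι : Type*} {s : Finset ι}
    {f : ι → (Fin 4 → ℝ) → F} (hf : ∀ i ∈ s, DifferentiableAt ℝ (f i) x) (α : Fin 4) :
    pd α (fun y => ∑ i ∈ s, f i y) x = ∑ i ∈ s, pd α (f i) x := by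
  rw [pd, fderiv_fun_sum hf]; simp [pd]

lemma pd_ofReal_mul_const (hf : DifferentiableAt ℝ f x) (c : ℂ) (α : Fin 4) :
    pd α (fun y => (f y : ℂ) * c) x = ((pd α f x : ℝ) : ℂ) * c := by
  have h1 : HasFDerivAt (fun y => (f y : ℂ)) (Complex.ofRealCLM.comp (fderiv ℝ f x)) x :=
    Complex.ofRealCLM.hasFDerivAt.comp x hf.hasFDerivAt
  rw [pd, (h1.mul_const c).fderiv]
  simp [pd, mul_comm]

lemma pd_const (c : ℝ) (α : Fin 4) : pd α (fun _ => c) x = 0 := by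
  simp [pd]

/-- The matrix of partial derivatives of the entries of a matrix-valued function. -/
def pdM (α : Fin 4) (M : (Fin 4 → ℝ) → Matrix (Fin 4) (Fin 4) ℝ) (x : Fin 4 → ℝ) :
    Matrix (Fin 4) (Fin 4) ℝ := Matrix.of fun i j => pd α (fun y => M y i j) x

lemma pdM_mul {M N : (Fin 4 → ℝ) → Matrix (Fin 4) (Fin 4) ℝ}
    (hM : ∀ i j, DifferentiableAt ℝ (fun y => M y i j) x)
    (hN : ∀ i j, DifferentiableAt ℝ (fun y => N y i j) x) (α : Fin 4) :
    pdM α (fun y => M y * N y) x = pdM α M x * N x + M x * pdM α N x := by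
  ext i j
  simp only [pdM, Matrix.of_apply, Matrix.mul_apply, Matrix.add_apply]
  rw [pd_sum fun k _ => (hM i k).fun_mul (hN k j), ← Finset.sum_add_distrib]
  exact Finset.sum_congr rfl fun k _ => pd_mul (hM i k) (hN k j) α

lemma pdM_const (C : Matrix (Fin 4) (Fin 4) ℝ) (α : Fin 4) : pdM α (fun _ => C) x = 0 := by
  ext i j; simp [pdM, pd_const]

lemma pdM_congr {M N : (Fin 4 → ℝ) → Matrix (Fin 4) (Fin 4) ℝ} (H : M =ᶠ[𝓝 x] N) (α : Fin 4) :
    pdM α M x = pdM α N x := by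
  ext i j
  exact pd_congr (H.mono fun y hy => by simp only [hy]) α

lemma pdM_transpose (M : (Fin 4 → ℝ) → Matrix (Fin 4) (Fin 4) ℝ) (α : Fin 4) :
    pdM α (fun y => (M y).transpose) x = (pdM α M x).transpose := rfl

lemma differentiableAt_mul_entries {M N : (Fin 4 → ℝ) → Matrix (Fin 4) (Fin 4) ℝ}
    (hM : ∀ i j, DifferentiableAt ℝ (fun y => M y i j) x)
    (hN : ∀ i j, DifferentiableAt ℝ (fun y => N y i j) x) (i j : Fin 4) :
    DifferentiableAt ℝ (fun y => (M y * N y) i j) x := by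
  simp only [Matrix.mul_apply]
  exact DifferentiableAt.fun_sum fun k _ => (hM i k).fun_mul (hN k j)

end pd

/-! ## The Levi-Civita connection is metric -/

section metric
variable {Ω : Set (Fin 4 → ℝ)} {g : (Fin 4 → ℝ) → Matrix (Fin 4) (Fin 4) ℝ} {x : Fin 4 → ℝ}

lemma IsLorentzMetricOn.isUnit_det (hg : IsLorentzMetricOn Ω g) (hx : x ∈ Ω) :
    IsUnit (g x).det := by
  obtain ⟨E, hE⟩ := hg.signature x hx
  have h := congrArg Matrix.det hE
  rw [Matrix.det_mul, Matrix.det_mul, minkowski_det] at h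
  refine isUnit_iff_ne_zero.2 fun h0 => ?_
  rw [h0] at h; norm_num at h

lemma IsLorentzMetricOn.contDiffAt (hg : IsLorentzMetricOn Ω g) (hΩ : IsOpen Ω) (hx : x ∈ Ω)
    (μ ν : Fin 4) : ContDiffAt ℝ ∞ (fun y => g y μ ν) x :=
  (hg.smooth μ ν).contDiffAt (hΩ.mem_nhds hx)

lemma IsLorentzMetricOn.differentiableAt (hg : IsLorentzMetricOn Ω g) (hΩ : IsOpen Ω)
    (hx : x ∈ Ω) (μ ν : Fin 4) : DifferentiableAt ℝ (fun y => g y μ ν) x :=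
  (hg.contDiffAt hΩ hx μ ν).differentiableAt (by simp)

lemma IsLorentzMetricOn.pd_symm (hg : IsLorentzMetricOn Ω g) (hΩ : IsOpen Ω) (hx : x ∈ Ω)
    (α μ ν : Fin 4) : pd α (fun y => g y μ ν) x = pd α (fun y => g y ν μ) x :=
  pd_congr (by filter_upwards [hΩ.mem_nhds hx] with y hy using (hg.symm y hy).apply ν μ) α

lemma IsLorentzMetricOn.mul_christoffel (hg : IsLorentzMetricOn Ω g) (hx : x ∈ Ω)
    (σ μ ν : Fin 4) : ∑ ρ, g x σ ρ * christoffel g ρ μ ν x =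
      (1 / 2) * (pd μ (fun y => g y σ ν) x + pd ν (fun y => g y σ μ) x -
        pd σ (fun y => g y μ ν) x) := by
  set D : Fin 4 → ℝ := fun σ => pd μ (fun y => g y σ ν) x + pd ν (fun y => g y σ μ) x -
        pd σ (fun y => g y μ ν) x with hD
  have h1 : ∑ ρ, g x σ ρ * christoffel g ρ μ ν x =
      (1 / 2) * ∑ τ, (g x * (g x)⁻¹) σ τ * D τ := by
    simp only [christoffel, Matrix.mul_apply, Finset.mul_sum, Finset.sum_mul]
    rw [Finset.sum_comm]
    refine Finset.sum_congr rfl fun _ _ => Finset.sum_congr rfl fun _ _ => by rw [hD]; ring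
  rw [h1, Matrix.mul_nonsing_inv _ (hg.isUnit_det hx)]
  simp [Matrix.one_apply, hD]

/-- The matrix `Γ^ρ_{αμ}` of Christoffel symbols, for fixed `α`. -/
def chrM (g : (Fin 4 → ℝ) → Matrix (Fin 4) (Fin 4) ℝ) (α : Fin 4) (x : Fin 4 → ℝ) :
    Matrix (Fin 4) (Fin 4) ℝ := Matrix.of fun ρ μ => christoffel g ρ α μ x

/-- This is ∇g = 0. Adding the transpose cancels the antisymmetric part of the lowered Christoffel
symbols and leaves ∂g. -/
lemma IsLorentzMetricOn.pdM_metric (hg : IsLorentzMetricOn Ω g) (hΩ : IsOpen Ω) (hx : x ∈ Ω)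
    (α : Fin 4) : pdM α g x = g x * chrM g α x + (chrM g α x).transpose * g x := by
  have h1 : (chrM g α x).transpose * g x = (g x * chrM g α x).transpose := by
    rw [Matrix.transpose_mul, (hg.symm x hx).eq]
  rw [h1]
  ext μ ν
  simp only [pdM, Matrix.of_apply, Matrix.add_apply, Matrix.transpose_apply, Matrix.mul_apply, chrM,
    hg.mul_christoffel hx]
  rw [hg.pd_symm hΩ hx α ν μ, hg.pd_symm hΩ hx ν α μ, hg.pd_symm hΩ hx μ α ν]
  ring

end metric

/-! ## The connection of an orthonormal coframe -/

section coframe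
variable {Ω : Set (Fin 4 → ℝ)} {g θ : (Fin 4 → ℝ) → Matrix (Fin 4) (Fin 4) ℝ} {x : Fin 4 → ℝ}

/-- The matrix `ω` of the connection in a coframe, `∇_α θ = ω θ`. -/
def conn (g θ : (Fin 4 → ℝ) → Matrix (Fin 4) (Fin 4) ℝ) (α : Fin 4) (x : Fin 4 → ℝ) :
    Matrix (Fin 4) (Fin 4) ℝ := (pdM α θ x - θ x * chrM g α x) * (θ x)⁻¹

lemma pdM_coframe (h : IsCoframe (g x) (θ x)) (α : Fin 4) :
    pdM α θ x = conn g θ α x * θ x + θ x * chrM g α x := by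
  rw [conn, Matrix.mul_assoc, h.inv_mul, Matrix.mul_one, sub_add_cancel]

/-- Differentiating θᵀηθ = g and using ∇g = 0 gives θᵀ(ωᵀη + ηω)θ = 0, and θ is invertible. So ω
lies in the Lorentz Lie algebra. -/
lemma conn_antisymm (hg : IsLorentzMetricOn Ω g) (hΩ : IsOpen Ω) (hx : x ∈ Ω)
    (hθ : ∀ᶠ y in 𝓝 x, IsCoframe (g y) (θ y))
    (hd : ∀ i j, DifferentiableAt ℝ (fun y => θ y i j) x) (α : Fin 4) :
    (conn g θ α x).transpose * minkowski + minkowski * conn g θ α x = 0 := by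
  have h := hθ.self_of_nhds
  have h1 : pdM α g x = (pdM α θ x).transpose * (minkowski * θ x) +
      (θ x).transpose * (minkowski * pdM α θ x) := by
    have e : g =ᶠ[𝓝 x] fun y => (θ y).transpose * (minkowski * θ y) := by
      filter_upwards [hθ] with y hy
      rw [← Matrix.mul_assoc, hy.metric]
    have hc : ∀ i j, DifferentiableAt ℝ (fun _ : Fin 4 → ℝ => minkowski i j) x :=
      fun i j => differentiableAt_const _
    rw [pdM_congr e, pdM_mul (M := fun y => (θ y).transpose) (N := fun y => minkowski * θ y)
      (fun i j => hd j i) (differentiableAt_mul_entries hc hd),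
      pdM_mul (M := fun _ => minkowski) hc hd, pdM_const, Matrix.zero_mul, zero_add, pdM_transpose]
  rw [hg.pdM_metric hΩ hx, pdM_coframe h, ← h.metric] at h1
  set C := chrM g α x
  set W := conn g θ α x
  set T := θ x
  have h2 : T.transpose * (W.transpose * minkowski + minkowski * W) * T = 0 := by
    have h3 : T.transpose * (W.transpose * minkowski + minkowski * W) * T =
        ((W * T + T * C).transpose * (minkowski * T) +
          T.transpose * (minkowski * (W * T + T * C))) -
        (T.transpose * minkowski * T * C + C.transpose * (T.transpose * minkowski * T)) := by
      simp only [Matrix.transpose_add, Matrix.transpose_mul, Matrix.mul_add, Matrix.add_mul,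
        Matrix.mul_assoc]
      abel
    rw [h3, h1, sub_self]
  have h4 : T⁻¹.transpose * T.transpose = 1 := by
    rw [← Matrix.transpose_mul, h.mul_inv, Matrix.transpose_one]
  calc _ = (T⁻¹.transpose * T.transpose) * (W.transpose * minkowski + minkowski * W) *
        (T * T⁻¹) := by rw [h4, h.mul_inv, Matrix.one_mul, Matrix.mul_one]
    _ = T⁻¹.transpose * (T.transpose * (W.transpose * minkowski + minkowski * W) * T) * T⁻¹ := by
        simp only [Matrix.mul_assoc]
    _ = 0 := by rw [h2, Matrix.mul_zero, Matrix.zero_mul]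

lemma nablaB_congr {B B' : (Fin 4 → ℝ) → Tensor2} (H : B =ᶠ[𝓝 x] B') (α : Fin 4) :
    nablaB g B α x = nablaB g B' α x := by
  ext μ ν
  simp only [nablaB, Matrix.of_apply, H.self_of_nhds]
  rw [pd_congr (f := fun y => B y μ ν) (h := fun y => B' y μ ν)
    (H.mono fun y hy => by simp only [hy])]

/-- The covariant derivative of a bivector field with constant components in a coframe. -/
lemma nablaB_pull (h : IsCoframe (g x) (θ x))
    (hd : ∀ i j, DifferentiableAt ℝ (fun y => θ y i j) x) (X : Tensor2) (α : Fin 4) :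
    nablaB g (fun y => pull (θ y) X) α x =
      pull (θ x) ((toC (conn g θ α x)).transpose * X + X * toC (conn g θ α x)) := by
  have h1 : (Matrix.of fun μ ν => pd α (fun y => pull (θ y) X μ ν) x) =
      (toC (pdM α θ x)).transpose * X * toC (θ x) +
        (toC (θ x)).transpose * X * toC (pdM α θ x) := by
    ext μ ν
    have e : (fun y => pull (θ y) X μ ν) =
        fun y => ∑ a, ∑ b, ((θ y a μ * θ y b ν : ℝ) : ℂ) * X a b := by
      funext y
      rw [pull_entry]
      refine Finset.sum_congr rfl fun a _ => Finset.sum_congr rfl fun b _ => ?_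
      push_cast; ring
    have hm : ∀ a b, DifferentiableAt ℝ (fun y => θ y a μ * θ y b ν) x :=
      fun a b => (hd a μ).fun_mul (hd b ν)
    have hm' : ∀ a b, DifferentiableAt ℝ (fun y => ((θ y a μ * θ y b ν : ℝ) : ℂ) * X a b) x :=
      fun a b => (Complex.ofRealCLM.differentiableAt.comp x (hm a b)).mul_const _
    rw [Matrix.of_apply, e, pd_sum fun a _ => DifferentiableAt.fun_sum fun b _ => hm' a b]
    simp only [Matrix.add_apply, Matrix.mul_apply, Finset.sum_mul, Matrix.transpose_apply,
      toC_apply]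
    rw [Finset.sum_comm (f := fun j i => (pdM α θ x i μ : ℂ) * X i j * (θ x j ν : ℂ)),
      Finset.sum_comm (f := fun j i => (θ x i μ : ℂ) * X i j * (pdM α θ x j ν : ℂ)),
      ← Finset.sum_add_distrib]
    refine Finset.sum_congr rfl fun a _ => ?_
    rw [pd_sum fun b _ => hm' a b, ← Finset.sum_add_distrib]
    refine Finset.sum_congr rfl fun b _ => ?_
    rw [pd_ofReal_mul_const (hm a b), pd_mul (hd a μ) (hd b ν)]
    simp only [pdM, Matrix.of_apply]
    push_cast; ring
  have h2 : nablaB g (fun y => pull (θ y) X) α x =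
      (Matrix.of fun μ ν => pd α (fun y => pull (θ y) X μ ν) x) -
        ((toC (chrM g α x)).transpose * pull (θ x) X + pull (θ x) X * toC (chrM g α x)) := by
    ext μ ν
    simp only [nablaB, Matrix.of_apply, Matrix.sub_apply, Matrix.add_apply, Matrix.mul_apply,
      Matrix.transpose_apply, toC_apply, chrM, Finset.sum_add_distrib]
    congr 2
    exact Finset.sum_congr rfl fun _ _ => mul_comm _ _
  have h3 : toC (pdM α θ x) = toC (conn g θ α x) * toC (θ x) + toC (θ x) * toC (chrM g α x) := by
    rw [pdM_coframe h, ← toC_mul, ← toC_mul]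
    ext; simp
  rw [h2, h1, h3]
  simp only [pull_apply, Matrix.transpose_add, Matrix.transpose_mul, Matrix.mul_add, Matrix.add_mul,
        Matrix.mul_assoc]
  abel

/-- The covariant derivative of the vectors dual to a coframe. -/
lemma mul_nablaV_dualFrame {e : Fin 4 → (Fin 4 → ℝ) → Fin 4 → ℝ}
    (hθ : ∀ᶠ y in 𝓝 x, IsCoframe (g y) (θ y))
    (hd : ∀ i j, DifferentiableAt ℝ (fun y => θ y i j) x)
    (he : ∀ᶠ y in 𝓝 x, ∀ a, e a y = dualFrame (θ y) a)
    (hed : ∀ a μ, DifferentiableAt ℝ (fun y => e a y μ) x) (α : Fin 4) :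
    θ x * (Matrix.of fun μ a => nablaV g (e a) α μ x) = -conn g θ α x := by
  have h := hθ.self_of_nhds
  set E : (Fin 4 → ℝ) → Matrix (Fin 4) (Fin 4) ℝ := fun y => Matrix.of fun μ a => e a y μ with hE
  have hE1 : ∀ᶠ y in 𝓝 x, E y = (θ y)⁻¹ := by
    filter_upwards [he] with y hy
    ext μ a
    simp [hE, hy, dualFrame]
  have h1 : (Matrix.of fun μ a => nablaV g (e a) α μ x) = pdM α E x + chrM g α x * E x := by
    ext μ a
    simp [nablaV, pdM, hE, chrM, Matrix.mul_apply]
  -- Differentiating θE = 1 turns ∇θ = ωθ into θ∇E = -ω.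
  have h2 : pdM α θ x * E x + θ x * pdM α E x = 0 := by
    rw [← pdM_mul (N := E) hd fun μ a => hed a μ, ← pdM_const (x := x) 1 α]
    refine pdM_congr ?_ α
    filter_upwards [hE1, hθ] with y hy hc
    rw [hy, hc.mul_inv]
  have h3 : θ x * E x = 1 := by rw [hE1.self_of_nhds, h.mul_inv]
  rw [h1, Matrix.mul_add, ← Matrix.mul_assoc, eq_neg_of_add_eq_zero_right h2, pdM_coframe h,
    Matrix.add_mul, Matrix.mul_assoc (conn g θ α x), h3, Matrix.mul_one]
  abel

/-- The coefficients in the dual frame are those of -ω. Summing e_b⊗θ^b to the identity turns the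
derivative index back into the coordinate index α, and lowering e_c produces ηθ. -/
lemma connTensor_eq {e : Fin 4 → (Fin 4 → ℝ) → Fin 4 → ℝ}
    (hθ : ∀ᶠ y in 𝓝 x, IsCoframe (g y) (θ y))
    (hd : ∀ i j, DifferentiableAt ℝ (fun y => θ y i j) x)
    (he : ∀ᶠ y in 𝓝 x, ∀ a, e a y = dualFrame (θ y) a)
    (hed : ∀ a μ, DifferentiableAt ℝ (fun y => e a y μ) x) (α : Fin 4) :
    (Matrix.of fun μ ν => connTensor g e x α μ ν) =
      -((θ x).transpose * ((conn g θ α x).transpose * minkowski) * θ x) := by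
  have h := hθ.self_of_nhds
  have he' := he.self_of_nhds
  have hco : ∀ c μ, coframe e x c μ = θ x c μ := by
    intro c μ
    have : (Matrix.of fun a ν => e a x ν) = (θ x)⁻¹.transpose := by
      ext a ν; simp [he', dualFrame]
    rw [coframe, this, ← Matrix.transpose_nonsing_inv, Matrix.transpose_apply,
      Matrix.nonsing_inv_nonsing_inv _ h.isUnit_det]
  have hγ : ∀ c a b, connCoeff g e c a b x = ∑ κ, e b x κ * (-(conn g θ κ x c a)) := by
    intro c a b
    rw [connCoeff]
    refine Finset.sum_congr rfl fun κ _ => ?_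
    have := congrFun (congrFun (mul_nablaV_dualFrame hθ hd he hed κ) c) a
    rw [Matrix.neg_apply] at this
    rw [← this, Matrix.mul_apply, Finset.mul_sum]
    refine Finset.sum_congr rfl fun μ _ => ?_
    rw [hco, Matrix.of_apply]; ring
  have hδ : ∀ κ, ∑ b, e b x κ * θ x b α = if κ = α then 1 else 0 := by
    intro κ
    rw [← Matrix.one_apply, ← h.inv_mul, Matrix.mul_apply]
    simp [he', dualFrame]
  ext μ ν
  rw [Matrix.of_apply, connTensor]
  have h1 : ∀ a c, ∑ b, connCoeff g e c a b x * coframe e x b α = -(conn g θ α x c a) := by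
    intro a c
    simp only [hγ, hco, Finset.sum_mul]
    rw [Finset.sum_comm]
    have : ∀ κ, ∑ b, e b x κ * -conn g θ κ x c a * θ x b α =
        (if κ = α then 1 else 0) * (-conn g θ κ x c a) := by
      intro κ
      rw [← hδ, Finset.sum_mul]
      exact Finset.sum_congr rfl fun b _ => by ring
    rw [Finset.sum_congr rfl fun κ _ => this κ]
    simp
  have h2 : ∀ c, (g x).mulVec (e c x) ν = (minkowski * θ x) c ν := by
    intro c
    rw [he' c, mulVec_dualFrame h, minkowski, Matrix.diagonal_mul, Matrix.diagonal_apply_eq]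
  have h3 : ∀ a, ∑ b, ∑ c, connCoeff g e c a b x * coframe e x b α * coframe e x a μ *
      (g x).mulVec (e c x) ν = ∑ c, θ x a μ * (-(conn g θ α x c a)) * (minkowski * θ x) c ν := by
    intro a
    rw [Finset.sum_comm]
    refine Finset.sum_congr rfl fun c _ => ?_
    rw [← h1, ← h2, Finset.mul_sum, Finset.sum_mul]
    exact Finset.sum_congr rfl fun b _ => by rw [hco a]; ring
  simp only [h3]
  have h4 : (θ x).transpose * ((conn g θ α x).transpose * minkowski) * θ x =
      (θ x).transpose * (conn g θ α x).transpose * (minkowski * θ x) := by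
    simp only [Matrix.mul_assoc]
  rw [h4, Matrix.neg_apply]
  have h5 : ∀ c, ((θ x).transpose * (conn g θ α x).transpose) μ c =
      ∑ a, θ x a μ * conn g θ α x c a := fun c => Matrix.mul_apply
  rw [Matrix.mul_apply]
  simp only [h5, Finset.sum_mul]
  rw [Finset.sum_comm, ← Finset.sum_neg_distrib]
  refine Finset.sum_congr rfl fun c _ => ?_
  rw [← Finset.sum_neg_distrib]
  exact Finset.sum_congr rfl fun a _ => by ring

end coframe

end

section

/-! # The connection tensor -/

/-- Components of the covariant derivative of a bivector with constant components `X`. -/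
def covC (W : Matrix (Fin 4) (Fin 4) ℝ) (X : Tensor2) : Tensor2 :=
  (toC W).transpose * X + X * toC W

lemma covC_add (W : Matrix (Fin 4) (Fin 4) ℝ) (X Y : Tensor2) :
    covC W (X + Y) = covC W X + covC W Y := by
  simp only [covC, Matrix.mul_add, Matrix.add_mul]; abel

lemma covC_smul (W : Matrix (Fin 4) (Fin 4) ℝ) (c : ℂ) (X : Tensor2) :
    covC W (c • X) = c • covC W X := by
  simp only [covC, Matrix.mul_smul, Matrix.smul_mul, smul_add]

lemma exists_of_antisymm {W : Matrix (Fin 4) (Fin 4) ℝ}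
    (hW : W.transpose * minkowski + minkowski * W = 0) :
    ∃ a b c d e f : ℝ, W = !![0, a, b, c; a, 0, d, e; b, -d, 0, f; c, -e, -f, 0] := by
  have h : ∀ i j, W j i * minkowski j j + minkowski i i * W i j = 0 := by
    intro i j
    have := congrFun (congrFun hW i) j
    simpa [Matrix.mul_apply, minkowski, Matrix.diagonal_apply] using this
  refine ⟨W 0 1, W 0 2, W 0 3, W 1 2, W 1 3, W 2 3, ?_⟩
  have h00 := h 0 0
  have h11 := h 1 1
  have h22 := h 2 2
  have h33 := h 3 3
  have h01 := h 0 1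
  have h02 := h 0 2
  have h03 := h 0 3
  have h12 := h 1 2
  have h13 := h 1 3
  have h23 := h 2 3
  simp only [minkowski_apply] at h00 h11 h22 h33 h01 h02 h03 h12 h13 h23
  simp at h00 h11 h22 h33 h01 h02 h03 h12 h13 h23
  ext i j
  fin_cases i <;> fin_cases j <;> simp <;> linarith

/-- With one index raised, `covC W X` is the commutator of X and ω. The anti-self-dual part of ω
commutes with every `sd i`. On the self-dual part, the sum of commutators multiplied by `sd i` acts
as a scalar. So A is four times the self-dual part of ωᵀη, and the conjugate supplies the other
half. The check is by entries in the six parameters of ω. -/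
lemma sum_covC_sd {W : Matrix (Fin 4) (Fin 4) ℝ}
    (hW : W.transpose * minkowski + minkowski * W = 0) (A : Tensor2)
    (hA : A = ∑ i, covC W (sd i) * toC minkowski * sd i) (i j : Fin 4) :
    A i j + (starRingEnd ℂ) (A i j) = 4 * ((W.transpose * minkowski) i j : ℝ) := by
  obtain ⟨a, b, c, d, e, f, rfl⟩ := exists_of_antisymm hW
  subst hA
  have h1 : toC !![0, a, b, c; a, 0, d, e; b, -d, 0, f; c, -e, -f, 0] =
      (!![0, (a : ℂ), b, c; a, 0, d, e; b, -d, 0, f; c, -e, -f, 0] : Matrix (Fin 4) (Fin 4) ℂ) := by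
    ext i j; fin_cases i <;> fin_cases j <;> simp
  have h2 : !![0, a, b, c; a, 0, d, e; b, -d, 0, f; c, -e, -f, 0].transpose * minkowski =
      !![0, a, b, c; -a, 0, -d, -e; -b, d, 0, -f; -c, e, f, 0] := by
    ext i j
    rw [minkowski, Matrix.mul_diagonal]
    fin_cases i <;> fin_cases j <;> simp
  rw [h2, Fin.sum_univ_three, toC_minkowski]
  unfold covC
  rw [h1]
  fin_cases i <;> fin_cases j <;>
    simp [sd, Matrix.mul_apply, Fin.sum_univ_four, Matrix.transpose] <;>
    ring_nf <;> simp only [Complex.I_sq] <;> ring_nf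

end

/-! ### The connection tensor of a principal frame from the computed bivectors. -/

section

section
variable {Ω V : Set (Fin 4 → ℝ)} {g : (Fin 4 → ℝ) → Matrix (Fin 4) (Fin 4) ℝ}
  {e : Fin 4 → (Fin 4 → ℝ) → Fin 4 → ℝ} {x : Fin 4 → ℝ}

/-- The oriented orthonormal coframe dual to a frame. -/
def coframeM (e : Fin 4 → (Fin 4 → ℝ) → Fin 4 → ℝ) (x : Fin 4 → ℝ) :
    Matrix (Fin 4) (Fin 4) ℝ := (Matrix.of fun a => e a x).transpose⁻¹

lemma IsOrientedFrameOn.isCoframe (he : IsOrientedFrameOn g V e) (hx : x ∈ V) :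
    IsCoframe (g x) (coframeM e x) ∧ ∀ a, e a x = dualFrame (coframeM e x) a := by
  have h := isCoframe_of_tetrad (G := g x) (e := fun a => e a x) (he.orthonormal x hx)
    (he.oriented x hx)
  exact ⟨h.1, fun a => (congrFun h.2 a).symm⟩

lemma IsOrientedFrameOn.contDiffAt (he : IsOrientedFrameOn g V e) (hV : IsOpen V) (hx : x ∈ V)
    (a μ : Fin 4) : ContDiffAt ℝ ∞ (fun y => e a y μ) x :=
  contDiffAt_pi.1 ((he.smooth a).contDiffAt (hV.mem_nhds hx)) μ

lemma IsOrientedFrameOn.coframeM_differentiableAt (he : IsOrientedFrameOn g V e)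
    (hg : IsLorentzMetricOn Ω g) (hΩ : IsOpen Ω) (hV : IsOpen V) (hVΩ : V ⊆ Ω) (hx : x ∈ V)
    (i j : Fin 4) : DifferentiableAt ℝ (fun y => coframeM e y i j) x := by
  -- θ^i is e_i with its index lowered, up to the sign η_ii. This expression in g and e avoids
  -- differentiating an inverse matrix.
  have h1 : (fun y => coframeM e y i j) =ᶠ[𝓝 x]
      fun y => minkowski i i * ∑ ν, g y j ν * e i y ν := by
    filter_upwards [hV.mem_nhds hx] with y hy
    obtain ⟨h2, h3⟩ := he.isCoframe hy
    have h4 := mulVec_dualFrame h2 i j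
    rw [← h3 i] at h4
    have h5 : minkowski i i * minkowski i i = 1 := by
      fin_cases i <;> simp [minkowski_apply]
    have h6 : (g y).mulVec (e i y) j = ∑ ν, g y j ν * e i y ν := rfl
    rw [← h6, h4, ← mul_assoc, h5, one_mul]
  refine DifferentiableAt.congr_of_eventuallyEq ?_ h1
  refine (DifferentiableAt.fun_sum fun ν _ => ?_).const_mul _
  exact (hg.differentiableAt hΩ (hVΩ hx) j ν).fun_mul
    ((he.contDiffAt hV hx i ν).differentiableAt (by simp))

/-- The triad of a frame, in terms of its coframe. -/
lemma IsOrientedFrameOn.triad_eq (he : IsOrientedFrameOn g V e) (hx : x ∈ V) :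
    frameU (g x) (fun a => e a x) 1 = rt • pull (coframeM e x) (sd 0) ∧
    frameLp (g x) (fun a => e a x) = pull (coframeM e x) sdP ∧
    frameLm (g x) (fun a => e a x) = pull (coframeM e x) sdM := by
  obtain ⟨h, h'⟩ := he.isCoframe hx
  rw [show (fun a => e a x) = dualFrame (coframeM e x) from funext h', frameLp_dualFrame h,
    frameLm_dualFrame h]
  exact ⟨frameU_dualFrame h 0, rfl, rfl⟩

/-- The contraction is a fixed polynomial in the frame components X(e_a, e_b), which are visibly
continuous. It is needed for (ℓ₊,X), whose continuity keeps the sign ε locally constant. -/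
lemma continuousAt_pair {V : Set (Fin 4 → ℝ)} {X : (Fin 4 → ℝ) → Tensor2}
    (he : IsOrientedFrameOn g V e) (hV : IsOpen V) (hx : x ∈ V)
    (hX : ∀ μ ν, ContinuousAt (fun y => X y μ ν) x) (Y : Tensor2) :
    ContinuousAt (fun y => pair (g y) (pull (coframeM e y) Y) (X y)) x := by
  have h1 : (fun y => pair (g y) (pull (coframeM e y) Y) (X y)) =ᶠ[𝓝 x] fun y =>
      pair minkowski Y (Matrix.of fun a b => ∑ μ, ∑ ν, X y μ ν * (e a y μ : ℂ) * (e b y ν : ℂ)) := by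
    filter_upwards [hV.mem_nhds hx] with y hy
    obtain ⟨h, h'⟩ := he.isCoframe hy
    set T := coframeM e y
    have h2 : X y = pull T ((toC T⁻¹).transpose * X y * toC T⁻¹) := by
      have h3 : pull T (pull T⁻¹ (X y)) = X y := by rw [pull_pull, h.inv_mul, pull_one]
      exact h3.symm
    rw [h2, pair_pull h, ← h2]
    congr 1
    ext a b
    rw [← pull_apply, pull_entry, Matrix.of_apply]
    refine Finset.sum_congr rfl fun μ _ => Finset.sum_congr rfl fun ν _ => ?_
    rw [h', h']; simp only [dualFrame]; ring
  refine ContinuousAt.congr ?_ h1.symm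
  have h4 : ∀ a b, ContinuousAt
      (fun y => ∑ μ, ∑ ν, X y μ ν * (e a y μ : ℂ) * (e b y ν : ℂ)) x := by
    intro a b
    have hc : ∀ a μ, ContinuousAt (fun y => (e a y μ : ℂ)) x := fun a μ =>
      Complex.continuous_ofReal.continuousAt.comp (he.contDiffAt hV hx a μ).continuousAt
    exact tendsto_finsetSum _ fun μ _ => tendsto_finsetSum _ fun ν _ =>
      ((hX μ ν).mul (hc a μ)).mul (hc b ν)
  simp only [pair_minkowski, Matrix.of_apply]
  fun_prop (disch := assumption)

/-- The formula for the connection tensor of a frame in terms of bivectors that are locally, up to a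
constant sign, those of the frame. -/
theorem connTensor_eq_calH (he : IsOrientedFrameOn g V e)
    (hg : IsLorentzMetricOn Ω g) (hΩ : IsOpen Ω) (hV : IsOpen V) (hVΩ : V ⊆ Ω) (hx : x ∈ V)
    {U Lp Lm : (Fin 4 → ℝ) → Tensor2} {ε : ℂ} (hε : ε ^ 2 = 1)
    (hU : ∀ᶠ y in 𝓝 x, U y = ε • frameU (g y) (fun a => e a y) 1)
    (hLp : ∀ᶠ y in 𝓝 x, Lp y = ε • frameLp (g y) (fun a => e a y))
    (hLm : ∀ᶠ y in 𝓝 x, Lm y = ε • frameLm (g y) (fun a => e a y)) (α μ ν : Fin 4) :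
    (connTensor g e x α μ ν : ℂ) = (1 / (√2 : ℝ) : ℂ) * (calH g U Lp Lm x α μ ν +
      (starRingEnd ℂ) (calH g U Lp Lm x α μ ν)) := by
  have hV' := hV.mem_nhds hx
  set θ := coframeM e with hθdef
  have hθ : ∀ᶠ y in 𝓝 x, IsCoframe (g y) (θ y) := by
    filter_upwards [hV'] with y hy using (he.isCoframe hy).1
  have h := hθ.self_of_nhds
  have hed : ∀ a μ, DifferentiableAt ℝ (fun y => e a y μ) x := fun a μ =>
    (he.contDiffAt hV hx a μ).differentiableAt (by simp)
  have hd := he.coframeM_differentiableAt hg hΩ hV hVΩ hx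
  have hee : ∀ᶠ y in 𝓝 x, ∀ a, e a y = dualFrame (θ y) a := by
    filter_upwards [hV'] with y hy using (he.isCoframe hy).2
  have hU' : U =ᶠ[𝓝 x] fun y => pull (θ y) ((ε * rt) • sd 0) := by
    filter_upwards [hU, hV'] with y hy hyV
    rw [hy, (he.triad_eq hyV).1, map_smul, mul_smul]
  have hLp' : Lp =ᶠ[𝓝 x] fun y => pull (θ y) (ε • sdP) := by
    filter_upwards [hLp, hV'] with y hy hyV
    rw [hy, (he.triad_eq hyV).2.1, map_smul]
  have hLm' : Lm =ᶠ[𝓝 x] fun y => pull (θ y) (ε • sdM) := by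
    filter_upwards [hLm, hV'] with y hy hyV
    rw [hy, (he.triad_eq hyV).2.2, map_smul]
  set W := conn g θ α x with hW
  have hWa := conn_antisymm hg hΩ (hVΩ hx) hθ hd α
  set S := ∑ i, covC W (sd i) * toC minkowski * sd i with hS
  -- Each product contains ε twice, so only ε² = 1 remains. In the terms with ℓ₊ and ℓ₋ the mixed
  -- products of `sd 1` and `sd 2` cancel, and the whole becomes half the sum over the basis `sd`.
  have hH : calH g U Lp Lm x α = -(rt • pull (θ x) ((1 / 2 : ℂ) • S)) := by
    rw [calH, nablaB_congr hU', nablaB_congr hLp', nablaB_congr hLm', hU'.self_of_nhds,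
      hLp'.self_of_nhds, hLm'.self_of_nhds, nablaB_pull h hd, nablaB_pull h hd, nablaB_pull h hd,
      dot_pull h, dot_pull h, dot_pull h, ← map_add, ← map_add, ← rt, neg_smul]
    congr 3
    change covC W _ * _ * _ + covC W _ * _ * _ + covC W _ * _ * _ = _
    simp only [sdP, sdM, covC_smul, sub_eq_add_neg, ← neg_smul, covC_add, hS, Fin.sum_univ_three]
    simp only [Matrix.smul_mul, Matrix.mul_smul, Matrix.add_mul, Matrix.mul_add, smul_add,
      smul_smul]
    have e1 : ε * rt * (ε * rt) = 1 / 2 := by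
      rw [show ε * rt * (ε * rt) = ε ^ 2 * rt ^ 2 by ring, hε, rt_sq, one_mul]
    ext i j
    simp only [Matrix.add_apply, Matrix.smul_apply, smul_eq_mul]
    linear_combination ((covC W (sd 0) * toC minkowski * sd 0) i j) * e1 +
      (1 / 2 * ((covC W (sd 1) * toC minkowski * sd 1) i j) +
        1 / 2 * ((covC W (sd 2) * toC minkowski * sd 2) i j)) * hε -
      ε ^ 2 / 2 * ((covC W (sd 2) * toC minkowski * sd 2) i j) * Complex.I_sq
  have hC := congrFun (congrFun (connTensor_eq hθ hd hee hed α) μ) ν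
  rw [Matrix.of_apply] at hC
  have hC' : (connTensor g e x α μ ν : ℂ) =
      -∑ a, ∑ b, (θ x a μ : ℂ) * (((W.transpose * minkowski) a b : ℝ) : ℂ) * (θ x b ν : ℂ) := by
    rw [hC, Matrix.neg_apply, Complex.ofReal_neg, Matrix.mul_apply]
    simp only [Matrix.mul_apply (M := (θ x).transpose), Finset.sum_mul, Matrix.transpose_apply]
    rw [Finset.sum_comm]
    push_cast
    rfl
  rw [hC', hH, ← rt]
  simp only [Matrix.neg_apply, Matrix.smul_apply, map_neg, map_mul, smul_eq_mul, conj_rt,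
    pull_entry, map_sum, Complex.conj_ofReal]
  have e2 : ∀ z w : ℂ, rt * (-(rt * z) + -(rt * w)) = -(1 / 2 * (z + w)) := by
    intro z w
    linear_combination (-(z + w)) * rt_sq
  rw [e2, ← Finset.sum_add_distrib, Finset.mul_sum]
  congr 1
  refine Finset.sum_congr rfl fun a _ => ?_
  rw [← Finset.sum_add_distrib, Finset.mul_sum]
  refine Finset.sum_congr rfl fun b _ => ?_
  have := sum_covC_sd hWa S hS a b
  have e3 : (starRingEnd ℂ) (1 / 2 : ℂ) = 1 / 2 := by rw [map_div₀, map_one, map_ofNat]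
  rw [e3]
  linear_combination (-(1 / 4) * (θ x a μ : ℂ) * (θ x b ν : ℂ)) * this

/-- The bivectors computed from the Weyl tensor determine the connection tensor of a Weyl principal
frame. -/
theorem IsWeylPrincipalFrameOn.connTensor_eq (he : IsWeylPrincipalFrameOn g V e)
    (hg : IsLorentzMetricOn Ω g) (hΩ : IsOpen Ω) (hV : IsOpen V) (hVΩ : V ⊆ Ω)
    {X : (Fin 4 → ℝ) → Tensor2} (hX : ∀ μ ν, ContDiffOn ℝ ∞ (fun x => X x μ ν) V)
    (hne : ∀ x ∈ V, image (g x) (calW2 g x) (X x) ≠ 0)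
    {s : (Fin 4 → ℝ) → ℂ} (hs : ContinuousOn s V)
    (hs2 : ∀ x ∈ V, s x ^ 2 = -form (g x) (calW2 g x) (X x) (X x)) (hx : x ∈ V) :
    s x ≠ 0 ∧ ip (g x) (weylLp g X s x) (X x) ≠ 0 ∧
    (∃ ε : ℂ, (ε = 1 ∨ ε = -1) ∧
      weylU g X s x = ε • frameU (g x) (fun a => e a x) 1 ∧
      weylLp g X s x = ε • frameLp (g x) (fun a => e a x) ∧
      weylLm g X s x = ε • frameLm (g x) (fun a => e a x)) ∧
    ∀ α μ ν, (connTensor g e x α μ ν : ℂ) = (1 / (√2 : ℝ) : ℂ) *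
      (calH g (weylU g X s) (weylLp g X s) (weylLm g X s) x α μ ν +
        (starRingEnd ℂ) (calH g (weylU g X s) (weylLp g X s) (weylLm g X s) x α μ ν)) := by
  have key : ∀ y ∈ V, ∃ ε : ℂ, (ε = 1 ∨ ε = -1) ∧ s y ≠ 0 ∧
      s y = ε * pair (g y) (pull (coframeM e y) sdP) (X y) ∧
      ip (g y) (weylLp g X s y) (X y) ≠ 0 ∧
      weylU g X s y = ε • frameU (g y) (fun a => e a y) 1 ∧
      weylLp g X s y = ε • frameLp (g y) (fun a => e a y) ∧
      weylLm g X s y = ε • frameLm (g y) (fun a => e a y) := by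
    intro y hy
    obtain ⟨h, h'⟩ := he.isCoframe hy
    obtain ⟨t1, t2, t3⟩ := he.triad_eq hy
    have hT := isTriad_pull h
    rw [← t1, ← t2, ← t3] at hT
    rw [← t2]
    exact weylTriad_eq hT (he.canonical y hy) (hne y hy) (hs2 y hy)
  obtain ⟨ε, hε, hs0, hsε, hip, hU, hLp, hLm⟩ := key x hx
  refine ⟨hs0, hip, ⟨ε, hε, hU, hLp, hLm⟩, ?_⟩
  set a : (Fin 4 → ℝ) → ℂ := fun y => pair (g y) (pull (coframeM e y) sdP) (X y) with ha
  have hac : ContinuousAt a x := continuousAt_pair he.toIsOrientedFrameOn hV hx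
    (fun μ ν => ((hX μ ν).contDiffAt (hV.mem_nhds hx)).continuousAt) sdP
  have hsc : ContinuousAt s x := hs.continuousAt (hV.mem_nhds hx)
  have hε2 : ε ^ 2 = 1 := by rcases hε with rfl | rfl <;> norm_num
  -- At x this sum is 2s ≠ 0, while at a point of the opposite sign it would vanish. Thus mere
  -- continuity of s fixes the sign near x, and there the computed bivectors inherit the smoothness
  -- of the frame.
  have hlim : ∀ᶠ y in 𝓝 x, s y + ε * a y ≠ 0 := by
    refine (hsc.add (hac.const_mul ε)).eventually_ne ?_
    change s x + ε * a x ≠ 0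
    rw [← hsε]
    intro h0
    exact hs0 (by linear_combination (1 / 2 : ℂ) * h0)
  have hall : ∀ᶠ y in 𝓝 x, weylU g X s y = ε • frameU (g y) (fun a => e a y) 1 ∧
      weylLp g X s y = ε • frameLp (g y) (fun a => e a y) ∧
      weylLm g X s y = ε • frameLm (g y) (fun a => e a y) := by
    filter_upwards [hlim, hV.mem_nhds hx] with y hy hyV
    obtain ⟨ε', hε', -, hsε', -, hU', hLp', hLm'⟩ := key y hyV
    have : ε' = ε := by
      by_contra hne'
      have h1 : ε' = -ε := by
        rcases hε with rfl | rfl <;> rcases hε' with rfl | rfl <;> simp_all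
      apply hy
      rw [hsε', h1]; ring
    subst this
    exact ⟨hU', hLp', hLm'⟩
  exact connTensor_eq_calH he.toIsOrientedFrameOn hg hΩ hV hVΩ hx hε2
    (hall.mono fun y hy => hy.1) (hall.mono fun y hy => hy.2.1) (hall.mono fun y hy => hy.2.2)

end

end

section

/-! # Smoothness of the curvature -/

section smooth
variable {Ω : Set (Fin 4 → ℝ)} {g : (Fin 4 → ℝ) → Matrix (Fin 4) (Fin 4) ℝ} {x : Fin 4 → ℝ}

lemma contDiffAt_pd {f : (Fin 4 → ℝ) → ℝ} (hf : ContDiffAt ℝ ∞ f x) (α : Fin 4) :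
    ContDiffAt ℝ ∞ (fun y => pd α f y) x :=
  (hf.fderiv_right (m := ∞) (by simp)).clm_apply contDiffAt_const

lemma pd_comm {f : (Fin 4 → ℝ) → ℝ} (hf : ContDiffAt ℝ ∞ f x) (α β : Fin 4) :
    pd α (fun y => pd β f y) x = pd β (fun y => pd α f y) x := by
  have h1 : DifferentiableAt ℝ (fderiv ℝ f) x :=
    (hf.fderiv_right (m := ∞) (by simp)).differentiableAt (by simp)
  have h2 : ∀ α β, pd α (fun y => pd β f y) x =
      fderiv ℝ (fderiv ℝ f) x (Pi.single α 1) (Pi.single β 1) := by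
    intro α β
    simp only [pd]
    rw [fderiv_clm_apply h1 (differentiableAt_const _)]
    simp
  have h3 : (2 : WithTop ℕ∞) ≤ ∞ := WithTop.coe_le_coe.2 (le_top : (2 : ℕ∞) ≤ ⊤)
  rw [h2, h2]
  exact (hf.isSymmSndFDerivAt (by simpa using h3)).eq _ _

lemma contDiffAt_det {M : (Fin 4 → ℝ) → Matrix (Fin 4) (Fin 4) ℝ}
    (hM : ∀ i j, ContDiffAt ℝ ∞ (fun y => M y i j) x) : ContDiffAt ℝ ∞ (fun y => (M y).det) x := by
  simp only [Matrix.det_apply']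
  exact ContDiffAt.sum fun σ _ => contDiffAt_const.mul (contDiffAt_prod fun i _ => hM _ _)

lemma IsLorentzMetricOn.contDiffAt_inv (hg : IsLorentzMetricOn Ω g) (hΩ : IsOpen Ω) (hx : x ∈ Ω)
    (i j : Fin 4) : ContDiffAt ℝ ∞ (fun y => (g y)⁻¹ i j) x := by
  have hd := contDiffAt_det (hg.contDiffAt hΩ hx)
  have hd0 := (hg.isUnit_det hx).ne_zero
  have hadj : ContDiffAt ℝ ∞ (fun y => (g y).adjugate i j) x := by
    simp only [Matrix.adjugate_apply]
    refine contDiffAt_det fun k l => ?_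
    by_cases hk : k = j
    · subst hk
      simp only [Matrix.updateRow_self]
      exact contDiffAt_const
    · simp only [Matrix.updateRow_ne hk]
      exact hg.contDiffAt hΩ hx k l
  have e : (fun y => (g y)⁻¹ i j) = fun y => ((g y).det)⁻¹ * (g y).adjugate i j := by
    funext y
    rw [Matrix.inv_def, Matrix.smul_apply, Ring.inverse_eq_inv', smul_eq_mul]
  rw [e]
  exact (hd.inv hd0).mul hadj

lemma IsLorentzMetricOn.contDiffAt_christoffel (hg : IsLorentzMetricOn Ω g) (hΩ : IsOpen Ω)
    (hx : x ∈ Ω) (ρ μ ν : Fin 4) : ContDiffAt ℝ ∞ (christoffel g ρ μ ν) x := by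
  have h := fun a b c => contDiffAt_pd (hg.contDiffAt hΩ hx a b) c
  exact contDiffAt_const.mul (ContDiffAt.sum fun σ _ => (hg.contDiffAt_inv hΩ hx ρ σ).mul
    (((h _ _ _).add (h _ _ _)).sub (h _ _ _)))

lemma IsLorentzMetricOn.contDiffAt_riemannUp (hg : IsLorentzMetricOn Ω g) (hΩ : IsOpen Ω)
    (hx : x ∈ Ω) (ρ σ μ ν : Fin 4) : ContDiffAt ℝ ∞ (riemannUp g ρ σ μ ν) x := by
  have h := fun a b c => hg.contDiffAt_christoffel hΩ hx a b c
  exact ((contDiffAt_pd (h _ _ _) _).sub (contDiffAt_pd (h _ _ _) _)).add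
    (ContDiffAt.sum fun κ _ => ((h _ _ _).mul (h _ _ _)).sub ((h _ _ _).mul (h _ _ _)))

lemma IsLorentzMetricOn.contDiffAt_ricci (hg : IsLorentzMetricOn Ω g) (hΩ : IsOpen Ω)
    (hx : x ∈ Ω) (β ν : Fin 4) : ContDiffAt ℝ ∞ (ricci g β ν) x :=
  ContDiffAt.sum fun α _ => hg.contDiffAt_riemannUp hΩ hx α β α ν

lemma IsLorentzMetricOn.contDiffAt_weyl (hg : IsLorentzMetricOn Ω g) (hΩ : IsOpen Ω)
    (hx : x ∈ Ω) (α β μ ν : Fin 4) : ContDiffAt ℝ ∞ (weyl g α β μ ν) x := by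
  have hG := hg.contDiffAt hΩ hx
  have hR := hg.contDiffAt_ricci hΩ hx
  have hS : ContDiffAt ℝ ∞ (scalarCurv g) x :=
    ContDiffAt.sum fun β _ => ContDiffAt.sum fun ν _ => (hg.contDiffAt_inv hΩ hx β ν).mul (hR β ν)
  have hRm : ContDiffAt ℝ ∞ (riemann g α β μ ν) x :=
    ContDiffAt.sum fun ρ _ => (hG α ρ).mul (hg.contDiffAt_riemannUp hΩ hx ρ β μ ν)
  exact (hRm.sub (contDiffAt_const.mul (((((hG _ _).mul (hR _ _)).sub ((hG _ _).mul (hR _ _))).sub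
    ((hG _ _).mul (hR _ _))).add ((hG _ _).mul (hR _ _))))).add
      ((contDiffAt_const.mul hS).mul (((hG _ _).mul (hG _ _)).sub ((hG _ _).mul (hG _ _))))

lemma IsLorentzMetricOn.contDiffAt_vol (hg : IsLorentzMetricOn Ω g) (hΩ : IsOpen Ω)
    (hx : x ∈ Ω) (α β μ ν : Fin 4) : ContDiffAt ℝ ∞ (fun y => vol (g y) α β μ ν) x := by
  have hd := contDiffAt_det (hg.contDiffAt hΩ hx)
  have hd0 := (hg.isUnit_det hx).ne_zero
  exact (ContDiffAt.sqrt (hd.abs hd0) (abs_ne_zero.2 hd0)).mul contDiffAt_const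

end smooth

/-! # Symmetries of the curvature -/

section symmetries
variable {Ω : Set (Fin 4 → ℝ)} {g : (Fin 4 → ℝ) → Matrix (Fin 4) (Fin 4) ℝ} {x : Fin 4 → ℝ}

/-- To lower the first index, g is moved inside the derivative, g∂Γ = ∂(gΓ) - (∂g)Γ. The first term
is linear in second derivatives of g, and ∂g is rewritten by metricity. The resulting form exhibits
the symmetries of the curvature. -/
lemma IsLorentzMetricOn.riemann_eq (hg : IsLorentzMetricOn Ω g) (hΩ : IsOpen Ω) (hx : x ∈ Ω)
    (α β μ ν : Fin 4) : riemann g α β μ ν x =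
      (1 / 2) * (pd μ (fun z => pd β (fun y => g y α ν) z) x -
        pd μ (fun z => pd α (fun y => g y β ν) z) x -
        pd ν (fun z => pd β (fun y => g y α μ) z) x +
        pd ν (fun z => pd α (fun y => g y β μ) z) x) -
      ∑ ρ, ∑ σ, g x ρ σ * christoffel g σ μ α x * christoffel g ρ ν β x +
      ∑ ρ, ∑ σ, g x ρ σ * christoffel g σ ν α x * christoffel g ρ μ β x := by
  set C := christoffel g with hC
  have dC : ∀ a b c, DifferentiableAt ℝ (C a b c) x := fun a b c =>
    (hg.contDiffAt_christoffel hΩ hx a b c).differentiableAt (by simp)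
  have dG := hg.differentiableAt hΩ hx
  have dP : ∀ a b c, DifferentiableAt ℝ (fun z => pd c (fun y => g y a b) z) x := fun a b c =>
    (contDiffAt_pd (hg.contDiffAt hΩ hx a b) c).differentiableAt (by simp)
  have low : ∀ μ ν β, pd μ (fun y => ∑ ρ, g y α ρ * C ρ ν β y) x =
      (1 / 2) * (pd μ (fun z => pd ν (fun y => g y α β) z) x +
        pd μ (fun z => pd β (fun y => g y α ν) z) x -
        pd μ (fun z => pd α (fun y => g y ν β) z) x) := by
    intro μ ν β
    rw [pd_congr (h := fun z => (1 / 2) * (pd ν (fun y => g y α β) z + pd β (fun y => g y α ν) z -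
      pd α (fun y => g y ν β) z))]
    · rw [pd_const_mul _ (((dP _ _ _).fun_add (dP _ _ _)).fun_sub (dP _ _ _)),
        pd_sub ((dP _ _ _).fun_add (dP _ _ _)) (dP _ _ _), pd_add (dP _ _ _) (dP _ _ _)]
    · filter_upwards [hΩ.mem_nhds hx] with z hz using hg.mul_christoffel hz α ν β
  have leib : ∀ μ ν β, ∑ ρ, g x α ρ * pd μ (C ρ ν β) x =
      pd μ (fun y => ∑ ρ, g y α ρ * C ρ ν β y) x -
        ∑ ρ, pd μ (fun y => g y α ρ) x * C ρ ν β x := by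
    intro μ ν β
    rw [pd_sum fun ρ _ => (dG α ρ).fun_mul (dC ρ ν β), ← Finset.sum_sub_distrib]
    refine Finset.sum_congr rfl fun ρ _ => ?_
    rw [pd_mul (dG α ρ) (dC ρ ν β)]; ring
  have met : ∀ μ ρ, pd μ (fun y => g y α ρ) x =
      ∑ σ, g x α σ * C σ μ ρ x + ∑ σ, g x ρ σ * C σ μ α x := by
    intro μ ρ
    rw [hg.mul_christoffel hx, hg.mul_christoffel hx, hg.pd_symm hΩ hx μ ρ α,
      hg.pd_symm hΩ hx ρ μ α, hg.pd_symm hΩ hx α μ ρ]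
    ring
  have symG : ∀ a b c d, pd a (fun z => pd b (fun y => g y c d) z) x =
      pd a (fun z => pd b (fun y => g y d c) z) x := by
    intro a b c d
    refine pd_congr ?_ a
    filter_upwards [hΩ.mem_nhds hx] with z hz using hg.pd_symm hΩ hz b c d
  -- In this shape the term cancels the first half of `met` in the Leibniz remainder; only the
  -- second half survives.
  have quad : ∀ μ ν, ∑ ρ, g x α ρ * ∑ κ, C ρ μ κ x * C κ ν β x =
      ∑ ρ, (∑ σ, g x α σ * C σ μ ρ x) * C ρ ν β x := by
    intro μ ν
    simp only [Finset.mul_sum, Finset.sum_mul]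
    rw [Finset.sum_comm]
    exact Finset.sum_congr rfl fun _ _ => Finset.sum_congr rfl fun _ _ => by ring
  have expand : riemann g α β μ ν x = ∑ ρ, g x α ρ * pd μ (C ρ ν β) x -
      ∑ ρ, g x α ρ * pd ν (C ρ μ β) x + ∑ ρ, g x α ρ * ∑ κ, C ρ μ κ x * C κ ν β x -
      ∑ ρ, g x α ρ * ∑ κ, C ρ ν κ x * C κ μ β x := by
    rw [riemann, ← Finset.sum_sub_distrib, ← Finset.sum_add_distrib, ← Finset.sum_sub_distrib]
    refine Finset.sum_congr rfl fun ρ _ => ?_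
    rw [riemannUp, Finset.sum_sub_distrib]; ring
  rw [expand, leib, leib, quad, quad, low, low]
  simp only [met, add_mul, Finset.sum_add_distrib, Finset.sum_mul]
  rw [pd_comm (hg.contDiffAt hΩ hx α β) μ ν, symG μ α ν β, symG ν α μ β]
  ring

/-- The algebraic symmetries of a Weyl tensor. -/
structure IsWeylLike (Gi : Matrix (Fin 4) (Fin 4) ℝ) (T : Tensor4) : Prop where
  left : ∀ α β μ ν, T β α μ ν = -T α β μ ν
  right : ∀ α β μ ν, T α β ν μ = -T α β μ ν
  pair : ∀ α β μ ν, T μ ν α β = T α β μ ν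
  trace : ∀ β ν, ∑ α, ∑ μ, (Gi α μ : ℂ) * T α β μ ν = 0

/-- Visible in `riemann_eq` once partial derivatives commute, g is symmetric, and the quadratic
terms are recognized as values of the symmetric form g on Christoffel symbols (`symQ`). -/
lemma IsLorentzMetricOn.riemann_symm (hg : IsLorentzMetricOn Ω g) (hΩ : IsOpen Ω) (hx : x ∈ Ω)
    (α β μ ν : Fin 4) : riemann g β α μ ν x = -riemann g α β μ ν x ∧
      riemann g α β ν μ x = -riemann g α β μ ν x ∧ riemann g μ ν α β x = riemann g α β μ ν x := by
  have symG : ∀ a b c d, pd a (fun z => pd b (fun y => g y c d) z) x =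
      pd a (fun z => pd b (fun y => g y d c) z) x := by
    intro a b c d
    refine pd_congr ?_ a
    filter_upwards [hΩ.mem_nhds hx] with z hz using hg.pd_symm hΩ hz b c d
  have comm : ∀ a b c d, pd a (fun z => pd b (fun y => g y c d) z) x =
      pd b (fun z => pd a (fun y => g y c d) z) x := fun a b c d =>
    pd_comm (hg.contDiffAt hΩ hx c d) a b
  have symC : ∀ a b c, christoffel g a b c x = christoffel g a c b x := by
    intro a b c
    simp only [christoffel]
    congr 1
    refine Finset.sum_congr rfl fun σ _ => ?_
    rw [hg.pd_symm hΩ hx σ b c]; ring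
  have symQ : ∀ a b c d, ∑ ρ, ∑ σ, g x ρ σ * christoffel g σ a b x * christoffel g ρ c d x =
      ∑ ρ, ∑ σ, g x ρ σ * christoffel g σ c d x * christoffel g ρ a b x := by
    intro a b c d
    rw [Finset.sum_comm]
    refine Finset.sum_congr rfl fun ρ _ => Finset.sum_congr rfl fun σ _ => ?_
    rw [(hg.symm x hx).apply ρ σ]; ring
  simp only [hg.riemann_eq hΩ hx]
  refine ⟨?_, ?_, ?_⟩
  · rw [symQ μ β ν α, symQ ν β μ α]; ring
  · ring
  · simp only [symC _ α μ, symC _ β ν, symC _ β μ, symC _ α ν]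
    rw [symQ μ β ν α, comm α ν μ β, symG ν α μ β, comm α μ ν β, symG μ α ν β, comm β ν μ α,
      symG ν β μ α, comm β μ ν α, symG μ β ν α]
    ring

lemma IsLorentzMetricOn.inv_symm (hg : IsLorentzMetricOn Ω g) (hx : x ∈ Ω) (a b : Fin 4) :
    (g x)⁻¹ a b = (g x)⁻¹ b a := by
  have := (hg.symm x hx).eq
  conv_lhs => rw [← this, ← Matrix.transpose_nonsing_inv, Matrix.transpose_apply]

lemma IsLorentzMetricOn.sum_inv_riemann (hg : IsLorentzMetricOn Ω g) (hx : x ∈ Ω)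
    (β ν : Fin 4) : ∑ α, ∑ μ, (g x)⁻¹ α μ * riemann g α β μ ν x = ricci g β ν x := by
  have h1 : ∀ μ, ∑ α, (g x)⁻¹ α μ * riemann g α β μ ν x =
      ∑ ρ, ((g x)⁻¹ * g x) μ ρ * riemannUp g ρ β μ ν x := by
    intro μ
    simp only [riemann, Matrix.mul_apply, Finset.mul_sum, Finset.sum_mul]
    rw [Finset.sum_comm]
    refine Finset.sum_congr rfl fun _ _ => Finset.sum_congr rfl fun _ _ => ?_
    rw [hg.inv_symm hx μ]; ring
  rw [Finset.sum_comm]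
  simp only [h1, Matrix.nonsing_inv_mul _ (hg.isUnit_det hx), Matrix.one_apply]
  simp [ricci]

lemma IsLorentzMetricOn.ricci_symm (hg : IsLorentzMetricOn Ω g) (hΩ : IsOpen Ω) (hx : x ∈ Ω)
    (β ν : Fin 4) : ricci g ν β x = ricci g β ν x := by
  rw [← hg.sum_inv_riemann hx, ← hg.sum_inv_riemann hx, Finset.sum_comm]
  refine Finset.sum_congr rfl fun _ _ => Finset.sum_congr rfl fun _ _ => ?_
  rw [hg.inv_symm hx, (hg.riemann_symm hΩ hx _ _ _ _).2.2]

lemma IsLorentzMetricOn.isWeylLike (hg : IsLorentzMetricOn Ω g) (hΩ : IsOpen Ω) (hx : x ∈ Ω) :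
    IsWeylLike (g x)⁻¹ (fun α β μ ν => (weyl g α β μ ν x : ℂ)) := by
  have hR := hg.ricci_symm hΩ hx
  have hG : ∀ a b, g x a b = g x b a := fun a b => (hg.symm x hx).apply b a
  have hGi := hg.inv_symm hx
  refine ⟨fun α β μ ν => ?_, fun α β μ ν => ?_, fun α β μ ν => ?_, fun β ν => ?_⟩
  · rw [← Complex.ofReal_neg]
    congr 1
    rw [weyl, weyl, (hg.riemann_symm hΩ hx α β μ ν).1]; ring
  · rw [← Complex.ofReal_neg]
    congr 1
    rw [weyl, weyl, (hg.riemann_symm hΩ hx α β μ ν).2.1]; ring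
  · congr 1
    rw [weyl, weyl, (hg.riemann_symm hΩ hx α β μ ν).2.2, hR β ν, hR β μ, hR α ν, hR α μ,
      hG μ α, hG ν β, hG μ β, hG ν α]; ring
  · have one : ∀ a b, ∑ m, (g x)⁻¹ a m * g x m b = if a = b then 1 else 0 := by
      intro a b
      rw [← Matrix.one_apply, ← Matrix.nonsing_inv_mul _ (hg.isUnit_det hx), Matrix.mul_apply]
    -- Dimension four enters here. The Ricci coefficients add up to 1 - (4 - 1 - 1)/2 = 0, and those
    -- of the scalar curvature to -1/2 + (4 - 1)/6 = 0.
    have t1 : ∑ α, ∑ μ, (g x)⁻¹ α μ * g x α μ = 4 := by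
      have : ∀ α, ∑ μ, (g x)⁻¹ α μ * g x α μ = 1 := fun α => by
        have := one α α
        rw [if_pos rfl] at this
        rw [← this]
        exact Finset.sum_congr rfl fun m _ => by rw [hG]
      simp [this]
    have t2 : ∀ r : Fin 4 → ℝ, ∀ ν, ∑ α, ∑ μ, (g x)⁻¹ α μ * (g x α ν * r μ) = r ν := by
      intro r ν
      rw [Finset.sum_comm]
      have : ∀ μ, ∑ α, (g x)⁻¹ α μ * (g x α ν * r μ) = (if μ = ν then 1 else 0) * r μ := by
        intro μ
        rw [← one, Finset.sum_mul]
        exact Finset.sum_congr rfl fun m _ => by rw [hGi]; ring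
      simp [this]
    have t3 : ∀ r : Fin 4 → ℝ, ∀ β, ∑ α, ∑ μ, (g x)⁻¹ α μ * (g x β μ * r α) = r β := by
      intro r β
      rw [← t2 r β, Finset.sum_comm]
      refine Finset.sum_congr rfl fun _ _ => Finset.sum_congr rfl fun _ _ => ?_
      rw [hGi, hG]
    have e : ∑ α, ∑ μ, (g x)⁻¹ α μ * weyl g α β μ ν x = 0 := by
      have e1 : ∀ α μ, (g x)⁻¹ α μ * weyl g α β μ ν x =
          (g x)⁻¹ α μ * riemann g α β μ ν x
          - (1 / 2) * ((g x)⁻¹ α μ * g x α μ * ricci g β ν x)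
          + (1 / 2) * ((g x)⁻¹ α μ * (g x α ν * ricci g β μ x))
          + (1 / 2) * ((g x)⁻¹ α μ * (g x β μ * ricci g α ν x))
          - (1 / 2) * g x β ν * ((g x)⁻¹ α μ * ricci g α μ x)
          + (1 / 6) * scalarCurv g x * g x β ν * ((g x)⁻¹ α μ * g x α μ)
          - (1 / 6) * scalarCurv g x * ((g x)⁻¹ α μ * (g x α ν * g x β μ)) := by
        intro α μ; rw [weyl]; ring
      simp only [e1, Finset.sum_sub_distrib, Finset.sum_add_distrib, ← Finset.mul_sum]
      simp only [← Finset.sum_mul]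
      rw [hg.sum_inv_riemann hx, t1, t2 (fun μ => ricci g β μ x), t3 (fun α => ricci g α ν x),
        t2 (fun μ => g x β μ), ← scalarCurv]
      ring
    exact_mod_cast congrArg (fun r : ℝ => (r : ℂ)) e

end symmetries

end

section

/-! # The self-dual part of a Weyl tensor -/

lemma hodge_tensor (G : Matrix (Fin 4) (Fin 4) ℝ) (A B : Tensor2) (μ ν : Fin 4) :
    hodge G (Matrix.of fun ρ σ => tensor A B ρ σ μ ν) = B μ ν • hodge G A := by
  have h : (Matrix.of fun ρ σ => tensor A B ρ σ μ ν) = (0 : Tensor2) + B μ ν • A := by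
    ext; simp [tensor, mul_comm]
  have h0 : hodge G 0 = 0 := by
    ext; simp [hodge, raise_eq]
  rw [h, hodge_linear, h0, zero_add]

/-- The self-dual part `½ (T - i *T)` of a double bivector. -/
def selfDualPart (G : Matrix (Fin 4) (Fin 4) ℝ) : Tensor4 →ₗ[ℂ] Tensor4 where
  toFun T := fun α β μ ν => (1 / 2 : ℂ) * (T α β μ ν -
    Complex.I * hodge G (Matrix.of fun ρ σ => T ρ σ μ ν) α β)
  map_add' S T := by
    funext α β μ ν
    have h : (Matrix.of fun ρ σ => (S + T) ρ σ μ ν) = (Matrix.of fun ρ σ => S ρ σ μ ν) +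
        (1 : ℂ) • (Matrix.of fun ρ σ => T ρ σ μ ν) := by
      ext; simp
    rw [h, hodge_linear]
    simp only [Pi.add_apply, Matrix.add_apply, Matrix.smul_apply, smul_eq_mul]
    ring
  map_smul' c T := by
    funext α β μ ν
    have h : (Matrix.of fun ρ σ => (c • T) ρ σ μ ν) = (0 : Tensor2) +
        c • (Matrix.of fun ρ σ => T ρ σ μ ν) := by
      ext; simp
    have h0 : hodge G 0 = 0 := by
      ext; simp [hodge, raise_eq]
    rw [h, hodge_linear, h0]
    simp only [Pi.smul_apply, Matrix.add_apply, Matrix.smul_apply, smul_eq_mul, RingHom.id_apply,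
      Matrix.zero_apply]
    ring

lemma selfDualPart_apply (G : Matrix (Fin 4) (Fin 4) ℝ) (T : Tensor4) (α β μ ν : Fin 4) :
    selfDualPart G T α β μ ν = (1 / 2 : ℂ) * (T α β μ ν -
      Complex.I * hodge G (Matrix.of fun ρ σ => T ρ σ μ ν) α β) := rfl

lemma selfDualPart_tensor (G : Matrix (Fin 4) (Fin 4) ℝ) (A B : Tensor2) :
    selfDualPart G (tensor A B) = tensor ((1 / 2 : ℂ) • (A - Complex.I • hodge G A)) B := by
  funext α β μ ν
  rw [selfDualPart_apply, hodge_tensor]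
  simp only [tensor, Matrix.smul_apply, Matrix.sub_apply, smul_eq_mul]
  ring

lemma selfDualPart_pull4 {G θ : Matrix (Fin 4) (Fin 4) ℝ} (h : IsCoframe G θ) (T : Tensor4) :
    selfDualPart G (pull4 θ T) = pull4 θ (selfDualPart minkowski T) := by
  have : selfDualPart G ∘ₗ pull4 θ = pull4 θ ∘ₗ selfDualPart minkowski :=
    linear_ext_tensor fun A B => by
      simp only [LinearMap.comp_apply, pull4_tensor, selfDualPart_tensor, hodge_pull h, map_smul,
        map_sub]
  exact LinearMap.congr_fun this T

/-- Contraction of the first and third index. -/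
def contract (Gi : Matrix (Fin 4) (Fin 4) ℝ) : Tensor4 →ₗ[ℂ] Tensor2 where
  toFun T := Matrix.of fun β ν => ∑ α, ∑ μ, (Gi α μ : ℂ) * T α β μ ν
  map_add' S T := by
    ext; simp [mul_add, Finset.sum_add_distrib]
  map_smul' c T := by
    ext β ν
    simp only [Matrix.of_apply, Matrix.smul_apply, Pi.smul_apply, smul_eq_mul, RingHom.id_apply,
      Finset.mul_sum]
    exact Finset.sum_congr rfl fun _ _ => Finset.sum_congr rfl fun _ _ => by ring

lemma contract_tensor (Gi : Matrix (Fin 4) (Fin 4) ℝ) (A B : Tensor2) :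
    contract Gi (tensor A B) = A.transpose * toC Gi * B := by
  ext β ν
  change ∑ α, ∑ μ, (Gi α μ : ℂ) * (A α β * B μ ν) = _
  simp only [Matrix.mul_apply, Matrix.transpose_apply, toC_apply, Finset.sum_mul]
  rw [Finset.sum_comm]
  exact Finset.sum_congr rfl fun _ _ => Finset.sum_congr rfl fun _ _ => by ring

lemma contract_pull4 {G θ : Matrix (Fin 4) (Fin 4) ℝ} (h : IsCoframe G θ) (T : Tensor4) :
    contract minkowski (pull4 θ⁻¹ T) = pull θ⁻¹ (contract G⁻¹ T) := by
  have : contract minkowski ∘ₗ pull4 θ⁻¹ = pull θ⁻¹ ∘ₗ contract G⁻¹ :=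
    linear_ext_tensor fun A B => by
      simp only [LinearMap.comp_apply, pull4_tensor, contract_tensor, pull_apply,
        toC_metric_inv h, Matrix.transpose_mul, Matrix.transpose_transpose, Matrix.mul_assoc]
  exact LinearMap.congr_fun this T

lemma sum_comm_pairs {ι M : Type*} [Fintype ι] [AddCommMonoid M] (F : ι → ι → ι → ι → M) :
    ∑ a, ∑ b, ∑ c, ∑ d, F a b c d = ∑ c, ∑ d, ∑ a, ∑ b, F a b c d := by
  calc _ = ∑ a, ∑ c, ∑ b, ∑ d, F a b c d := Finset.sum_congr rfl fun _ _ => Finset.sum_comm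
    _ = ∑ c, ∑ a, ∑ d, ∑ b, F a b c d := by
        rw [Finset.sum_comm]
        exact Finset.sum_congr rfl fun _ _ => Finset.sum_congr rfl fun _ _ => Finset.sum_comm
    _ = _ := Finset.sum_congr rfl fun _ _ => Finset.sum_comm

lemma hodge_antisymm (G : Matrix (Fin 4) (Fin 4) ℝ) (X : Tensor2) (a b : Fin 4) :
    hodge G X b a = -hodge G X a b := by
  simp only [hodge, vol, leviCivita_swap_left a b, Matrix.of_apply]
  simp

lemma IsWeylLike.pull4 {G θ : Matrix (Fin 4) (Fin 4) ℝ} (h : IsCoframe G θ) {T : Tensor4}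
    (hT : IsWeylLike G⁻¹ T) : IsWeylLike minkowski (pull4 θ⁻¹ T) := by
  refine ⟨fun α β μ ν => ?_, fun α β μ ν => ?_, fun α β μ ν => ?_, fun β ν => ?_⟩
  · rw [pull4_apply, pull4_apply, Finset.sum_comm]
    simp only [← Finset.sum_neg_distrib]
    refine Finset.sum_congr rfl fun a _ => Finset.sum_congr rfl fun b _ =>
      Finset.sum_congr rfl fun c _ => Finset.sum_congr rfl fun d _ => ?_
    rw [hT.left]; ring
  · rw [pull4_apply, pull4_apply]
    simp only [← Finset.sum_neg_distrib]
    refine Finset.sum_congr rfl fun a _ => Finset.sum_congr rfl fun b _ => ?_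
    rw [Finset.sum_comm]
    refine Finset.sum_congr rfl fun c _ => Finset.sum_congr rfl fun d _ => ?_
    rw [hT.right]; ring
  · rw [pull4_apply, pull4_apply]
    rw [sum_comm_pairs]
    refine Finset.sum_congr rfl fun a _ => Finset.sum_congr rfl fun b _ =>
      Finset.sum_congr rfl fun c _ => Finset.sum_congr rfl fun d _ => ?_
    rw [hT.pair]; ring
  · have h0 : contract G⁻¹ T = 0 := by
      ext β ν; exact hT.trace β ν
    have h1 := contract_pull4 h T
    rw [h0, map_zero] at h1
    exact congrFun (congrFun h1 β) ν

/-- The traces make the magnetic block symmetric (`q12`, `q13`, `q23`) and the block on spatial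
pairs minus the electric one (`k11` to `k33`). So the left and right duals agree, and the left
self-dual part is self-dual in both pairs. The matrix is w = E - iB in its electric and magnetic
parts. The cyclic identity would add only tr B = 0, which nilpotency supplies later. -/
lemma IsWeylLike.selfDualPart_minkowski {T : Tensor4} (h : IsWeylLike minkowski T) :
    ∃ w : Matrix (Fin 3) (Fin 3) ℂ, w.transpose = w ∧
      selfDualPart minkowski T = (1 / 2 : ℂ) • ∑ A, ∑ B, w A B • tensor (sd A) (sd B) := by
  have dl : ∀ a c d, T a a c d = 0 := fun a c d => by
    linear_combination (1 / 2 : ℂ) * h.left a a c d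
  have dr : ∀ a c d, T c d a a = 0 := fun a c d => by
    linear_combination (1 / 2 : ℂ) * h.right c d a a
  have l10 : ∀ c d, T 1 0 c d = -T 0 1 c d := h.left 0 1
  have r10 : ∀ c d, T c d 1 0 = -T c d 0 1 := fun c d => h.right c d 0 1
  have l20 : ∀ c d, T 2 0 c d = -T 0 2 c d := h.left 0 2
  have r20 : ∀ c d, T c d 2 0 = -T c d 0 2 := fun c d => h.right c d 0 2
  have l30 : ∀ c d, T 3 0 c d = -T 0 3 c d := h.left 0 3
  have r30 : ∀ c d, T c d 3 0 = -T c d 0 3 := fun c d => h.right c d 0 3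
  have l32 : ∀ c d, T 3 2 c d = -T 2 3 c d := h.left 2 3
  have r32 : ∀ c d, T c d 3 2 = -T c d 2 3 := fun c d => h.right c d 2 3
  have l13 : ∀ c d, T 1 3 c d = -T 3 1 c d := h.left 3 1
  have r13 : ∀ c d, T c d 1 3 = -T c d 3 1 := fun c d => h.right c d 3 1
  have l21 : ∀ c d, T 2 1 c d = -T 1 2 c d := h.left 1 2
  have r21 : ∀ c d, T c d 2 1 = -T c d 1 2 := fun c d => h.right c d 1 2
  have p0201 : T 0 2 0 1 = T 0 1 0 2 := h.pair 0 1 0 2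
  have p0301 : T 0 3 0 1 = T 0 1 0 3 := h.pair 0 1 0 3
  have p0302 : T 0 3 0 2 = T 0 2 0 3 := h.pair 0 2 0 3
  have p2301 : T 2 3 0 1 = T 0 1 2 3 := h.pair 0 1 2 3
  have p2302 : T 2 3 0 2 = T 0 2 2 3 := h.pair 0 2 2 3
  have p2303 : T 2 3 0 3 = T 0 3 2 3 := h.pair 0 3 2 3
  have p3101 : T 3 1 0 1 = T 0 1 3 1 := h.pair 0 1 3 1
  have p3102 : T 3 1 0 2 = T 0 2 3 1 := h.pair 0 2 3 1
  have p3103 : T 3 1 0 3 = T 0 3 3 1 := h.pair 0 3 3 1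
  have p3123 : T 3 1 2 3 = T 2 3 3 1 := h.pair 2 3 3 1
  have p1201 : T 1 2 0 1 = T 0 1 1 2 := h.pair 0 1 1 2
  have p1202 : T 1 2 0 2 = T 0 2 1 2 := h.pair 0 2 1 2
  have p1203 : T 1 2 0 3 = T 0 3 1 2 := h.pair 0 3 1 2
  have p1223 : T 1 2 2 3 = T 2 3 1 2 := h.pair 2 3 1 2
  have p1231 : T 1 2 3 1 = T 3 1 1 2 := h.pair 3 1 1 2
  have tr : ∀ b d, -T 0 b 0 d + T 1 b 1 d + T 2 b 2 d + T 3 b 3 d = 0 := by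
    intro b d
    have := h.trace b d
    simp only [minkowski_apply, Fin.sum_univ_four] at this
    simpa using this
  have t00 := tr 0 0
  have t01 := tr 0 1
  have t02 := tr 0 2
  have t03 := tr 0 3
  have t11 := tr 1 1
  have t22 := tr 2 2
  have t33 := tr 3 3
  have t12 := tr 1 2
  have t13 := tr 1 3
  have t23 := tr 2 3
  simp only [dl, dr, l10, r10, l20, r20, l30, r30, l32, r32, l13, r13, l21, r21, p3123, p1223, p1231] at t00 t01 t02 t03 t11 t22 t33 t12 t13 t23
  have q23 : T 0 3 3 1 = T 0 2 1 2 := by linear_combination -t01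
  have q13 : T 0 3 2 3 = T 0 1 1 2 := by linear_combination t02
  have q12 : T 0 2 2 3 = T 0 1 3 1 := by linear_combination -t03
  have k12 : T 2 3 3 1 = -T 0 1 0 2 := by linear_combination -t12
  have k13 : T 2 3 1 2 = -T 0 1 0 3 := by linear_combination -t13
  have k23 : T 3 1 1 2 = -T 0 2 0 3 := by linear_combination -t23
  have k11 : T 2 3 2 3 = -T 0 1 0 1 := by linear_combination (t22 + t33 - t11 + t00) / 2
  have k22 : T 3 1 3 1 = -T 0 2 0 2 := by linear_combination (t11 + t33 - t22 + t00) / 2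
  have k33 : T 1 2 1 2 = -T 0 3 0 3 := by linear_combination (t11 + t22 - t33 + t00) / 2
  set w : Matrix (Fin 3) (Fin 3) ℂ :=
    !![T 0 1 0 1 - Complex.I * T 0 1 2 3, T 0 1 0 2 - Complex.I * T 0 1 3 1,
        T 0 1 0 3 - Complex.I * T 0 1 1 2;
      T 0 1 0 2 - Complex.I * T 0 1 3 1, T 0 2 0 2 - Complex.I * T 0 2 3 1,
        T 0 2 0 3 - Complex.I * T 0 2 1 2;
      T 0 1 0 3 - Complex.I * T 0 1 1 2, T 0 2 0 3 - Complex.I * T 0 2 1 2,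
        T 0 3 0 3 - Complex.I * T 0 3 1 2] with hw
  refine ⟨w, by ext i j; fin_cases i <;> fin_cases j <;> rfl, ?_⟩
  have e : ∀ a b c d, ((1 / 2 : ℂ) • ∑ A, ∑ B, w A B • tensor (sd A) (sd B) : Tensor4) a b c d =
      (1 / 2 : ℂ) * ∑ A, ∑ B, w A B * (sd A a b * sd B c d) := by
    intro a b c d
    simp [tensor]
  have hI := Complex.I_sq
  funext α β μ ν
  rw [e]
  simp only [selfDualPart_apply, Fin.sum_univ_three]
  have hr : ∀ a b ρ σ, hodge minkowski (Matrix.of fun ρ σ => T ρ σ b a) ρ σ =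
      -hodge minkowski (Matrix.of fun ρ σ => T ρ σ a b) ρ σ := by
    intro a b ρ σ
    simp only [hodge_minkowski, Matrix.of_apply, h.right _ _ a b]
    fin_cases ρ <;> fin_cases σ <;> simp <;> ring
  revert α β
  refine ext_of_antisymm ?_ ?_ ?_ ?_ ?_ ?_ ?_ ?_
  · intro a b; rw [h.left a b, hodge_antisymm _ _ a b]; ring
  · intro a b; simp only [fun A => sd_antisymm A a b]; ring
  all_goals
    revert μ ν
    refine ext_of_antisymm ?_ ?_ ?_ ?_ ?_ ?_ ?_ ?_
    · intro a b; rw [h.right _ _ a b, hr a b]; ring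
    · intro a b; simp only [fun A => sd_antisymm A a b]; ring
  all_goals
    rw [hodge_minkowski]
    simp [sd, hw]
    simp only [q12, q13, q23, k11, k12, k13, k22, k23, k33, l10, l20, l30, l32, l13, l21, p0201,
      p0301, p0302, p2301, p2302, p2303, p3101, p3102, p3103, p3123, p1201, p1202, p1203, p1223,
      p1231]
    ring_nf
    try (simp only [hI]; ring_nf)

end

section

/-! # Nilpotent symmetric matrices of order three -/

/-- The product `n nᵀ`. -/
abbrev outer (u v : Fin 3 → ℂ) : Matrix (Fin 3) (Fin 3) ℂ := Matrix.vecMulVec u v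

lemma exists_sq_eq (z : ℂ) : ∃ r, z = r ^ 2 := by
  obtain ⟨r, hr⟩ := IsAlgClosed.exists_pow_nat_eq z (n := 2) (by norm_num)
  exact ⟨r, hr.symm⟩

/-- A zero adjugate means that all 2×2 minors vanish, so the rank is at most one. A row through a
nonzero diagonal entry, divided by a root of that entry, is the vector n. -/
lemma exists_outer_of_adjugate {M : Matrix (Fin 3) (Fin 3) ℂ} (hs : M.transpose = M)
    (ha : M.adjugate = 0) : ∃ n : Fin 3 → ℂ, M = outer n n := by
  have sym : ∀ i j, M j i = M i j := fun i j => congrFun (congrFun hs i) j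
  have h : ∀ i j, M.adjugate i j = 0 := fun i j => by rw [ha]; rfl
  have h00 := h 0 0
  have h01 := h 0 1
  have h02 := h 0 2
  have h11 := h 1 1
  have h12 := h 1 2
  have h22 := h 2 2
  simp [Matrix.adjugate_fin_three, sym 0 1, sym 0 2, sym 1 2] at h00 h01 h02 h11 h12 h22
  have minor : ∀ i j k, M i i * M j k = M i j * M i k := by
    intro i j k
    fin_cases i <;> fin_cases j <;> fin_cases k <;>
      simp only [Fin.zero_eta, Fin.mk_one, Fin.reduceFinMk, sym 0 1, sym 0 2, sym 1 2] <;>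
      first
      | ring1
      | linear_combination h00
      | linear_combination -h00
      | linear_combination h01
      | linear_combination -h01
      | linear_combination h02
      | linear_combination -h02
      | linear_combination h11
      | linear_combination -h11
      | linear_combination h12
      | linear_combination -h12
      | linear_combination h22
  by_cases hd : ∃ i, M i i ≠ 0
  · obtain ⟨i, hi⟩ := hd
    obtain ⟨r, hr⟩ := exists_sq_eq (M i i)
    have hr0 : r ≠ 0 := by rintro rfl; exact hi (by rw [hr]; ring)
    refine ⟨fun j => M i j / r, ?_⟩
    ext j k
    have := minor i j k
    change _ = M i j / r * (M i k / r)
    rw [div_mul_div_comm, ← this, hr]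
    field_simp
  -- With zero diagonal the minors give M_jk² = M_jj M_kk = 0, so M = 0.
  · push Not at hd
    refine ⟨0, ?_⟩
    ext j k
    have h1 := minor j k k
    rw [hd j, zero_mul] at h1
    simpa using h1.symm

/-- Nilpotency kills the traces of w and w², so the polynomial formula for the adjugate reduces to
adj w = w². Then adj(w²) = w⁴ = 0, so w² has rank at most one, and n·n is its trace. -/
lemma exists_outer_sq {w : Matrix (Fin 3) (Fin 3) ℂ} (hs : w.transpose = w)
    (h3 : w * (w * w) = 0) : w.trace = 0 ∧ ∃ n : Fin 3 → ℂ, w * w = outer n n ∧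
      n 0 ^ 2 + n 1 ^ 2 + n 2 ^ 2 = 0 := by
  have hn : IsNilpotent w := ⟨3, by rw [pow_three, h3]⟩
  have ht : w.trace = 0 := (Matrix.isNilpotent_trace_of_isNilpotent hn).eq_zero
  have hn2 : IsNilpotent (w * w) := ⟨2, by
    rw [pow_two, Matrix.mul_assoc, h3, Matrix.mul_zero]⟩
  have ht2 : (w * w).trace = 0 := (Matrix.isNilpotent_trace_of_isNilpotent hn2).eq_zero
  have hadj : w.adjugate = w * w := by
    have : w.adjugate = w * w - w.trace • w + ((w.trace ^ 2 - (w * w).trace) / 2) • 1 := by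
      ext i j
      fin_cases i <;> fin_cases j <;>
        simp [Matrix.adjugate_fin_three, Matrix.mul_apply, Matrix.trace, Fin.sum_univ_three] <;>
        ring
    rw [this, ht, ht2]; simp
  have ha : (w * w).adjugate = 0 := by
    rw [Matrix.adjugate_mul_distrib, hadj, Matrix.mul_assoc, h3, Matrix.mul_zero]
  obtain ⟨n, hn⟩ := exists_outer_of_adjugate (by rw [Matrix.transpose_mul, hs]) ha
  refine ⟨ht, n, hn, ?_⟩
  rw [hn] at ht2
  simp [Matrix.trace, Fin.sum_univ_three, Matrix.vecMulVec_apply] at ht2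
  linear_combination ht2

/-! ## Spin frames -/

/-- The components of `𝓛₊` in terms of the first spinor `(a, b)` of a spin frame. -/
def spinP (a b : ℂ) : Fin 3 → ℂ := ![a * b, (a ^ 2 - b ^ 2) / 2, Complex.I * (a ^ 2 + b ^ 2) / 2]

/-- The components of `√2 𝓤₁` in terms of a spin frame `(a, b)`, `(c, d)`. -/
def spinU (a b c d : ℂ) : Fin 3 → ℂ :=
  ![a * d + b * c, a * c - b * d, Complex.I * (a * c + b * d)]

/-- The components of `𝓛₋` in terms of the second spinor `(c, d)` of a spin frame. -/
def spinM (c d : ℂ) : Fin 3 → ℂ :=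
  ![-(c * d), (d ^ 2 - c ^ 2) / 2, -(Complex.I * (c ^ 2 + d ^ 2) / 2)]

/-- Null vectors of ℂ³ are squares of spinors. The roots a² = p₁ - ip₂ and b² = -(p₁ + ip₂) give
(ab)² = p₀², and the sign of b is free to make ab = p₀. -/
lemma exists_spinP {p : Fin 3 → ℂ} (hp : p 0 ^ 2 + p 1 ^ 2 + p 2 ^ 2 = 0) :
    ∃ a b, p = spinP a b := by
  have hI := Complex.I_sq
  obtain ⟨a, ha⟩ := exists_sq_eq (p 1 - Complex.I * p 2)
  obtain ⟨b, hb⟩ := exists_sq_eq (-(p 1 + Complex.I * p 2))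
  have hab : (a * b) ^ 2 = p 0 ^ 2 := by
    rw [mul_pow, ← ha, ← hb]
    linear_combination -hp + p 2 ^ 2 * hI
  have e1 : p 1 = (a ^ 2 - b ^ 2) / 2 := by rw [← ha, ← hb]; ring
  have e2 : p 2 = Complex.I * (a ^ 2 + b ^ 2) / 2 := by
    rw [← ha, ← hb]; linear_combination p 2 * hI
  rcases sq_eq_sq_iff_eq_or_eq_neg.1 hab with h | h
  · refine ⟨a, b, ?_⟩
    ext i; fin_cases i
    · exact h.symm
    · exact e1
    · exact e2
  · refine ⟨a, -b, ?_⟩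
    ext i; fin_cases i
    · change p 0 = a * -b
      linear_combination h
    · change p 1 = (a ^ 2 - (-b) ^ 2) / 2
      rw [e1]; ring
    · change p 2 = Complex.I * (a ^ 2 + (-b) ^ 2) / 2
      rw [e2]; ring

/-- Completeness of the basis u, p, q of ℂ³ with u·u = 1, p·q = 1/2 and the other products zero. It
gives the expansion of w below. -/
lemma spin_identity {a b c d : ℂ} (hD : a * d - b * c = 1) :
    (1 : Matrix (Fin 3) (Fin 3) ℂ) = outer (spinU a b c d) (spinU a b c d) +
      (2 : ℂ) • outer (spinP a b) (spinM c d) + (2 : ℂ) • outer (spinM c d) (spinP a b) := by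
  have hD2 : (a * d - b * c) ^ 2 = 1 := by rw [hD, one_pow]
  have hI := Complex.I_sq
  ext i j
  fin_cases i <;> fin_cases j <;>
    simp [spinU, spinP, spinM]
  all_goals
    ring_nf
    try simp only [hI]
    try ring_nf
    try linear_combination -hD2

end

/-! ### Canonical form of a nilpotent symmetric matrix. -/

section

/-- The canonical form of a nilpotent symmetric matrix of maximal order in a spin frame. -/
theorem exists_spin_canonical {w : Matrix (Fin 3) (Fin 3) ℂ} (hs : w.transpose = w)
    (h3 : w * (w * w) = 0) (h2 : w * w ≠ 0) : ∃ a b c d, a * d - b * c = 1 ∧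
      w = (2 * rt) • (outer (spinU a b c d) (spinP a b) + outer (spinP a b) (spinU a b c d)) := by
  obtain ⟨ht, n, hM, hn⟩ := exists_outer_sq hs h3
  have hI := Complex.I_sq
  have sym : ∀ i j, w j i = w i j := fun i j => congrFun (congrFun hs i) j
  -- The factor `rt` makes w² = 2ppᵀ, the square of the target 2·rt(upᵀ + puᵀ).
  obtain ⟨a, b, hab⟩ := exists_spinP (p := fun i => rt * n i) (by
    linear_combination rt ^ 2 * hn)
  have hM2 : ∀ i j, ∑ k, w i k * w k j = 2 * (spinP a b i * spinP a b j) := by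
    intro i j
    rw [← Matrix.mul_apply, hM, ← hab]
    change n i * n j = _
    linear_combination (-2 * n i * n j) * rt_sq
  have hp0 : ∃ k, spinP a b k ≠ 0 := by
    by_contra h
    push Not at h
    apply h2
    ext i j
    rw [Matrix.mul_apply, hM2, h i]; simp
  obtain ⟨k, hk⟩ := hp0
  -- Any completion will do; it is corrected at the end by adding a multiple of (a, b).
  obtain ⟨c, d, hD⟩ : ∃ c d, a * d - b * c = 1 := by
    by_cases ha : a = 0
    · by_cases hb : b = 0
      · exact absurd (by fin_cases k <;> simp [spinP, ha, hb]) hk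
      · exact ⟨-b⁻¹, 0, by field_simp; ring⟩
    · exact ⟨0, a⁻¹, by field_simp; ring⟩
  set p := spinP a b with hp
  set u := spinU a b c d with hu
  set q := spinM c d with hq
  have pp : p 0 * p 0 + p 1 * p 1 + p 2 * p 2 = 0 := by
    simp [hp, spinP]; linear_combination ((a ^ 2 + b ^ 2) ^ 2 / 4) * hI
  have up : u 0 * p 0 + u 1 * p 1 + u 2 * p 2 = 0 := by
    simp [hp, hu, spinP, spinU]
    linear_combination ((a * c + b * d) * (a ^ 2 + b ^ 2) / 2) * hI
  have uu : u 0 * u 0 + u 1 * u 1 + u 2 * u 2 = 1 := by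
    simp [hu, spinU]
    linear_combination ((a * c + b * d) ^ 2) * hI + (a * d - b * c + 1) * hD
  have expand : ∀ v : Fin 3 → ℂ, ∀ i, v i = (∑ j, u j * v j) * u i + 2 * (∑ j, q j * v j) * p i +
      2 * (∑ j, p j * v j) * q i := by
    intro v i
    have h := congrFun (congrArg (fun M => Matrix.mulVec M v) (spin_identity hD)) i
    simp only [Matrix.one_mulVec] at h
    rw [h]
    simp only [Matrix.mulVec, dotProduct, Matrix.add_apply, Matrix.smul_apply,
      Matrix.vecMulVec_apply, smul_eq_mul, Fin.sum_univ_three]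
    ring
  -- A nonzero column of w² is proportional to p, so w³ = 0 says wp = 0.
  have wp : ∀ i, ∑ j, p j * w j i = 0 := by
    intro i
    have h := congrFun (congrFun h3 i) k
    rw [Matrix.mul_apply] at h
    have e : ∀ j, (w * w) j k = 2 * (p j * p k) := fun j => by rw [Matrix.mul_apply, hM2]
    simp only [e] at h
    have h' : (2 * p k) * ∑ j, p j * w j i = 0 := by
      rw [← Matrix.zero_apply (α := ℂ) i k, ← h, Finset.mul_sum]
      exact Finset.sum_congr rfl fun j _ => by rw [sym i j]; ring
    exact (mul_eq_zero.1 h').resolve_left (mul_ne_zero two_ne_zero hk)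
  set U : Fin 3 → ℂ := fun i => ∑ j, u j * w j i with hU
  set Q : Fin 3 → ℂ := fun i => ∑ j, q j * w j i with hQ
  have w1 : ∀ i j, w i j = U j * u i + 2 * Q j * p i := by
    intro i j
    have := expand (fun i => w i j) i
    rw [wp j] at this
    rw [this]; ring
  have contr : ∀ v z : Fin 3 → ℂ, ∑ j, v j * ∑ l, z l * w l j = ∑ j, z j * ∑ l, v l * w l j := by
    intro v z
    simp only [Finset.mul_sum]
    rw [Finset.sum_comm]
    exact Finset.sum_congr rfl fun _ _ => Finset.sum_congr rfl fun _ _ => by rw [sym]; ring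
  have pv : ∀ v : Fin 3 → ℂ, ∑ j, p j * ∑ l, v l * w l j = 0 := by
    intro v
    rw [contr]; simp [wp]
  set A := ∑ j, u j * U j with hA
  set B := ∑ j, q j * U j with hB
  set C := ∑ j, q j * Q j with hC
  have hBQ : ∑ j, u j * Q j = B := contr u q
  have hUe : ∀ j, U j = A * u j + 2 * B * p j := by
    intro j
    have := expand U j
    rw [pv u] at this
    rw [this]; ring
  have hQe : ∀ j, Q j = B * u j + 2 * C * p j := by
    intro j
    have := expand Q j
    rw [pv q, hBQ] at this
    rw [this]; ring
  -- Since u·u = 1 and u·p = p·p = 0, the trace of w is A.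
  have hA0 : A = 0 := by
    rw [Matrix.trace, Fin.sum_univ_three] at ht
    simp only [Matrix.diag_apply, w1, hUe, hQe] at ht
    linear_combination ht - A * uu - 4 * B * up - 4 * C * pp
  have hw : ∀ i j, w i j = 2 * B * (u i * p j + p i * u j) + 4 * C * (p i * p j) := by
    intro i j
    rw [w1, hUe, hQe, hA0]; ring
  have hB2 : (2 * B) ^ 2 = (2 * rt) ^ 2 := by
    have h := hM2 k k
    simp only [hw, Fin.sum_univ_three] at h
    have h' : p k * p k * ((2 * B) ^ 2 - (2 * rt) ^ 2) = 0 := by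
      linear_combination h - 4 * p k * p k * rt_sq - 4 * B ^ 2 * p k * p k * uu -
        4 * B ^ 2 * u k * u k * pp - 8 * B ^ 2 * u k * p k * up - 16 * B * C * p k * p k * up -
        16 * B * C * u k * p k * pp - 16 * C ^ 2 * p k * p k * pp
    exact sub_eq_zero.1 ((mul_eq_zero.1 h').resolve_left (mul_ne_zero hk hk))
  have hr0 := rt_ne_zero
  -- The null rotation (c, d) ↦ (c, d) + z(a, b) fixes p and sends u to u + 2zp. This value of z
  -- absorbs the ppᵀ term.
  set z := 4 * C / (8 * rt) with hz
  have hz' : 8 * rt * z = 4 * C := by rw [hz]; field_simp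
  rcases sq_eq_sq_iff_eq_or_eq_neg.1 hB2 with h | h
  · refine ⟨a, b, c + z * a, d + z * b, by linear_combination hD, ?_⟩
    have hu' : ∀ i, spinU a b (c + z * a) (d + z * b) i = u i + 2 * z * p i := by
      intro i
      fin_cases i <;> simp [hu, hp, spinU, spinP] <;> ring
    ext i j
    simp only [Matrix.smul_apply, Matrix.add_apply, Matrix.vecMulVec_apply, smul_eq_mul, hu']
    rw [hw, h, ← hp]
    linear_combination (-(p i * p j)) * hz'
  -- For the other sign of B, the unimodular rescaling of the two spinors by i and -i keeps u and
  -- reverses p.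
  · refine ⟨Complex.I * a, Complex.I * b, -Complex.I * c + z * (Complex.I * a),
      -Complex.I * d + z * (Complex.I * b),
      by linear_combination hD - (a * d - b * c) * hI, ?_⟩
    have hp' : ∀ i, spinP (Complex.I * a) (Complex.I * b) i = -p i := by
      intro i
      fin_cases i <;> simp [hp, spinP]
      · linear_combination (a * b) * hI
      · linear_combination ((a ^ 2 - b ^ 2) / 2) * hI
      · linear_combination (Complex.I * (a ^ 2 + b ^ 2) / 2) * hI
    have hu' : ∀ i, spinU (Complex.I * a) (Complex.I * b) (-Complex.I * c + z * (Complex.I * a))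
        (-Complex.I * d + z * (Complex.I * b)) i = u i - 2 * z * p i := by
      intro i
      fin_cases i <;> simp [hu, hp, spinU, spinP]
      · linear_combination (-(a * d + b * c) + 2 * z * a * b) * hI
      · linear_combination (-(a * c - b * d) + z * (a ^ 2 - b ^ 2)) * hI
      · linear_combination (Complex.I * (-(a * c + b * d) + z * (a ^ 2 + b ^ 2))) * hI
    ext i j
    simp only [Matrix.smul_apply, Matrix.add_apply, Matrix.vecMulVec_apply, smul_eq_mul, hu', hp']
    rw [hw, h]
    linear_combination (-(p i * p j)) * hz'

/-! ## Lorentz transformations of spin frames -/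

/-- The null coframe `(l, m, m̄, k)` in terms of an orthonormal coframe. -/
def nullM : Matrix (Fin 4) (Fin 4) ℂ :=
  !![1, -1, 0, 0; 0, 0, 1, Complex.I; 0, 0, 1, -Complex.I; 1, 1, 0, 0]

/-- The inverse of `nullM`. -/
def nullInv : Matrix (Fin 4) (Fin 4) ℂ := (1 / 2 : ℂ) •
  !![1, 0, 0, 1; -1, 0, 0, 1; 0, 1, 1, 0; 0, -Complex.I, Complex.I, 0]

/-- The action of a spin frame `(a, b)`, `(c, d)` on null coframes. -/
def spinK (a b c d : ℂ) : Matrix (Fin 4) (Fin 4) ℂ :=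
  !![a * conj a, a * conj b, b * conj a, b * conj b;
    a * conj c, a * conj d, b * conj c, b * conj d;
    c * conj a, c * conj b, d * conj a, d * conj b;
    c * conj c, c * conj d, d * conj c, d * conj d]

lemma nullM_mul_nullInv : nullM * nullInv = 1 := by
  have hI := Complex.I_mul_I
  ext i j
  fin_cases i <;> fin_cases j <;>
    simp [nullM, nullInv, Matrix.mul_apply, Fin.sum_univ_four] <;>
    first
    | linear_combination (1 / 2 : ℂ) * hI
    | linear_combination (-1 / 2 : ℂ) * hI
    | norm_num

/-- The Lorentz transformation of a spin frame. -/
def spinL (a b c d : ℂ) : Matrix (Fin 4) (Fin 4) ℝ :=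
  (nullInv * spinK a b c d * nullM).map Complex.re

/-- `spinK` is the Kronecker product of the spin matrix with its conjugate. Conjugation swaps the
factors just as it swaps m and m̄, so the product is real and `re` loses nothing. -/
lemma toC_spinL (a b c d : ℂ) : toC (spinL a b c d) = nullInv * spinK a b c d * nullM := by
  ext i j
  rw [toC_apply, spinL, Matrix.map_apply, ← Complex.conj_eq_iff_re]
  fin_cases i <;> fin_cases j <;>
    simp [nullM, nullInv, spinK, Matrix.mul_apply, Fin.sum_univ_four,
      map_ofNat] <;>
    ring

/-- The metric in a null coframe. -/
def nullJ : Matrix (Fin 4) (Fin 4) ℂ := (1 / 2 : ℂ) •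
  !![0, 0, 0, -1; 0, 0, 1, 0; 0, 1, 0, 0; -1, 0, 0, 0]

lemma toC_minkowski_eq_null : toC minkowski = nullM.transpose * nullJ * nullM := by
  have hI := Complex.I_mul_I
  rw [toC_minkowski]
  ext i j
  fin_cases i <;> fin_cases j <;>
    simp [nullM, nullJ, Matrix.mul_apply, Fin.sum_univ_four] <;>
    first
    | linear_combination hI
    | norm_num

/-- `nullJ` is -1/2 times the Kronecker square of the symplectic form of ℂ². The two factors of
`spinK` scale it by ad - bc and by its conjugate, both 1. -/
lemma spinK_metric {a b c d : ℂ} (hD : a * d - b * c = 1) :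
    (spinK a b c d).transpose * nullJ * spinK a b c d = nullJ := by
  have hD' : conj a * conj d - conj b * conj c = 1 := by
    rw [← map_mul, ← map_mul, ← map_sub, hD, map_one]
  have h1 : (a * d - b * c) * (conj a * conj d - conj b * conj c) = 1 := by rw [hD, hD', one_mul]
  ext i j
  fin_cases i <;> fin_cases j <;>
    simp [spinK, nullJ, Matrix.mul_apply, Fin.sum_univ_four] <;>
    first
    | ring1
    | linear_combination (1 / 2 : ℂ) * h1
    | linear_combination (-1 / 2 : ℂ) * h1

lemma spinK_det {a b c d : ℂ} (hD : a * d - b * c = 1) : (spinK a b c d).det = 1 := by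
  have hD' : conj a * conj d - conj b * conj c = 1 := by
    rw [← map_mul, ← map_mul, ← map_sub, hD, map_one]
  have : (spinK a b c d).det =
      (a * d - b * c) ^ 2 * (conj a * conj d - conj b * conj c) ^ 2 := by
    simp [spinK, Matrix.det_succ_row_zero, Fin.sum_univ_succ, Fin.succAbove]
    ring
  rw [this, hD, hD']; norm_num

end

/-! ### Spin transformations as oriented Lorentz transformations of self-dual bivectors. -/

section

lemma nullInv_mul_nullM : nullInv * nullM = 1 := mul_eq_one_comm.1 nullM_mul_nullInv

lemma toC_injective {A B : Matrix (Fin 4) (Fin 4) ℝ} (h : toC A = toC B) : A = B := by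
  ext i j
  exact Complex.ofReal_injective (congrFun (congrFun h i) j)

lemma spinL_isCoframe {a b c d : ℂ} (hD : a * d - b * c = 1) :
    IsCoframe minkowski (spinL a b c d) := by
  have h1 := nullM_mul_nullInv
  have h2 : nullInv.transpose * nullM.transpose = 1 := by
    rw [← Matrix.transpose_mul, h1, Matrix.transpose_one]
  constructor
  · apply toC_injective
    rw [toC_mul, toC_mul, toC_transpose, toC_spinL, toC_minkowski_eq_null]
    simp only [Matrix.transpose_mul]
    calc _ = nullM.transpose * ((spinK a b c d).transpose *
          ((nullInv.transpose * nullM.transpose) * nullJ * (nullM * nullInv)) *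
            spinK a b c d) * nullM := by simp only [Matrix.mul_assoc]
      _ = _ := by rw [h1, h2, Matrix.one_mul, Matrix.mul_one, spinK_metric hD]
  · have h3 : ((spinL a b c d).det : ℂ) = 1 := by
      have : ((spinL a b c d).det : ℂ) = (toC (spinL a b c d)).det :=
        RingHom.map_det Complex.ofRealHom _
      rw [this, toC_spinL, Matrix.det_mul, Matrix.det_mul, spinK_det hD, mul_one, ← Matrix.det_mul,
        nullInv_mul_nullM, Matrix.det_one]
    have h4 : (spinL a b c d).det = 1 := by exact_mod_cast h3
    rw [h4]; exact one_pos

/-- The components of `sd A` in a null coframe. -/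
def nullSd (A : Fin 3) : Tensor2 := (1 / 2 : ℂ) •
  ![!![0, 0, 0, -1; 0, 0, 1, 0; 0, -1, 0, 0; 1, 0, 0, 0],
    !![0, -1, 0, 0; 1, 0, 0, 0; 0, 0, 0, 1; 0, 0, -1, 0],
    !![0, Complex.I, 0, 0; -Complex.I, 0, 0, 0; 0, 0, 0, Complex.I; 0, 0, -Complex.I, 0]] A

lemma sd_eq_null (A : Fin 3) : sd A = nullM.transpose * nullSd A * nullM := by
  have hI := Complex.I_mul_I
  ext i j
  fin_cases A <;> fin_cases i <;> fin_cases j <;>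
    simp [sd, nullM, nullSd, Matrix.mul_apply, Fin.sum_univ_four] <;>
    first
    | ring1
    | linear_combination hI
    | linear_combination -hI

lemma pull_spinL (a b c d : ℂ) (n : Tensor2) :
    pull (spinL a b c d) (nullM.transpose * n * nullM) =
      nullM.transpose * ((spinK a b c d).transpose * n * spinK a b c d) * nullM := by
  have h1 := nullM_mul_nullInv
  have h2 : nullInv.transpose * nullM.transpose = 1 := by
    rw [← Matrix.transpose_mul, h1, Matrix.transpose_one]
  rw [pull_apply, toC_spinL]
  simp only [Matrix.transpose_mul]
  calc _ = nullM.transpose * ((spinK a b c d).transpose *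
        ((nullInv.transpose * nullM.transpose) * n * (nullM * nullInv)) *
          spinK a b c d) * nullM := by simp only [Matrix.mul_assoc]
    _ = _ := by rw [h1, h2, Matrix.one_mul, Matrix.mul_one]

lemma sum_spinP_nullSd (a b : ℂ) : ∑ A, spinP a b A • nullSd A = (1 / 2 : ℂ) •
    !![0, -a ^ 2, 0, -(a * b); a ^ 2, 0, a * b, 0; 0, -(a * b), 0, -b ^ 2; a * b, 0, b ^ 2, 0] := by
  have hI := Complex.I_mul_I
  ext i j
  fin_cases i <;> fin_cases j <;>
    simp [Fin.sum_univ_three, nullSd, spinP] <;>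
    first
    | ring1
    | linear_combination ((a ^ 2 + b ^ 2) / 4) * hI
    | linear_combination (-(a ^ 2 + b ^ 2) / 4) * hI

lemma sum_spinU_nullSd (a b c d : ℂ) : ∑ A, spinU a b c d A • nullSd A = (1 / 2 : ℂ) •
    !![0, -(2 * a * c), 0, -(a * d + b * c); 2 * a * c, 0, a * d + b * c, 0;
      0, -(a * d + b * c), 0, -(2 * b * d); a * d + b * c, 0, 2 * b * d, 0] := by
  have hI := Complex.I_mul_I
  ext i j
  fin_cases i <;> fin_cases j <;>
    simp [Fin.sum_univ_three, nullSd, spinU] <;>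
    first
    | ring1
    | linear_combination ((a * c + b * d) / 2) * hI
    | linear_combination (-(a * c + b * d) / 2) * hI

/-- In spinor form a self-dual bivector is a symmetric spinor times the conjugate symplectic form.
The latter is only scaled by the conjugate determinant, the factor in `key`. -/
lemma spinK_nullU {a b c d : ℂ} (hD : a * d - b * c = 1) :
    (spinK a b c d).transpose * nullSd 0 * spinK a b c d =
      ∑ A, spinU a b c d A • nullSd A := by
  have hD' : conj a * conj d - conj b * conj c = 1 := by
    rw [← map_mul, ← map_mul, ← map_sub, hD, map_one]
  have key : (spinK a b c d).transpose * nullSd 0 * spinK a b c d =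
      (conj a * conj d - conj b * conj c) • ∑ A, spinU a b c d A • nullSd A := by
    rw [sum_spinU_nullSd]
    ext i j
    fin_cases i <;> fin_cases j <;>
      simp [spinK, nullSd, Matrix.mul_apply, Fin.sum_univ_four] <;> ring1
  rw [key, hD', one_smul]

lemma spinK_nullP {a b c d : ℂ} (hD : a * d - b * c = 1) :
    (spinK a b c d).transpose * ((1 / 2 : ℂ) • (nullSd 1 + Complex.I • nullSd 2)) *
      spinK a b c d = ∑ A, spinP a b A • nullSd A := by
  have hD' : conj a * conj d - conj b * conj c = 1 := by
    rw [← map_mul, ← map_mul, ← map_sub, hD, map_one]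
  have hP : (1 / 2 : ℂ) • (nullSd 1 + Complex.I • nullSd 2) = (1 / 2 : ℂ) •
      !![0, -1, 0, 0; 1, 0, 0, 0; 0, 0, 0, 0; 0, 0, 0, 0] := by
    have hI := Complex.I_mul_I
    ext i j
    fin_cases i <;> fin_cases j <;> simp [nullSd] <;>
      first
      | ring1
      | linear_combination (1 / 4 : ℂ) * hI
      | linear_combination (-1 / 4 : ℂ) * hI
      | linear_combination (1 / 2 : ℂ) * hI
      | linear_combination (-1 / 2 : ℂ) * hI
  have key : (spinK a b c d).transpose * ((1 / 2 : ℂ) •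
      !![0, -1, 0, 0; 1, 0, 0, 0; 0, 0, 0, 0; 0, 0, 0, 0]) * spinK a b c d =
      (conj a * conj d - conj b * conj c) • ∑ A, spinP a b A • nullSd A := by
    rw [sum_spinP_nullSd]
    ext i j
    fin_cases i <;> fin_cases j <;>
      simp [spinK, Matrix.mul_apply, Fin.sum_univ_four] <;> ring1
  rw [hP, key, hD', one_smul]

lemma sum_smul_sd (v : Fin 3 → ℂ) : nullM.transpose * (∑ A, v A • nullSd A) * nullM =
    ∑ A, v A • sd A := by
  rw [Finset.mul_sum, Finset.sum_mul]
  refine Finset.sum_congr rfl fun A _ => ?_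
  rw [sd_eq_null, Matrix.mul_smul, Matrix.smul_mul]

lemma pull_spinL_sd {a b c d : ℂ} (hD : a * d - b * c = 1) :
    pull (spinL a b c d) (sd 0) = ∑ A, spinU a b c d A • sd A := by
  rw [sd_eq_null, pull_spinL, spinK_nullU hD, sum_smul_sd]

lemma pull_spinL_sdP {a b c d : ℂ} (hD : a * d - b * c = 1) :
    pull (spinL a b c d) sdP = ∑ A, spinP a b A • sd A := by
  have h : sdP = nullM.transpose * ((1 / 2 : ℂ) • (nullSd 1 + Complex.I • nullSd 2)) * nullM := by
    rw [sdP, sd_eq_null 1, sd_eq_null 2]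
    simp only [Matrix.mul_smul, Matrix.smul_mul, Matrix.mul_add, Matrix.add_mul]
  rw [h, pull_spinL, spinK_nullP hD, sum_smul_sd]

/-! # Principal frames at a point -/

/-- The self-dual double bivector with components `w` in a coframe. -/
def dbl (θ : Matrix (Fin 4) (Fin 4) ℝ) (w : Matrix (Fin 3) (Fin 3) ℂ) : Tensor4 :=
  (1 / 2 : ℂ) • ∑ A, ∑ B, w A B • tensor (pull θ (sd A)) (pull θ (sd B))

/-- The minus sign comes from the squares -2 of `sd`; the normalization 1/2 in `dbl` leaves no other
factor. Thus the conditions on 𝓦² and 𝓦³ become conditions on w² and w³. -/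
lemma comp_dbl {G θ : Matrix (Fin 4) (Fin 4) ℝ} (h : IsCoframe G θ)
    (v w : Matrix (Fin 3) (Fin 3) ℂ) : comp G (dbl θ v) (dbl θ w) = -dbl θ (v * w) := by
  rw [← compL_apply]
  simp only [dbl, map_smul, map_sum, LinearMap.smul_apply, LinearMap.sum_apply, compL_apply,
    comp_tensor, pair_pull h, pair_sd]
  simp only [Fin.sum_univ_three, Matrix.mul_apply]
  funext α β μ ν
  simp [tensor]
  ring1

end

section

lemma image_dbl {G θ : Matrix (Fin 4) (Fin 4) ℝ} (h : IsCoframe G θ)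
    (w : Matrix (Fin 3) (Fin 3) ℂ) (B : Fin 3) :
    image G (dbl θ w) (pull θ (sd B)) = -∑ A, w A B • pull θ (sd A) := by
  rw [dbl, image_smul]
  simp only [Fin.sum_univ_three, image_add, image_smul, image_tensor, pair_pull h, pair_sd]
  fin_cases B <;> ext i j <;> simp <;> ring

lemma dbl_injective {G θ : Matrix (Fin 4) (Fin 4) ℝ} (h : IsCoframe G θ)
    {w : Matrix (Fin 3) (Fin 3) ℂ} (h0 : dbl θ w = 0) : w = 0 := by
  ext A B
  have h1 : pair G (image G (dbl θ w) (pull θ (sd B))) (pull θ (sd A)) = 2 * w A B := by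
    rw [image_dbl h, pair_neg_left]
    simp only [Fin.sum_univ_three, pair_add_left, pair_smul_left, pair_pull h, pair_sd]
    fin_cases A <;> simp <;> ring
  rw [h0] at h1
  have h2 : image G 0 (pull θ (sd B)) = 0 := by ext; simp [image]
  have h3 : pair G 0 (pull θ (sd A)) = 0 := by simp [pair]
  rw [h2, h3] at h1
  simpa using h1.symm

lemma dbl_zero (θ : Matrix (Fin 4) (Fin 4) ℝ) : dbl θ 0 = 0 := by simp [dbl]

lemma pull4_selfDual (θ : Matrix (Fin 4) (Fin 4) ℝ) (w : Matrix (Fin 3) (Fin 3) ℂ) :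
    pull4 θ ((1 / 2 : ℂ) • ∑ A, ∑ B, w A B • tensor (sd A) (sd B)) = dbl θ w := by
  simp only [dbl, map_smul, map_sum, pull4_tensor]

/-- The spin frame that normalizes w also transforms θ. The 2 in its canonical form cancels the 1/2
of `dbl`, and the remaining `rt` is the normalization of 𝓤₁. -/
lemma exists_principal_coframe {G θ : Matrix (Fin 4) (Fin 4) ℝ} (h : IsCoframe G θ)
    {w : Matrix (Fin 3) (Fin 3) ℂ} (hs : w.transpose = w)
    (h2 : comp G (dbl θ w) (dbl θ w) ≠ 0)
    (h3 : comp G (dbl θ w) (comp G (dbl θ w) (dbl θ w)) = 0) :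
    ∃ θ', IsCoframe G θ' ∧
      dbl θ w = tensor (rt • pull θ' (sd 0)) (pull θ' sdP) +
        tensor (pull θ' sdP) (rt • pull θ' (sd 0)) := by
  rw [comp_dbl h] at h2
  have hw2 : w * w ≠ 0 := fun h0 => h2 (by rw [h0, dbl_zero, neg_zero])
  have hw3 : w * (w * w) = 0 := by
    apply dbl_injective h
    rw [comp_dbl h, ← neg_one_smul ℂ, comp_smul_right, comp_dbl h] at h3
    simpa using h3
  obtain ⟨a, b, c, d, hD, hw⟩ := exists_spin_canonical hs hw3 hw2
  have hL := spinL_isCoframe hD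
  refine ⟨spinL a b c d * θ, ⟨?_, ?_⟩, ?_⟩
  · rw [← h.metric]
    conv_rhs => rw [← hL.metric]
    rw [Matrix.transpose_mul]
    simp only [Matrix.mul_assoc]
  · rw [Matrix.det_mul]; exact mul_pos hL.pos h.pos
  · rw [← pull_pull, ← pull_pull, pull_spinL_sd hD, pull_spinL_sdP hD, hw]
    simp only [dbl, Matrix.smul_apply, Matrix.add_apply, Matrix.vecMulVec_apply,
      Fin.sum_univ_three]
    funext α β μ ν
    simp [tensor]
    ring

lemma exists_coframe {G E : Matrix (Fin 4) (Fin 4) ℝ} (hE : E.transpose * G * E = minkowski) :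
    ∃ θ, IsCoframe G θ := by
  have aux : ∀ E : Matrix (Fin 4) (Fin 4) ℝ, E.transpose * G * E = minkowski → 0 < E.det →
      ∃ θ, IsCoframe G θ := by
    intro E hE hd
    have hu : IsUnit E.det := hd.ne'.isUnit
    have h2 : E.transpose⁻¹ * E.transpose = 1 := Matrix.nonsing_inv_mul _ (by
      rwa [Matrix.det_transpose])
    refine ⟨E⁻¹, ?_, ?_⟩
    · rw [← hE, Matrix.transpose_nonsing_inv]
      calc _ = (E.transpose⁻¹ * E.transpose) * G * (E * E⁻¹) := by simp only [Matrix.mul_assoc]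
        _ = G := by rw [h2, Matrix.mul_nonsing_inv _ hu, Matrix.one_mul, Matrix.mul_one]
    · rw [Matrix.det_nonsing_inv, Ring.inverse_eq_inv']; exact inv_pos.2 hd
  have hd : E.det ≠ 0 := by
    intro h0
    have := congrArg Matrix.det hE
    rw [Matrix.det_mul, h0, mul_zero, minkowski_det] at this
    norm_num at this
  rcases lt_or_gt_of_ne hd with h | h
  -- Reversing one spatial vector repairs the orientation and preserves orthonormality.
  · refine aux (E * Matrix.diagonal ![1, -1, 1, 1]) ?_ ?_
    · rw [Matrix.transpose_mul]
      calc _ = (Matrix.diagonal ![1, -1, 1, 1]).transpose * (E.transpose * G * E) *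
            Matrix.diagonal ![1, -1, 1, 1] := by simp only [Matrix.mul_assoc]
        _ = _ := by
          rw [hE, minkowski, Matrix.diagonal_transpose, Matrix.diagonal_mul_diagonal,
            Matrix.diagonal_mul_diagonal]
          congr 1
          funext i
          fin_cases i <;> simp
    · rw [Matrix.det_mul, Matrix.det_diagonal]
      simpa [Fin.prod_univ_four] using h
  · exact aux E hE h

/-- A Weyl tensor of type III has a canonical coframe at every point. -/
theorem exists_canonical_coframe {Ω : Set (Fin 4 → ℝ)} {g : (Fin 4 → ℝ) → Matrix (Fin 4) (Fin 4) ℝ}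
    {x : Fin 4 → ℝ} (hg : IsLorentzMetricOn Ω g) (hΩ : IsOpen Ω) (hx : x ∈ Ω)
    (hIII : IsTypeIII g x) :
    ∃ θ, IsCoframe (g x) θ ∧ calW g x = tensor (rt • pull θ (sd 0)) (pull θ sdP) +
      tensor (pull θ sdP) (rt • pull θ (sd 0)) := by
  obtain ⟨E, hE⟩ := hg.signature x hx
  obtain ⟨θ, h⟩ := exists_coframe hE
  have hT := hg.isWeylLike hΩ hx
  obtain ⟨w, hs, hw⟩ := (hT.pull4 h).selfDualPart_minkowski
  have hW : calW g x = dbl θ w := by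
    change selfDualPart (g x) (fun α β μ ν => (weyl g α β μ ν x : ℂ)) = _
    rw [← pull4_selfDual, ← hw, ← selfDualPart_pull4 h, pull4_pull4, h.inv_mul, pull4_one]
  obtain ⟨h2, h3⟩ := hIII
  rw [calW2, hW] at h2 h3
  rw [hW]
  exact exists_principal_coframe h hs h2 h3

end

section

/-! # Smoothness of the bivectors computed from the Weyl tensor -/

/-- Smoothness of the components of a 2-tensor field at a point. -/
def Smooth2 (F : (Fin 4 → ℝ) → Tensor2) (x : Fin 4 → ℝ) : Prop :=
  ∀ i j, ContDiffAt ℝ ∞ (fun y => F y i j) x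

/-- Smoothness of the components of a 4-tensor field at a point. -/
def Smooth4 (T : (Fin 4 → ℝ) → Tensor4) (x : Fin 4 → ℝ) : Prop :=
  ∀ i j k l, ContDiffAt ℝ ∞ (fun y => T y i j k l) x

variable {Ω : Set (Fin 4 → ℝ)} {g : (Fin 4 → ℝ) → Matrix (Fin 4) (Fin 4) ℝ} {x : Fin 4 → ℝ}
  {A B X : (Fin 4 → ℝ) → Tensor2} {S T : (Fin 4 → ℝ) → Tensor4} {c s : (Fin 4 → ℝ) → ℂ}

lemma contDiffAt_ofReal {f : (Fin 4 → ℝ) → ℝ} (hf : ContDiffAt ℝ ∞ f x) :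
    ContDiffAt ℝ ∞ (fun y => (f y : ℂ)) x :=
  Complex.ofRealCLM.contDiff.contDiffAt.comp x hf

lemma contDiffAt_re {f : (Fin 4 → ℝ) → ℂ} (hf : ContDiffAt ℝ ∞ f x) :
    ContDiffAt ℝ ∞ (fun y => (f y).re) x :=
  Complex.reCLM.contDiff.contDiffAt.comp x hf

lemma contDiffAt_conj {f : (Fin 4 → ℝ) → ℂ} (hf : ContDiffAt ℝ ∞ f x) :
    ContDiffAt ℝ ∞ (fun y => starRingEnd ℂ (f y)) x :=
  Complex.conjCLE.contDiff.contDiffAt.comp x hf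

lemma contDiffAt_one_div_two_mul_sq (hc : ContDiffAt ℝ ∞ c x) (h0 : c x ≠ 0) :
    ContDiffAt ℝ ∞ (fun y => 1 / (2 * c y ^ 2)) x := by
  simp only [one_div]
  exact (contDiffAt_const.mul (hc.pow 2)).inv (mul_ne_zero two_ne_zero (pow_ne_zero 2 h0))

lemma Smooth2.const (M : Tensor2) : Smooth2 (fun _ => M) x := fun _ _ => contDiffAt_const

lemma Smooth2.add (hA : Smooth2 A x) (hB : Smooth2 B x) : Smooth2 (fun y => A y + B y) x :=
  fun i j => (hA i j).add (hB i j)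

lemma Smooth2.sub (hA : Smooth2 A x) (hB : Smooth2 B x) : Smooth2 (fun y => A y - B y) x :=
  fun i j => (hA i j).sub (hB i j)

lemma Smooth2.neg (hA : Smooth2 A x) : Smooth2 (fun y => -A y) x := fun i j => (hA i j).neg

lemma Smooth2.smul (hc : ContDiffAt ℝ ∞ c x) (hA : Smooth2 A x) :
    Smooth2 (fun y => c y • A y) x := fun i j => hc.mul (hA i j)

lemma Smooth2.map_conj (hA : Smooth2 A x) : Smooth2 (fun y => (A y).map (starRingEnd ℂ)) x :=
  fun i j => contDiffAt_conj (hA i j)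

lemma Smooth4.add (hS : Smooth4 S x) (hT : Smooth4 T x) : Smooth4 (fun y => S y + T y) x :=
  fun i j k l => (hS i j k l).add (hT i j k l)

lemma Smooth2.tensor (hA : Smooth2 A x) (hB : Smooth2 B x) :
    Smooth4 (fun y => tensor (A y) (B y)) x := fun i j k l => (hA i j).mul (hB k l)

section
variable (hi : ∀ i j, ContDiffAt ℝ ∞ (fun y => (g y)⁻¹ i j) x)
include hi

lemma Smooth2.raise (hA : Smooth2 A x) : Smooth2 (fun y => raise (g y) (A y)) x := fun i j => by
  simp only [Spacetime.raise, Matrix.of_apply]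
  exact ContDiffAt.sum fun ρ _ => ContDiffAt.sum fun σ _ =>
    ((contDiffAt_ofReal (hi i ρ)).mul (contDiffAt_ofReal (hi j σ))).mul (hA ρ σ)

lemma Smooth2.dot (hA : Smooth2 A x) (hB : Smooth2 B x) :
    Smooth2 (fun y => dot (g y) (A y) (B y)) x := fun i j => by
  simp only [Spacetime.dot, Matrix.of_apply]
  exact ContDiffAt.sum fun ρ _ => ContDiffAt.sum fun σ _ =>
    ((hA i ρ).mul (contDiffAt_ofReal (hi ρ σ))).mul (hB σ j)

lemma Smooth4.image (hT : Smooth4 T x) (hA : Smooth2 A x) :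
    Smooth2 (fun y => image (g y) (T y) (A y)) x := fun i j =>
  contDiffAt_const.mul (ContDiffAt.sum fun μ _ => ContDiffAt.sum fun ν _ =>
    (hT i j μ ν).mul (hA.raise hi μ ν))

lemma Smooth4.form (hT : Smooth4 T x) (hA : Smooth2 A x) (hB : Smooth2 B x) :
    ContDiffAt ℝ ∞ (fun y => form (g y) (T y) (A y) (B y)) x :=
  contDiffAt_const.mul (ContDiffAt.sum fun α _ => ContDiffAt.sum fun β _ => ContDiffAt.sum
    fun μ _ => ContDiffAt.sum fun ν _ =>
      ((hT α β μ ν).mul (hA.raise hi α β)).mul (hB.raise hi μ ν))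

lemma Smooth4.comp (hS : Smooth4 S x) (hT : Smooth4 T x) :
    Smooth4 (fun y => comp (g y) (S y) (T y)) x := fun α β μ ν =>
  contDiffAt_const.mul (ContDiffAt.sum fun κ _ => ContDiffAt.sum fun ρ _ =>
    (hS α β κ ρ).mul (Smooth2.raise (A := fun y => Matrix.of fun κ' ρ' => T y κ' ρ' μ ν) hi
      (fun κ' ρ' => hT κ' ρ' μ ν) κ ρ))

lemma Smooth2.pair (hA : Smooth2 A x) (hB : Smooth2 B x) :
    ContDiffAt ℝ ∞ (fun y => pair (g y) (A y) (B y)) x :=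
  contDiffAt_const.mul (ContDiffAt.sum fun μ _ => ContDiffAt.sum fun ν _ =>
    (hA μ ν).mul (hB.raise hi μ ν))

end

section
variable (hg : IsLorentzMetricOn Ω g) (hΩ : IsOpen Ω) (hx : x ∈ Ω)
include hg hΩ hx

lemma smooth_calW : Smooth4 (calW g) x := fun α β μ ν => by
  have hW := fun a b c d => contDiffAt_ofReal (hg.contDiffAt_weyl hΩ hx a b c d)
  refine contDiffAt_const.mul ((hW α β μ ν).sub (contDiffAt_const.mul (contDiffAt_const.mul
    (ContDiffAt.sum fun κ _ => ContDiffAt.sum fun ρ _ => ?_))))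
  exact (contDiffAt_ofReal (hg.contDiffAt_vol hΩ hx α β κ ρ)).mul
    (Smooth2.raise (A := fun y => Matrix.of fun ρ σ => (weyl g ρ σ μ ν y : ℂ))
      (hg.contDiffAt_inv hΩ hx) (fun a b => hW a b μ ν) κ ρ)

lemma smooth_calG : Smooth4 (fun y => calG (g y)) x := fun α β μ ν => by
  have hG := hg.contDiffAt hΩ hx
  exact contDiffAt_const.mul ((contDiffAt_ofReal (((hG _ _).mul (hG _ _)).sub
    ((hG _ _).mul (hG _ _)))).sub (contDiffAt_const.mul
      (contDiffAt_ofReal (hg.contDiffAt_vol hΩ hx α β μ ν))))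

lemma smooth_calW2 : Smooth4 (calW2 g) x :=
  Smooth4.comp (hg.contDiffAt_inv hΩ hx) (smooth_calW hg hΩ hx) (smooth_calW hg hΩ hx)

variable (hX : Smooth2 X x) (hs : ContDiffAt ℝ ∞ s x) (hs0 : s x ≠ 0)
include hX hs hs0

lemma smooth_weylLp : Smooth2 (weylLp g X s) x :=
  (Smooth2.smul (hs.inv hs0)
    (Smooth4.image (hg.contDiffAt_inv hΩ hx) (smooth_calW2 hg hΩ hx) hX)).neg

variable (hip : ip (g x) (weylLp g X s x) (X x) ≠ 0)
include hip

lemma smooth_weylU : Smooth2 (weylU g X s) x := by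
  have hi := hg.contDiffAt_inv hΩ hx
  have hL := smooth_weylLp hg hΩ hx hX hs hs0
  have hp := Smooth4.form hi (smooth_calG hg hΩ hx) hL hX
  refine Smooth2.smul (contDiffAt_one_div_two_mul_sq hp hip) (Smooth2.sub (Smooth2.smul
      (contDiffAt_const.mul hp) (Smooth4.image hi (smooth_calW hg hΩ hx) hX))
        (Smooth2.smul (Smooth4.form hi (smooth_calW hg hΩ hx) hX hX) hL))

lemma smooth_weylLm : Smooth2 (weylLm g X s) x := by
  have hi := hg.contDiffAt_inv hΩ hx
  have hL := smooth_weylLp hg hΩ hx hX hs hs0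
  have hU := smooth_weylU hg hΩ hx hX hs hs0 hip
  have hS : Smooth4 (weylS g X s) x := (smooth_calG hg hΩ hx).add (hU.tensor hU)
  have hp := Smooth4.form hi (smooth_calG hg hΩ hx) hL hX
  refine Smooth2.smul (contDiffAt_one_div_two_mul_sq hp hip) (Smooth2.sub
        (Smooth2.smul (Smooth4.form hi hS hX hX) hL) (Smooth2.smul
      (contDiffAt_const.mul hp) (Smooth4.image hi hS hX)))

end

end

section

variable {Ω : Set (Fin 4 → ℝ)} {g : (Fin 4 → ℝ) → Matrix (Fin 4) (Fin 4) ℝ} {x : Fin 4 → ℝ}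

/-! # Recovering a coframe from its self-dual bivectors -/

/-- This quadratic expression in the bivectors singles out the time direction; through it the triad
determines θ⁰⊗θ⁰. -/
lemma sum_sd_conj : ∑ A, sd A * toC minkowski * (sd A).map (starRingEnd ℂ) =
    (-4 : ℂ) • Matrix.single 0 0 1 - toC minkowski := by
  rw [toC_minkowski]
  ext i j
  fin_cases i <;> fin_cases j <;>
    simp [Fin.sum_univ_three, Fin.sum_univ_four, sd, Matrix.single,
      Matrix.vecMul, dotProduct] <;> norm_num

lemma pull_map_conj (θ : Matrix (Fin 4) (Fin 4) ℝ) (X : Tensor2) :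
    (pull θ X).map (starRingEnd ℂ) = pull θ (X.map (starRingEnd ℂ)) := by
  have h : (toC θ).map (starRingEnd ℂ) = toC θ := by ext i j; simp [toC]
  have h' : (toC θ).transpose.map (starRingEnd ℂ) = (toC θ).transpose := by ext i j; simp [toC]
  rw [pull_apply, pull_apply, Matrix.map_mul, Matrix.map_mul, h, h']

/-- The square of the time-like covector of a coframe, computed from its self-dual bivectors. -/
def timeSq (G : Matrix (Fin 4) (Fin 4) ℝ) (S : Fin 3 → Tensor2) : Tensor2 :=
  (-1 / 4 : ℂ) • (dot G (S 0) ((S 0).map (starRingEnd ℂ)) + dot G (S 1) ((S 1).map (starRingEnd ℂ)) +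
    dot G (S 2) ((S 2).map (starRingEnd ℂ)) + toC G)

lemma timeSq_apply {G θ : Matrix (Fin 4) (Fin 4) ℝ} (h : IsCoframe G θ) {S : Fin 3 → Tensor2}
    (hS : ∀ A, S A = pull θ (sd A)) (α β : Fin 4) :
    timeSq G S α β = (θ 0 α : ℂ) * (θ 0 β : ℂ) := by
  have h1 : toC G = pull θ (toC minkowski) := by
    rw [pull_apply, ← toC_transpose, ← toC_mul, ← toC_mul, h.metric]
  have h2 := sum_sd_conj
  rw [Fin.sum_univ_three] at h2
  rw [timeSq]
  simp only [hS, pull_map_conj, dot_pull h]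
  rw [h1, ← map_add, ← map_add, ← map_add, h2, sub_add_cancel, map_smul, smul_smul]
  rw [Matrix.smul_apply, pull_entry]
  simp [Matrix.single, Fin.sum_univ_four]

/-- The only time components of `sd A` are those of e₀∧e_A, so contraction with θ⁰ leaves θ^A. -/
lemma space_apply {G θ : Matrix (Fin 4) (Fin 4) ℝ} (h : IsCoframe G θ) (A : Fin 3) (ν : Fin 4) :
    ∑ κ, ∑ ρ, (θ 0 κ : ℂ) * ((G⁻¹ κ ρ : ℝ) : ℂ) * pull θ (sd A) ρ ν = (θ A.succ ν : ℂ) := by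
  have h1 : toC θ * toC G⁻¹ * pull θ (sd A) = toC minkowski * sd A * toC θ := by
    have h2 : (toC θ⁻¹).transpose * (toC θ).transpose = 1 := by
      rw [← Matrix.transpose_mul, h.toC_mul_inv, Matrix.transpose_one]
    rw [toC_metric_inv h, pull_apply]
    calc _ = (toC θ * toC θ⁻¹) * toC minkowski * ((toC θ⁻¹).transpose * (toC θ).transpose) *
          sd A * toC θ := by simp only [Matrix.mul_assoc]
      _ = _ := by rw [h2, h.toC_mul_inv, Matrix.one_mul, Matrix.mul_one]
  have h3 := congrFun (congrFun h1 0) ν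
  have h4 : (toC minkowski * sd A * toC θ) 0 ν = (θ A.succ ν : ℂ) := by
    rw [toC_minkowski]
    fin_cases A <;> simp [Matrix.mul_apply, Fin.sum_univ_four, sd, toC]
  rw [← h4, ← h3, Matrix.mul_apply]
  simp only [Matrix.mul_apply, Finset.sum_mul]
  rw [Finset.sum_comm]
  rfl

/-- In even dimension -θ has the same orientation, and by `pull_neg` the same bivectors. This
freedom is used to choose the sign of θ⁰. -/
lemma IsCoframe.neg {G θ : Matrix (Fin 4) (Fin 4) ℝ} (h : IsCoframe G θ) : IsCoframe G (-θ) := by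
  refine ⟨by rw [← h.metric]; simp, ?_⟩
  have h4 : (-θ).det = θ.det := by rw [Matrix.det_neg, Fintype.card_fin]; norm_num
  rw [h4]
  exact h.pos

lemma pull_neg (θ : Matrix (Fin 4) (Fin 4) ℝ) (X : Tensor2) : pull (-θ) X = pull θ X := by
  have h : toC (-θ) = -toC θ := by ext i j; simp [toC]
  rw [pull_apply, pull_apply, h]; simp

/-- Smooth bivectors make θ⁰⊗θ⁰ smooth. Evaluating one slot on a fixed vector v and normalizing
gives θ⁰ itself, with the sign for which θ⁰(v) > 0. The rest of the coframe follows by contraction.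
-/
theorem exists_smooth_coframe {V : Set (Fin 4 → ℝ)} {p : Fin 4 → ℝ} (hg : IsLorentzMetricOn Ω g)
    (hΩ : IsOpen Ω) (hV : IsOpen V) (hVΩ : V ⊆ Ω) (hp : p ∈ V) {S : Fin 3 → (Fin 4 → ℝ) → Tensor2}
    (hS : ∀ y ∈ V, ∀ A, Smooth2 (S A) y)
    (hθ : ∀ y ∈ V, ∃ θ, IsCoframe (g y) θ ∧ ∀ A, S A y = pull θ (sd A)) :
    ∃ V' ⊆ V, IsOpen V' ∧ p ∈ V' ∧ ∃ θ : (Fin 4 → ℝ) → Matrix (Fin 4) (Fin 4) ℝ, ∀ y ∈ V',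
      IsCoframe (g y) (θ y) ∧ (∀ A, S A y = pull (θ y) (sd A)) ∧
      ∀ i j, ContDiffAt ℝ ∞ (fun z => θ z i j) y := by
  obtain ⟨θp, hcp, hSp⟩ := hθ p hp
  -- With v the vector e₀ of the coframe at p, θ⁰(v) = 1 there, so θ⁰(v) ≠ 0 nearby.
  set v : Fin 4 → ℝ := dualFrame θp 0 with hv
  set P : (Fin 4 → ℝ) → Tensor2 := fun y => timeSq (g y) (fun A => S A y) with hP
  have hPs : ∀ y ∈ V, Smooth2 P y := by
    intro y hy
    have hi := hg.contDiffAt_inv hΩ (hVΩ hy)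
    have hd := fun A => Smooth2.dot hi (hS y hy A) (hS y hy A).map_conj
    have hgs : Smooth2 (fun z => toC (g z)) y := fun i j =>
      contDiffAt_ofReal (hg.contDiffAt hΩ (hVΩ hy) i j)
    exact Smooth2.smul (c := fun _ => (-1 / 4 : ℂ)) contDiffAt_const
      ((((hd 0).add (hd 1)).add (hd 2)).add hgs)
  -- r = θ⁰(v)θ⁰ and, below, q = θ⁰(v)²: both are smooth and blind to the sign of θ.
  set r : (Fin 4 → ℝ) → Fin 4 → ℝ := fun y α => ∑ β, (P y α β).re * v β with hr
  set q : (Fin 4 → ℝ) → ℝ := fun y => ∑ α, r y α * v α with hq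
  have hrs : ∀ y ∈ V, ∀ α, ContDiffAt ℝ ∞ (fun z => r z α) y := fun y hy α =>
    ContDiffAt.sum fun β _ => (contDiffAt_re (hPs y hy α β)).mul contDiffAt_const
  have hqs : ∀ y ∈ V, ContDiffAt ℝ ∞ q y := fun y hy =>
    ContDiffAt.sum fun β _ => (hrs y hy β).mul contDiffAt_const
  have hreq : ∀ y θ, IsCoframe (g y) θ → (∀ A, S A y = pull θ (sd A)) → ∀ α,
      r y α = θ 0 α * ∑ β, θ 0 β * v β := by
    intro y θ hc hs α
    simp only [hr, hP, timeSq_apply hc hs, Finset.mul_sum]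
    refine Finset.sum_congr rfl fun β _ => ?_
    rw [← Complex.ofReal_mul, Complex.ofReal_re, mul_assoc]
  have hqeq : ∀ y θ, IsCoframe (g y) θ → (∀ A, S A y = pull θ (sd A)) →
      q y = (∑ β, θ 0 β * v β) ^ 2 := by
    intro y θ hc hs
    simp only [hq, hreq y θ hc hs]
    rw [pow_two, Finset.sum_mul]
    exact Finset.sum_congr rfl fun β _ => by ring
  have hqp : 0 < q p := by
    have h1 : ∑ β, θp 0 β * v β = (θp * θp⁻¹) 0 0 := by
      rw [Matrix.mul_apply]; rfl
    rw [hqeq p θp hcp hSp, h1, hcp.mul_inv]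
    simp
  have hev : ∀ᶠ y in 𝓝 p, 0 < q y ∧ y ∈ V :=
    ((hqs p hp).continuousAt.eventually_const_lt hqp).and (hV.mem_nhds hp)
  obtain ⟨V', hV'sub, hV', hpV'⟩ := mem_nhds_iff.1 hev
  have hex : ∀ y, ∃ θ, y ∈ V' → IsCoframe (g y) θ ∧ (∀ A, S A y = pull θ (sd A)) ∧
      0 < ∑ β, θ 0 β * v β := by
    intro y
    by_cases hy : y ∈ V'
    · obtain ⟨θ, hc, hs⟩ := hθ y (hV'sub hy).2
      have h1 := (hV'sub hy).1
      rw [hqeq y θ hc hs] at h1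
      rcases lt_or_gt_of_ne (fun h0 => by rw [h0] at h1; norm_num at h1 :
        (∑ β, θ 0 β * v β) ≠ 0) with h2 | h2
      · refine ⟨-θ, fun _ => ⟨hc.neg, fun A => by rw [hs, pull_neg], ?_⟩⟩
        simpa using h2
      · exact ⟨θ, fun _ => ⟨hc, hs, h2⟩⟩
    · exact ⟨0, fun h => absurd h hy⟩
  choose θ hθ' using hex
  refine ⟨V', fun y hy => (hV'sub hy).2, hV', hpV', θ, fun y hy =>
    ⟨(hθ' y hy).1, (hθ' y hy).2.1, ?_⟩⟩
  have hyV := (hV'sub hy).2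
  have h0eq : ∀ z ∈ V', ∀ α, θ z 0 α = r z α / √(q z) := by
    intro z hz α
    obtain ⟨hc, hs, hpos⟩ := hθ' z hz
    rw [hqeq z _ hc hs, Real.sqrt_sq hpos.le, hreq z _ hc hs, mul_div_cancel_right₀ _ hpos.ne']
  have h0 : ∀ α, ContDiffAt ℝ ∞ (fun z => θ z 0 α) y := by
    intro α
    have hq0 := (hV'sub hy).1
    refine ContDiffAt.congr_of_eventuallyEq (f := fun z => r z α / √(q z)) ?_ ?_
    · exact (hrs y hyV α).div ((hqs y hyV).sqrt hq0.ne') (Real.sqrt_pos.2 hq0).ne'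
    · filter_upwards [hV'.mem_nhds hy] with z hz using h0eq z hz α
  intro i ν
  refine Fin.cases (h0 ν) (fun A => ?_) i
  have hi := hg.contDiffAt_inv hΩ (hVΩ hyV)
  refine ContDiffAt.congr_of_eventuallyEq (f := fun z => (∑ κ, ∑ ρ, (θ z 0 κ : ℂ) *
    (((g z)⁻¹ κ ρ : ℝ) : ℂ) * S A z ρ ν).re) (contDiffAt_re (ContDiffAt.sum fun κ _ =>
      ContDiffAt.sum fun ρ _ => ((contDiffAt_ofReal (h0 κ)).mul (contDiffAt_ofReal (hi κ ρ))).mul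
        (hS y hyV A ρ ν))) ?_
  filter_upwards [hV'.mem_nhds hy] with z hz
  rw [(hθ' z hz).2.1 A, space_apply (hθ' z hz).1, Complex.ofReal_re]

lemma isOrientedFrameOn_dualFrame {V : Set (Fin 4 → ℝ)} (hg : IsLorentzMetricOn Ω g)
    (hΩ : IsOpen Ω) (hVΩ : V ⊆ Ω) {θ : (Fin 4 → ℝ) → Matrix (Fin 4) (Fin 4) ℝ}
    (hθ : ∀ y ∈ V, IsCoframe (g y) (θ y))
    (hs : ∀ y ∈ V, ∀ i j, ContDiffAt ℝ ∞ (fun z => θ z i j) y) (hV : IsOpen V) :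
    IsOrientedFrameOn g V (fun a y => dualFrame (θ y) a) := by
  refine ⟨fun a => contDiffOn_pi.2 fun μ y hy => ContDiffAt.contDiffWithinAt ?_,
    fun y hy => (hθ y hy).tetrad.1, fun y hy => (hθ y hy).tetrad.2⟩
  have hi := hg.contDiffAt_inv hΩ (hVΩ hy)
  refine ContDiffAt.congr_of_eventuallyEq (f := fun z => ∑ ν, (g z)⁻¹ μ ν * (θ z a ν *
    minkowski a a)) (ContDiffAt.sum fun ν _ => (hi μ ν).mul ((hs y hy a ν).mul contDiffAt_const)) ?_
  filter_upwards [hV.mem_nhds hy] with z hz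
  have h := hθ z hz
  -- The vectors are the covectors with raised index, so smoothness of g⁻¹ and θ suffices.
  have h1 : (θ z)⁻¹ = (g z)⁻¹ * ((θ z).transpose * minkowski) := by
    rw [h.metric_inv]
    have h2 : (θ z)⁻¹.transpose * (θ z).transpose = 1 := by
      rw [← Matrix.transpose_mul, h.mul_inv, Matrix.transpose_one]
    calc (θ z)⁻¹ = (θ z)⁻¹ * minkowski * ((θ z)⁻¹.transpose * (θ z).transpose) * minkowski := by
          rw [h2, Matrix.mul_one, Matrix.mul_assoc, minkowski_mul_self, Matrix.mul_one]
      _ = _ := by simp only [Matrix.mul_assoc]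
  rw [dualFrame, h1, Matrix.mul_apply]
  refine Finset.sum_congr rfl fun ν _ => ?_
  rw [minkowski, Matrix.mul_diagonal, Matrix.diagonal_apply_eq, Matrix.transpose_apply]

end

/-! ### Local existence of smooth principal frames. -/

section

variable {Ω : Set (Fin 4 → ℝ)} {g : (Fin 4 → ℝ) → Matrix (Fin 4) (Fin 4) ℝ}

/-- A nonzero cubic invariant of the triad. Being odd, it detects a common change of sign, since ε³
= ε. -/
lemma pair_dot_sd : pair minkowski (dot minkowski (sd 0) sdP) sdM = -1 := by
  rw [dot_eq, minkowski_inv, toC_minkowski, pair_minkowski]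
  simp [sd, sdP, sdM, Matrix.mul_apply, Fin.sum_univ_four]
  linear_combination (3 / 4 : ℂ) * Complex.I_sq

/-- The common sign of the bivectors computed from a Weyl tensor and those of its frame. -/
lemma triad_sign {G θ : Matrix (Fin 4) (Fin 4) ℝ} (h : IsCoframe G θ) {ε : ℂ} (hε : ε ^ 2 = 1) :
    -rt⁻¹ * pair G (dot G (ε • rt • pull θ (sd 0)) (ε • pull θ sdP)) (ε • pull θ sdM) = ε := by
  have h1 : dot G (pull θ (sd 0)) (pull θ sdP) = pull θ (dot minkowski (sd 0) sdP) := by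
    rw [dot_pull h, dot_eq, minkowski_inv]
  have h2 : dot G (ε • rt • pull θ (sd 0)) (ε • pull θ sdP) =
      (ε * rt * ε) • dot G (pull θ (sd 0)) (pull θ sdP) := by
    simp only [dot_eq, Matrix.smul_mul, Matrix.mul_smul, smul_smul]
    congr 1; ring
  rw [h2, h1, pair_smul_left, pair_smul_right, pair_pull h, pair_dot_sd]
  have h3 := rt_ne_zero
  field_simp
  linear_combination ε * hε

theorem exists_isWeylPrincipalFrameOn (hg : IsLorentzMetricOn Ω g) (hΩ : IsOpen Ω)
    (hIII : ∀ x ∈ Ω, IsTypeIII g x) {p : Fin 4 → ℝ} (hp : p ∈ Ω) :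
    ∃ V ⊆ Ω, IsOpen V ∧ p ∈ V ∧ ∃ e : Fin 4 → (Fin 4 → ℝ) → Fin 4 → ℝ,
      IsWeylPrincipalFrameOn g V e := by
  have hcan := fun x hx => exists_canonical_coframe hg hΩ hx (hIII x hx)
  obtain ⟨θp, hcp, hWp⟩ := hcan p hp
  -- Taking X equal to ℓ₋ at p makes -𝓦²(X,X) = (ℓ₊,ℓ₋)² = 1 there. Near p it stays in the slit
  -- plane, where the principal square root is smooth.
  set X : (Fin 4 → ℝ) → Tensor2 := fun _ => pull θp sdM with hX
  have hXs : ∀ y, Smooth2 X y := fun y => Smooth2.const _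
  set f : (Fin 4 → ℝ) → ℂ := fun y => -form (g y) (calW2 g y) (X y) (X y) with hf
  have hfs : ∀ y ∈ Ω, ContDiffAt ℝ ∞ f y := fun y hy =>
    (Smooth4.form (hg.contDiffAt_inv hΩ hy) (smooth_calW2 hg hΩ hy) (hXs y) (hXs y)).neg
  have hfp : f p = 1 := by
    have hT := isTriad_pull hcp
    have h2 : calW2 g p = -tensor (pull θp sdP) (pull θp sdP) := by
      rw [calW2, hWp, comp_canonical hT]
    simp only [hf, hX, form_eq_pair_image, h2, image_neg, image_tensor, pair_neg_left,
      pair_smul_left, hT.pm]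
    norm_num
  have hev : ∀ᶠ y in 𝓝 p, f y ∈ Complex.slitPlane ∧ y ∈ Ω := by
    refine ((hfs p hp).continuousAt.eventually_mem (Complex.isOpen_slitPlane.mem_nhds ?_)).and
      (hΩ.mem_nhds hp)
    rw [hfp]; exact Complex.one_mem_slitPlane
  obtain ⟨V, hVsub, hV, hpV⟩ := mem_nhds_iff.1 hev
  have hVΩ : V ⊆ Ω := fun y hy => (hVsub hy).2
  set s : (Fin 4 → ℝ) → ℂ := fun y => Complex.exp (1 / 2 * Complex.log (f y)) with hs
  have hs0 : ∀ y, s y ≠ 0 := fun y => Complex.exp_ne_zero _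
  have hss : ∀ y ∈ V, ContDiffAt ℝ ∞ s y := fun y hy =>
    (contDiffAt_const.mul (((Complex.contDiffAt_log (hVsub hy).1).restrict_scalars ℝ).comp y
      (hfs y (hVΩ hy)))).cexp
  have hf0 : ∀ y ∈ V, f y ≠ 0 := fun y hy => Complex.slitPlane_ne_zero (hVsub hy).1
  have hs2 : ∀ y ∈ V, s y ^ 2 = -form (g y) (calW2 g y) (X y) (X y) := by
    intro y hy
    rw [hs, ← Complex.exp_nat_mul]
    have : ((2 : ℕ) : ℂ) * (1 / 2 * Complex.log (f y)) = Complex.log (f y) := by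
      push_cast; ring
    rw [this, Complex.exp_log (hf0 y hy)]
  have hne : ∀ y ∈ V, image (g y) (calW2 g y) (X y) ≠ 0 := by
    intro y hy h0
    apply hf0 y hy
    simp only [hf, form_eq_pair_image, h0]
    simp [pair]
  have key : ∀ y ∈ V, ∃ θ, IsCoframe (g y) θ ∧ calW g y = tensor (rt • pull θ (sd 0)) (pull θ sdP) +
      tensor (pull θ sdP) (rt • pull θ (sd 0)) ∧ ∃ ε : ℂ, ε ^ 2 = 1 ∧
      ip (g y) (weylLp g X s y) (X y) ≠ 0 ∧ weylU g X s y = ε • rt • pull θ (sd 0) ∧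
      weylLp g X s y = ε • pull θ sdP ∧ weylLm g X s y = ε • pull θ sdM := by
    intro y hy
    obtain ⟨θ, hc, hW⟩ := hcan y (hVΩ hy)
    obtain ⟨ε, hε, -, -, hip, h1, h2, h3⟩ := weylTriad_eq (isTriad_pull hc) hW (hne y hy) (hs2 y hy)
    exact ⟨θ, hc, hW, ε, by rcases hε with rfl | rfl <;> norm_num, hip, h1, h2, h3⟩
  -- By `triad_sign` σ is the sign ε, now given by a smooth expression. Multiplying by it turns the
  -- computed triad into smooth fields S with components `sd` in the pointwise coframes.
  set σ : (Fin 4 → ℝ) → ℂ := fun y =>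
    -rt⁻¹ * pair (g y) (dot (g y) (weylU g X s y) (weylLp g X s y)) (weylLm g X s y) with hσ
  set S : Fin 3 → (Fin 4 → ℝ) → Tensor2 := ![fun y => (rt⁻¹ * σ y) • weylU g X s y,
    fun y => σ y • (weylLp g X s y + weylLm g X s y),
    fun y => (-Complex.I * σ y) • (weylLp g X s y - weylLm g X s y)] with hS
  have hSs : ∀ y ∈ V, ∀ A, Smooth2 (S A) y := by
    intro y hy
    obtain ⟨θ, -, -, ε, -, hip, -, -, -⟩ := key y hy
    have hi := hg.contDiffAt_inv hΩ (hVΩ hy)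
    have h1 := smooth_weylLp hg hΩ (hVΩ hy) (hXs y) (hss y hy) (hs0 y)
    have h2 := smooth_weylU hg hΩ (hVΩ hy) (hXs y) (hss y hy) (hs0 y) hip
    have h3 := smooth_weylLm hg hΩ (hVΩ hy) (hXs y) (hss y hy) (hs0 y) hip
    have hσs : ContDiffAt ℝ ∞ σ y :=
      contDiffAt_const.mul (Smooth2.pair hi (Smooth2.dot hi h2 h1) h3)
    have h4 : Smooth2 (fun y => (rt⁻¹ * σ y) • weylU g X s y) y :=
      Smooth2.smul (contDiffAt_const.mul hσs) h2
    have h5 : Smooth2 (fun y => σ y • (weylLp g X s y + weylLm g X s y)) y :=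
      Smooth2.smul hσs (h1.add h3)
    have h6 : Smooth2 (fun y => (-Complex.I * σ y) • (weylLp g X s y - weylLm g X s y)) y :=
      Smooth2.smul (contDiffAt_const.mul hσs) (h1.sub h3)
    intro A
    fin_cases A
    exacts [h4, h5, h6]
  have hSθ : ∀ y ∈ V, ∃ θ, IsCoframe (g y) θ ∧ calW g y = tensor (rt • pull θ (sd 0)) (pull θ sdP) +
      tensor (pull θ sdP) (rt • pull θ (sd 0)) ∧ ∀ A, S A y = pull θ (sd A) := by
    intro y hy
    obtain ⟨θ, hc, hW, ε, hε, -, h1, h2, h3⟩ := key y hy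
    have hσε : σ y = ε := by rw [hσ]; simp only [h1, h2, h3]; exact triad_sign hc hε
    have hI : Complex.I ^ 2 = -1 := Complex.I_sq
    have hP : sdP + sdM = sd 1 := by rw [sdP, sdM]; ext i j; simp; ring
    have hM : (-Complex.I) • (sdP - sdM) = sd 2 := by
      rw [sdP, sdM]; ext i j; simp; linear_combination (-sd 2 i j) * hI
    refine ⟨θ, hc, hW, fun A => ?_⟩
    have e0 : (rt⁻¹ * ε) • ε • rt • pull θ (sd 0) = pull θ (sd 0) := by
      rw [smul_smul, smul_smul]
      have : rt⁻¹ * ε * ε * rt = 1 := by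
        have h3 := rt_ne_zero
        field_simp; exact hε
      rw [this, one_smul]
    have e1 : ε • (ε • pull θ sdP + ε • pull θ sdM) = pull θ (sd 1) := by
      rw [← smul_add, smul_smul, ← pow_two, hε, one_smul, ← map_add, hP]
    have e2 : (-Complex.I * ε) • (ε • pull θ sdP - ε • pull θ sdM) = pull θ (sd 2) := by
      rw [← smul_sub, smul_smul, mul_assoc, ← pow_two, hε, mul_one, ← map_sub, ← map_smul, hM]
    fin_cases A
    · simpa [hS, hσε, h1] using e0
    · simpa [hS, hσε, h2, h3] using e1
    · simpa [hS, hσε, h2, h3] using e2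
  obtain ⟨V', hV'V, hV', hpV', θ, hθ⟩ := exists_smooth_coframe hg hΩ hV hVΩ hpV hSs
    fun y hy => (hSθ y hy).imp fun θ h => ⟨h.1, h.2.2⟩
  have hV'Ω : V' ⊆ Ω := hV'V.trans hVΩ
  refine ⟨V', hV'Ω, hV', hpV', fun a y => dualFrame (θ y) a, isOrientedFrameOn_dualFrame hg hΩ hV'Ω
    (fun y hy => (hθ y hy).1) (fun y hy => (hθ y hy).2.2) hV', fun y hy => ?_⟩
  obtain ⟨hc, hA, -⟩ := hθ y hy
  have hU : frameU (g y) (fun a => dualFrame (θ y) a) 1 = rt • pull (θ y) (sd 0) :=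
    frameU_dualFrame hc 0
  have hL : frameLp (g y) (fun a => dualFrame (θ y) a) = pull (θ y) sdP := frameLp_dualFrame hc
  rw [hU, hL]
  -- The canonical form is known for the pointwise coframe θ'. It passes to the smooth θ because
  -- both have the same self-dual bivectors.
  obtain ⟨θ', -, hW, hA'⟩ := hSθ y (hV'V hy)
  have hsd : ∀ A, pull (θ y) (sd A) = pull θ' (sd A) := fun A => (hA A).symm.trans (hA' A)
  have hP : pull (θ y) sdP = pull θ' sdP := by
    simp only [sdP, map_smul, map_add, hsd]
  rw [hW, hsd, hP]

end

end Spacetime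

end

theorem proposition5 (Ω : Set (Fin 4 → ℝ)) (hΩ : IsOpen Ω)
    (g : (Fin 4 → ℝ) → Matrix (Fin 4) (Fin 4) ℝ) (hg : Spacetime.IsLorentzMetricOn Ω g)
    (hIII : ∀ x ∈ Ω, Spacetime.IsTypeIII g x) :
    -- a Weyl principal frame exists near every point
    (∀ p ∈ Ω, ∃ V ⊆ Ω, IsOpen V ∧ p ∈ V ∧
      ∃ e : Fin 4 → (Fin 4 → ℝ) → Fin 4 → ℝ, Spacetime.IsWeylPrincipalFrameOn g V e) ∧
    -- the connection tensor of every Weyl principal frame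
    (∀ V ⊆ Ω, IsOpen V → ∀ e : Fin 4 → (Fin 4 → ℝ) → Fin 4 → ℝ,
      Spacetime.IsWeylPrincipalFrameOn g V e →
      ∀ X : (Fin 4 → ℝ) → Spacetime.Tensor2,
      (∀ μ ν, ContDiffOn ℝ ∞ (fun x => X x μ ν) V) →
      (∀ x ∈ V, (X x).transpose = -X x) →
      (∀ x ∈ V, Spacetime.image (g x) (Spacetime.calW2 g x) (X x) ≠ 0) →
      ∀ s : (Fin 4 → ℝ) → ℂ, ContinuousOn s V →
      (∀ x ∈ V, s x ^ 2 = -Spacetime.form (g x) (Spacetime.calW2 g x) (X x) (X x)) →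
      ∀ x ∈ V,
        -- the denominators do not vanish
        s x ≠ 0 ∧ Spacetime.ip (g x) (Spacetime.weylLp g X s x) (X x) ≠ 0 ∧
        -- the computed bivectors are those of the frame, up to a common sign
        (∃ ε : ℂ, (ε = 1 ∨ ε = -1) ∧
          Spacetime.weylU g X s x = ε • Spacetime.frameU (g x) (fun a => e a x) 1 ∧
          Spacetime.weylLp g X s x = ε • Spacetime.frameLp (g x) (fun a => e a x) ∧
          Spacetime.weylLm g X s x = ε • Spacetime.frameLm (g x) (fun a => e a x)) ∧
        -- the formula for the connection tensor
        ∀ α μ ν, (Spacetime.connTensor g e x α μ ν : ℂ) =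
          (1 / (√2 : ℝ) : ℂ) *
            (Spacetime.calH g (Spacetime.weylU g X s) (Spacetime.weylLp g X s)
                (Spacetime.weylLm g X s) x α μ ν +
              (starRingEnd ℂ) (Spacetime.calH g (Spacetime.weylU g X s) (Spacetime.weylLp g X s)
                (Spacetime.weylLm g X s) x α μ ν))) :=
  ⟨fun _ hp => Spacetime.exists_isWeylPrincipalFrameOn hg hΩ hIII hp,
    fun _ hVΩ hV _ he _ hX _ hne _ hs hs2 _ hx =>
      he.connTensor_eq hg hΩ hV hVΩ hX hne hs hs2 hx⟩
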